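/- Let $\mathbb H=\{\tau\in\mathbb C:\operatorname{Im}\tau>0\}$ and \[ \vartheta_4(z;\tau)=\sum_{n\in\mathbb Z}(-1)^n e^{\pi i n^2\tau+2inz},\qquad \vartheta_3(z;\tau)=\vartheta_4(z+\tfrac{\pi}{2};\tau), \] \[ \vartheta_1(z;\tau)=-i\,e^{iz+\frac14\pi i\tau}\,\vartheta_4(z+\tfrac{\pi}{2}\tau;\tau),\qquad \vartheta_2(z;\tau)=\vartheta_1(z+\tfrac{\pi}{2};\tau) \] for $(z,\tau)\in\mathbb C\times\mathbb H$. The thetanulls are the functions $\vartheta_j(0;\tau)$, $j=2,3,4$. Put $\delta=\frac{1}{\pi i}\frac{\partial}{\partial\tau}$ and $\tilde\vartheta_1(z;\tau)=\vartheta_1(\pi z/2;\tau)$. Let $\Lambda_\tau=2\mathbb Z+2\tau\mathbb Z$, let $\wp(z;\tau)$ be the Weierstrass function of the lattice $\Lambda_\tau$, and let \[ \zeta(z;\tau)=\frac1z+\sum_{0\ne l\in\Lambda_\tau}\Bigl(\frac1{z-l}+\frac1l+\frac z{l^2}\Bigr). \] The polar locus of $\zeta$ (or of $\wp$) is the set of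 $(z,\tau)\in\mathbb C\times\mathbb H$ such that $z$ is a pole of $\zeta(\cdot;\tau)$ (or of $\wp(\cdot;\tau)$). A tuple $\phi=(\phi_1,\dots,\phi_\ell)$ of holomorphic functions on an open set $U\subset\mathbb C^n$ satisfies a rational Noetherian system without poles on $U$ if there are polynomials $Q_{i,j},R_{i,j}\in\mathbb C[x_1,\dots,x_n,y_1,\dots,y_\ell]$ such that, for all $i,j$ and all $x\in U$, $R_{i,j}(x,\phi(x))\neq0$ and $\partial\phi_i/\partial x_j=Q_{i,j}(x,\phi)/R_{i,j}(x,\phi)$. A Noetherian chain on a bounded domain $\Omega\subset\mathbb C^n$ is a tuple $\phi$ of functions that are holomorphic on a neighbourhood of $\overline\Omega$ and satisfy $\partial\phi_i/\partial x_j=P_{i,j}(x,\phi)$ on $\Omega$ with polynomials $P_{i,j}$; a Noetherian function on $\Omega$ is a polynomial in $x$ and some Noetherian chain on $\Omega$. Then: 1. For every $\tau\in\mathbb H$, $\partial_z\zeta(z;\tau)=-\wp(z;\tau)$ for $z\notin\Lambda_\tau$, and $\lim_{z\to0}(\zeta(z;\tau)-z^{-1})=0$. 2. The polar loci of $\zeta$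 and of $\wp$ coincide, and they are equal to $\{(z,\tau)\in\mathbb C\times\mathbb H:\tilde\vartheta_1(z;\tau)=0\}$ and to $\{(z,\tau)\in\mathbb C\times\mathbb H: z\in\Lambda_\tau\}$. Denote this set by $\Sigma$. 3. The six functions $\vartheta_j(0;\tau)$, $\delta\vartheta_j(0;\tau)$ ($j=2,3,4$) of $\tau$ satisfy a rational Noetherian system without poles on $\mathbb H$. The eleven functions $\vartheta_j(0;\tau)$, $\delta\vartheta_j(0;\tau)$ ($j=2,3,4$), $\tilde\vartheta_1$, $\zeta$, $\partial_z\zeta=-\wp$, $\partial_z^2\zeta$, $\partial_z^3\zeta$ of $(z,\tau)$ satisfy a rational Noetherian system without poles on $(\mathbb C\times\mathbb H)\setminus\Sigma$. 4. The thetanulls are Noetherian functions (of $\tau$, respectively of $(z,\tau)$) on every domain whose closure is a compact subset of $\mathbb H$, respectively of $\mathbb C\times\mathbb H$. On every domain $\Omega$ whose closure is a compact subset of $(\mathbb C\times\mathbb H)\setminus\Sigma$, the functions $\tilde\vartheta_1(z;\tau)$, $\zeta(z;\tau)$ and $\wp(z;\tau)$ are Noetherian functions of $(z,\tau)$. -/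

import Mathlib

noncomputable section

/-! ### Theta functions -/

/-- `ϑ(z;τ) = ϑ₄(z;τ) = ∑_{n ∈ ℤ} (-1)^n exp(π i n² τ + 2 i n z)`; the series converges for
`Im τ > 0`. -/
def thetaFour (z τ : ℂ) : ℂ :=
  ∑' n : ℤ, (-1 : ℂ) ^ n *
    Complex.exp (Real.pi * Complex.I * (n : ℂ) ^ 2 * τ + 2 * Complex.I * (n : ℂ) * z)

/-- `ϑ₃(z;τ) = ϑ₄(z + π/2;τ)`. -/
def thetaThree (z τ : ℂ) : ℂ := thetaFour (z + Real.pi / 2) τ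

/-- `ϑ₁(z;τ) = -i exp(i z + π i τ / 4) ϑ₄(z + π τ / 2;τ)`. -/
def thetaOne (z τ : ℂ) : ℂ :=
  -Complex.I * Complex.exp (Complex.I * z + Real.pi * Complex.I * τ / 4) *
    thetaFour (z + Real.pi * τ / 2) τ

/-- `ϑ₂(z;τ) = ϑ₁(z + π/2;τ)`. -/
def thetaTwo (z τ : ℂ) : ℂ := thetaOne (z + Real.pi / 2) τ

/-- The thetanulls `ϑ₂(0;τ)`, `ϑ₃(0;τ)`, `ϑ₄(0;τ)`, numbered `0, 1, 2`. -/
def thetaNull : Fin 3 → ℂ → ℂ :=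
  ![fun τ => thetaTwo 0 τ, fun τ => thetaThree 0 τ, fun τ => thetaFour 0 τ]

/-- The derivation `δ = (1 / (π i)) ∂/∂τ`. -/
def deltaDeriv (f : ℂ → ℂ) (τ : ℂ) : ℂ := 1 / (Real.pi * Complex.I) * deriv f τ

/-- `ϑ₁(π z / 2;τ)`. -/
def thetaOneTilde (z τ : ℂ) : ℂ := thetaOne (Real.pi * z / 2) τ

/-! ### Weierstrass functions with periods `2, 2τ` -/

/-- The pair of periods `2, 2τ` (half-periods `1, τ`). -/
def halfPeriodPair (τ : UpperHalfPlane) : PeriodPair where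
  ω₁ := 2
  ω₂ := 2 * (τ : ℂ)
  indep := by
    rw [LinearIndependent.pair_iff]
    intro s t h
    have him := congrArg Complex.im h
    have hre := congrArg Complex.re h
    simp at him hre
    have ht : t = 0 := by
      rcases him with h | h
      · exact h
      · exact absurd h τ.im_pos.ne'
    subst ht
    simpa using hre

/-- `℘(z;τ)`, the Weierstrass function with periods `2, 2τ`. -/
def wpTau (z : ℂ) (τ : UpperHalfPlane) : ℂ := (halfPeriodPair τ).weierstrassP z

/-- The Weierstrass function
`ζ(z;τ) = 1/z + ∑_{l ≠ 0} (1/(z - l) + 1/l + z/l²)`, `l` in the lattice `2ℤ + 2τℤ`.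
In the code `l = 0` is included in the sum: its term is `1/z`, because division by zero gives
zero. -/
def zetaTau (z : ℂ) (τ : UpperHalfPlane) : ℂ :=
  ∑' l : (halfPeriodPair τ).lattice, (1 / (z - (l : ℂ)) + 1 / (l : ℂ) + z / (l : ℂ) ^ 2)

/-! ### Functions of the two variables `x 0 = z`, `x 1 = τ` -/

/-- The domain `ℂ × ℍ`. -/
def planeTimesUpper : Set (Fin 2 → ℂ) := {x | 0 < (x 1).im}

/-- A function on `ℂ × ℍ` as a function on `ℂ²` (only its values on `ℂ × ℍ` matter). -/
def onPlane (f : ℂ → UpperHalfPlane → ℂ) (x : Fin 2 → ℂ) : ℂ :=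
  f (x 0) (UpperHalfPlane.ofComplex (x 1))

/-- The polar locus: all `(z, τ) ∈ ℂ × ℍ` such that `z` is a pole of `f(·;τ)`. -/
def polarLocus (f : ℂ → UpperHalfPlane → ℂ) : Set (Fin 2 → ℂ) :=
  {x | x ∈ planeTimesUpper ∧
    meromorphicOrderAt (fun z => f z (UpperHalfPlane.ofComplex (x 1))) (x 0) < 0}

/-- The thetanulls followed by their `δ`-derivatives, as functions of `x 0 = τ`. -/
def thetaNullChain : Fin 6 → (Fin 1 → ℂ) → ℂ :=
  ![fun x => thetaNull 0 (x 0), fun x => thetaNull 1 (x 0), fun x => thetaNull 2 (x 0),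
    fun x => deltaDeriv (thetaNull 0) (x 0), fun x => deltaDeriv (thetaNull 1) (x 0),
    fun x => deltaDeriv (thetaNull 2) (x 0)]

/-- The thetanulls, their `δ`-derivatives, `ϑ₁(π z / 2;τ)`, and `ζ` with its first three
`z`-derivatives, as functions of `x 0 = z`, `x 1 = τ`. -/
def thetaZetaChain : Fin 11 → (Fin 2 → ℂ) → ℂ :=
  ![fun x => thetaNull 0 (x 1), fun x => thetaNull 1 (x 1), fun x => thetaNull 2 (x 1),
    fun x => deltaDeriv (thetaNull 0) (x 1), fun x => deltaDeriv (thetaNull 1) (x 1),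
    fun x => deltaDeriv (thetaNull 2) (x 1),
    fun x => thetaOneTilde (x 0) (x 1),
    onPlane zetaTau,
    onPlane fun z τ => iteratedDeriv 1 (fun w => zetaTau w τ) z,
    onPlane fun z τ => iteratedDeriv 2 (fun w => zetaTau w τ) z,
    onPlane fun z τ => iteratedDeriv 3 (fun w => zetaTau w τ) z]

/-! ### Noetherian systems -/

/-- The value of `P(x, φ(x))` for a polynomial `P` in the `n + ℓ` variables `x, φ`. -/
def evalChain {n ℓ : ℕ} (P : MvPolynomial (Fin n ⊕ Fin ℓ) ℂ)
    (φ : Fin ℓ → (Fin n → ℂ) → ℂ) (x : Fin n → ℂ) : ℂ :=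
  MvPolynomial.eval (Sum.elim x fun i => φ i x) P

/-- The partial derivative `∂f/∂x_j` at `x`. -/
def partialAt {n : ℕ} (f : (Fin n → ℂ) → ℂ) (j : Fin n) (x : Fin n → ℂ) : ℂ :=
  fderiv ℂ f x (Pi.single j 1)

/-- `φ` is holomorphic on the open set `U` and satisfies there a rational system
`∂φ_i/∂x_j = Q_{i,j}(x, φ) / R_{i,j}(x, φ)` with polynomials `Q_{i,j}`, `R_{i,j}`, none of whose
denominators `R_{i,j}(x, φ(x))` vanishes at a point of `U`. -/
def SatisfiesRationalSystem {n ℓ : ℕ} (U : Set (Fin n → ℂ))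
    (φ : Fin ℓ → (Fin n → ℂ) → ℂ) : Prop :=
  IsOpen U ∧ (∀ i, AnalyticOnNhd ℂ (φ i) U) ∧
    ∃ Q R : Fin ℓ → Fin n → MvPolynomial (Fin n ⊕ Fin ℓ) ℂ,
      ∀ i j, ∀ x ∈ U, evalChain (R i j) φ x ≠ 0 ∧
        partialAt (φ i) j x = evalChain (Q i j) φ x / evalChain (R i j) φ x

/-- `φ` is a (complex) Noetherian chain on the bounded domain `Ω`: it is holomorphic on a
neighbourhood of the closure of `Ω`, and its partial derivatives are polynomials in `x, φ`. -/
def IsNoetherianChain {n ℓ : ℕ} (Ω : Set (Fin n → ℂ))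
    (φ : Fin ℓ → (Fin n → ℂ) → ℂ) : Prop :=
  IsOpen Ω ∧ IsConnected Ω ∧ Bornology.IsBounded Ω ∧
    (∀ i, AnalyticOnNhd ℂ (φ i) (closure Ω)) ∧
    ∃ P : Fin ℓ → Fin n → MvPolynomial (Fin n ⊕ Fin ℓ) ℂ,
      ∀ i j, ∀ x ∈ Ω, partialAt (φ i) j x = evalChain (P i j) φ x

/-- `F` is a Noetherian function on `Ω`: a polynomial in `x` and a Noetherian chain on `Ω`. -/
def IsNoetherianFunction {n : ℕ} (Ω : Set (Fin n → ℂ)) (F : (Fin n → ℂ) → ℂ) : Prop :=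
  ∃ (ℓ : ℕ) (φ : Fin ℓ → (Fin n → ℂ) → ℂ) (P : MvPolynomial (Fin n ⊕ Fin ℓ) ℂ),
    IsNoetherianChain Ω φ ∧ ∀ x ∈ Ω, F x = evalChain P φ x

/-- `Ω` is a domain (open, connected, non-empty) whose closure is compact and contained in `U`. -/
def IsRelCompactDomain {n : ℕ} (U Ω : Set (Fin n → ℂ)) : Prop :=
  IsOpen Ω ∧ IsConnected Ω ∧ IsCompact (closure Ω) ∧ closure Ω ⊆ U

end

/-! Write `T(z, τ) = ϑ₁(π z / 2; τ)` and `Λ = 2ℤ + 2τℤ`. Everything rests on three facts: the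
multipliers of `T` under `Λ`, the heat equation `∂_τ T = (1/(π i)) ∂_z² T`, and the differential
equation of `℘`.

Multipliers. An entire function with the multipliers of the theta series is a multiple of it,
because shifting the contour by `τ` relates consecutive Fourier coefficients
(`eq_const_mul_jacobiTheta₂`). Hence an elliptic function `h` for which `h T` has only removable
singularities is constant (`eventually_eq_const_of_elliptic`); this takes the place of residue and
zero counting. Applied to suitable functions it shows that the zeros of `T` are exactly `Λ` and are
simple, that `∂_z T / T = ζ + c z` with `c` depending on `τ` only, and that `℘` takes distinct
values `e_j` at the three half periods. The `e_j` are then the roots of `4 x³ - g₂ x - g₃`, so `∑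
e_j = 0` and `g₂ = 2 ∑ e_j²`.

Thetanulls. Up to the exponential of an affine function, `ϑ₂, ϑ₃, ϑ₄` are translates of `T` by half
periods. Being even, they have second and fourth `z`-derivatives at `0` that are polynomials in `c`
and the `e_j` times the thetanull (`exists_thetaEven_taylor`). By the heat equation these
derivatives are, up to powers of `π`, `δ ϑ_j` and `δ² ϑ_j`. With `ψ_j = δ ϑ_j / ϑ_j` this reads `e_j
= c + π² ψ_j`; the relation `∑ e_j = 0` determines `c`, and `δ² ϑ_j` becomes rational in the
thetanulls and their `δ`-derivatives (`thetaNull_main`). The denominators are thetanulls, which have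
no zeros on `ℍ` because half periods are not in `Λ`.

Two variables. Put `L = ζ + c z`. From `∂_z T = T L`, the heat equation and the symmetry of mixed
partials, `∂_τ L = (1/(π i)) (2 L ∂_z L + ∂_z² L)`, which gives `∂_τ ζ` and, after
`z`-differentiation, `∂_τ` of the `z`-derivatives of `ζ`. The chain closes by `ζ'''' = -12 ζ' ζ''`.

Finally, adjoining the inverse of the product of all denominators turns a rational system without
poles into a Noetherian chain (`SatisfiesRationalSystem.isNoetherianFunction`). -/

open Filter Topology

/-! ### Joint analyticity of the Jacobi theta function and the heat equation -/

/-- A series `∑ aₙ(τ) bₙ(z)` of products of normally convergent holomorphic functions is jointly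
analytic: it is a pairing of two Banach-space valued holomorphic functions. -/
theorem analyticOnNhd_tsum_mul {a b : ℤ → ℂ → ℂ} {α β : ℤ → ℝ} {U V : Set ℂ}
    (hU : IsOpen U) (hV : IsOpen V) (hα : Summable α) (hβ : Summable β)
    (ha : ∀ n, DifferentiableOn ℂ (a n) U) (hb : ∀ n, DifferentiableOn ℂ (b n) V)
    (haα : ∀ n, ∀ w ∈ U, ‖a n w‖ ≤ α n) (hbβ : ∀ n, ∀ w ∈ V, ‖b n w‖ ≤ β n) :
    AnalyticOnNhd ℂ (fun p : ℂ × ℂ => ∑' n, a n p.2 * b n p.1) (V ×ˢ U) := by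
  -- The `e n` are the unit functions on `ℤ` and the `δ n` the evaluations, so `δ n (e m)` is the
  -- Kronecker symbol and pairing `∑ aₙ δₙ` with `∑ bₙ eₙ` leaves the diagonal sum `∑ aₙ bₙ`.
  let e : ℤ → BoundedContinuousFunction ℤ ℂ := fun n =>
    BoundedContinuousFunction.ofNormedAddCommGroupDiscrete (Pi.single n (1 : ℂ)) 1 (by
      intro m; by_cases h : m = n
      · subst h; simp
      · simp [h])
  let δ : ℤ → (BoundedContinuousFunction ℤ ℂ →L[ℂ] ℂ) := fun n =>
    BoundedContinuousFunction.evalCLM ℂ n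
  have he : ∀ n, ‖e n‖ ≤ 1 := fun n => by
    refine (BoundedContinuousFunction.norm_le zero_le_one).2 fun m => ?_
    by_cases h : m = n
    · subst h; simp [e]
    · simp [e, h]
  have hδ : ∀ n, ‖δ n‖ ≤ 1 := fun n =>
    ContinuousLinearMap.opNorm_le_bound _ zero_le_one fun f => by
      simpa [δ] using f.norm_coe_le_norm n
  have hδe : ∀ n m, δ n (e m) = if m = n then 1 else 0 := fun n m => by
    by_cases h : m = n
    · subst h; simp [e, δ]
    · have : n ≠ m := fun h' => h h'.symm
      simp [e, δ, h, this]
  have hbe : ∀ n, ∀ w ∈ V, ‖b n w • e n‖ ≤ β n := fun n w hw => by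
    rw [norm_smul]
    exact (mul_le_of_le_one_right (norm_nonneg _) (he n)).trans (hbβ n w hw)
  have haδ : ∀ n, ∀ w ∈ U, ‖a n w • δ n‖ ≤ α n := fun n w hw => by
    rw [norm_smul]
    exact (mul_le_of_le_one_right (norm_nonneg _) (hδ n)).trans (haα n w hw)
  have hu : AnalyticOnNhd ℂ (fun w => ∑' n, b n w • e n) V :=
    (Complex.differentiableOn_tsum_of_summable_norm hβ
      (fun n => (hb n).smul_const (e n)) hV hbe).analyticOnNhd hV
  have hv : AnalyticOnNhd ℂ (fun w => ∑' n, a n w • δ n) U :=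
    (Complex.differentiableOn_tsum_of_summable_norm hα
      (fun n => (ha n).smul_const (δ n)) hU haδ).analyticOnNhd hU
  rintro ⟨z, τ⟩ ⟨hz, hτ⟩
  have hmain : AnalyticAt ℂ (fun p : ℂ × ℂ => (∑' n, a n p.2 • δ n) (∑' n, b n p.1 • e n)) (z, τ) :=
    AnalyticAt.fun_comp
      (g := fun q : (BoundedContinuousFunction ℤ ℂ →L[ℂ] ℂ) × BoundedContinuousFunction ℤ ℂ =>
        ContinuousLinearMap.id ℂ (BoundedContinuousFunction ℤ ℂ →L[ℂ] ℂ) q.1 q.2)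
      (f := fun p : ℂ × ℂ => (∑' n, a n p.2 • δ n, ∑' n, b n p.1 • e n))
      (ContinuousLinearMap.analyticAt_bilinear _ _)
      (AnalyticAt.prod (AnalyticAt.fun_comp (g := fun w => ∑' n, a n w • δ n) (f := Prod.snd)
        (hv τ hτ) analyticAt_snd)
      (AnalyticAt.fun_comp (g := fun w => ∑' n, b n w • e n) (f := Prod.fst)
        (hu z hz) analyticAt_fst))
  refine hmain.congr ?_
  filter_upwards [(hV.prod hU).mem_nhds (show (z, τ) ∈ V ×ˢ U from ⟨hz, hτ⟩)] with p hp
  have hse : Summable fun n => b n p.1 • e n :=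
    Summable.of_norm_bounded hβ fun n => hbe n _ hp.1
  have hsδ : Summable fun n => a n p.2 • δ n :=
    Summable.of_norm_bounded hα fun n => haδ n _ hp.2
  have h1 : ∀ n, δ n (∑' m, b m p.1 • e m) = b n p.1 := fun n => by
    rw [(δ n).map_tsum hse, tsum_eq_single n]
    · simp [hδe]
    · intro m hm; simp [hδe, hm]
  have h2 := (ContinuousLinearMap.apply ℂ ℂ (∑' m, b m p.1 • e m)).map_tsum hsδ
  simp only [ContinuousLinearMap.apply_apply] at h2
  rw [h2]
  refine tsum_congr fun n => ?_
  simp [h1]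

/-- For `T < Im τ` split `τ = (τ - iT/2) + iT/2`. One part of the Gaussian decay stays with the
factor depending on `τ`; the other absorbs the growth of `exp (2 π i n z)` on a strip. Each factor
is then normally summable. -/
theorem analyticAt_jacobiTheta₂ (z : ℂ) {τ : ℂ} (hτ : 0 < τ.im) :
    AnalyticAt ℂ (fun p : ℂ × ℂ => jacobiTheta₂ p.1 p.2) (z, τ) := by
  obtain ⟨T, hT, hTτ⟩ := exists_between hτ
  obtain ⟨S, hS⟩ := exists_gt |z.im|
  have hU : IsOpen {w : ℂ | T < w.im} := isOpen_lt continuous_const Complex.continuous_im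
  have hV : IsOpen {w : ℂ | |w.im| < S} :=
    isOpen_lt (continuous_abs.comp Complex.continuous_im) continuous_const
  have hsum : ∀ s : ℝ, ∀ t : ℝ, 0 < t →
      Summable fun n : ℤ => Real.exp (-Real.pi * (t * n ^ 2 - 2 * s * |(n : ℝ)|)) :=
    fun s t ht => by
    simpa using summable_pow_mul_jacobiTheta₂_term_bound s ht 0
  have key := analyticOnNhd_tsum_mul (U := {w : ℂ | T < w.im}) (V := {w : ℂ | |w.im| < S})
    (a := fun n w => Complex.exp (Real.pi * Complex.I * n ^ 2 * (w - Complex.I * (T / 2 : ℝ))))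
    (b := fun n w => Complex.exp (2 * Real.pi * Complex.I * n * w +
      Real.pi * Complex.I * n ^ 2 * (Complex.I * (T / 2 : ℝ))))
    (α := fun n => Real.exp (-Real.pi * (T / 2 * n ^ 2 - 2 * 0 * |(n : ℝ)|)))
    (β := fun n => Real.exp (-Real.pi * (T / 2 * n ^ 2 - 2 * S * |(n : ℝ)|)))
    hU hV (hsum 0 _ (half_pos hT)) (hsum S _ (half_pos hT))
    (fun n => Differentiable.differentiableOn (by fun_prop))
    (fun n => Differentiable.differentiableOn (by fun_prop)) ?_ ?_ (z, τ) ⟨hS, hTτ⟩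
  · refine key.congr (Eventually.of_forall fun p => ?_)
    refine tsum_congr fun n => ?_
    rw [jacobiTheta₂_term, ← Complex.exp_add]
    congr 1; ring
  · intro n w hw
    have h := norm_jacobiTheta₂_term_le (S := 0) (half_pos hT) (z := 0)
      (τ := w - Complex.I * (T / 2 : ℝ)) (by simp) (by
        simp only [Set.mem_ofPred_eq] at hw
        simp; linarith) n
    simpa [jacobiTheta₂_term] using h
  · intro n w hw
    have h := norm_jacobiTheta₂_term_le (τ := Complex.I * (T / 2 : ℝ)) (half_pos hT)
      (le_of_lt hw) (le_of_eq (by simp)) n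
    simpa [jacobiTheta₂_term] using h

/-- The termwise second `z`-derivative of the theta series. -/
theorem hasSum_deriv_jacobiTheta₂' (z : ℂ) {τ : ℂ} (hτ : 0 < τ.im) :
    HasSum (fun n : ℤ => (2 * Real.pi * Complex.I * n) ^ 2 * jacobiTheta₂_term n z τ)
      (deriv (fun w => jacobiTheta₂' w τ) z) := by
  obtain ⟨S, hS⟩ := exists_gt |z.im|
  have hV : IsOpen {w : ℂ | |w.im| < S} :=
    isOpen_lt (continuous_abs.comp Complex.continuous_im) continuous_const
  have hd : ∀ n : ℤ, Differentiable ℂ fun w => jacobiTheta₂_term n w τ := fun n => by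
    unfold jacobiTheta₂_term; fun_prop
  have hderiv : ∀ (n : ℤ) (w : ℂ), deriv (fun w => jacobiTheta₂'_term n w τ) w =
      (2 * Real.pi * Complex.I * n) ^ 2 * jacobiTheta₂_term n w τ := fun n w => by
    have h : HasDerivAt (fun w => jacobiTheta₂_term n w τ)
        (jacobiTheta₂_term n w τ * (2 * Real.pi * Complex.I * n)) w := by
      unfold jacobiTheta₂_term
      exact (((hasDerivAt_id' w).const_mul _).add_const _).cexp.congr_deriv (by ring)
    refine ((h.const_mul (2 * Real.pi * Complex.I * n)).congr_deriv ?_).deriv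
    ring
  have hsum : Summable fun n : ℤ => 2 * Real.pi *
      (|(n : ℝ)| ^ 1 * Real.exp (-Real.pi * (τ.im * n ^ 2 - 2 * S * |(n : ℝ)|))) :=
    (by simpa using summable_pow_mul_jacobiTheta₂_term_bound S hτ 1 : Summable _).mul_left _
  have h := Complex.hasSum_deriv_of_summable_norm (U := {w : ℂ | |w.im| < S})
    (F := fun n w => jacobiTheta₂'_term n w τ) (z := z) hsum
    (fun n => ((hd n).const_mul _).differentiableOn) hV (fun n w hw => by
      have := norm_jacobiTheta₂'_term_le hτ (le_of_lt hw) le_rfl n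
      simpa [mul_assoc] using this) hS
  simp only [hderiv] at h
  exact h

/-- The heat equation for the two-variable Jacobi theta function. -/
theorem hasFDerivAt_jacobiTheta₂_heat (z : ℂ) {τ : ℂ} (hτ : 0 < τ.im) :
    HasFDerivAt (fun p : ℂ × ℂ => jacobiTheta₂ p.1 p.2)
      (jacobiTheta₂' z τ • ContinuousLinearMap.fst ℂ ℂ ℂ +
        (-Complex.I / (4 * Real.pi) * deriv (fun w => jacobiTheta₂' w τ) z) •
          ContinuousLinearMap.snd ℂ ℂ ℂ) (z, τ) := by
  have h := hasFDerivAt_jacobiTheta₂ z hτ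
  have hs := hasSum_jacobiTheta₂_term_fderiv z hτ
  have h1 : jacobiTheta₂_fderiv z τ (1, 0) = jacobiTheta₂' z τ := by
    have := (ContinuousLinearMap.apply ℂ ℂ ((1 : ℂ), (0 : ℂ))).hasSum hs
    refine this.unique ?_
    refine (hasSum_jacobiTheta₂'_term z hτ).congr_fun fun n => ?_
    simp [jacobiTheta₂_term_fderiv, jacobiTheta₂'_term, jacobiTheta₂_term, mul_comm]
  -- The heat equation holds term by term: `π i n² = -i / (4 π) * (2 π i n)²`.
  have h2 : jacobiTheta₂_fderiv z τ (0, 1) =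
      -Complex.I / (4 * Real.pi) * deriv (fun w => jacobiTheta₂' w τ) z := by
    have := (ContinuousLinearMap.apply ℂ ℂ ((0 : ℂ), (1 : ℂ))).hasSum hs
    refine this.unique ?_
    refine ((hasSum_deriv_jacobiTheta₂' z hτ).mul_left _).congr_fun fun n => ?_
    have hpi : (Real.pi : ℂ) ≠ 0 := by exact_mod_cast Real.pi_ne_zero
    simp only [ContinuousLinearMap.apply_apply, jacobiTheta₂_term_fderiv,
      jacobiTheta₂_term, smul_apply, add_apply,
      ContinuousLinearMap.coe_fst', ContinuousLinearMap.coe_snd', smul_eq_mul]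
    field_simp
    linear_combination 4 * (n : ℂ) ^ 2 * Complex.I_sq
  convert h using 1
  ext
  · simp [h1]
  · simp [h2]

/-! ### Entire functions with the quasi-periodicity of the theta function -/

/-- The integral of a `1`-periodic entire function over a period does not depend on the contour. -/
theorem integral_add_of_periodic {g : ℂ → ℂ} (hg : Differentiable ℂ g)
    (hper : ∀ z, g (z + 1) = g z) (s : ℂ) :
    ∫ x in (0 : ℝ)..1, g (x + s) = ∫ x in (0 : ℝ)..1, g x := by
  obtain ⟨G, hG⟩ := hg.isExactOn_univ
  have hG' : ∀ z, HasDerivAt G (g z) z := fun z => hG z trivial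
  have hint : ∀ s : ℂ, ∫ x in (0 : ℝ)..1, g (x + s) = G (1 + s) - G s := fun s => by
    have h : ∀ x ∈ Set.uIcc (0 : ℝ) 1, HasDerivAt (fun y : ℝ => G (y + s)) (g (x + s)) x :=
      fun x _ => by
        have := ((hG' (x + s)).comp_add_const (x : ℂ) s).comp_ofReal
        exact this
    rw [intervalIntegral.integral_eq_sub_of_hasDerivAt h]
    · simp
    · exact (hg.continuous.comp (by fun_prop :
        Continuous fun x : ℝ => (x : ℂ) + s)).intervalIntegrable
        _ _
  have hconst : ∀ s, HasDerivAt (fun s => G (1 + s) - G s) 0 s := fun s => by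
    have h := ((hG' (1 + s)).comp_const_add 1 s).sub (hG' s)
    rwa [add_comm 1 s, hper, sub_self] at h
  have := is_const_of_deriv_eq_zero (fun s => (hconst s).differentiableAt)
    (fun s => (hconst s).deriv) s 0
  have h0 := hint 0
  simp only [add_zero] at h0 this
  rw [hint, h0, this]

/-- A periodic entire function all of whose Fourier coefficients vanish is zero. -/
theorem eq_zero_of_fourier_eq_zero {f : ℂ → ℂ} (hf : Differentiable ℂ f)
    (hper : ∀ z, f (z + 1) = f z)
    (h : ∀ n : ℤ, ∫ x in (0 : ℝ)..1, Complex.exp (2 * Real.pi * Complex.I * n * x) * f x = 0) :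
    ∀ z, f z = 0 := by
  have : Fact ((0 : ℝ) < 1) := ⟨one_pos⟩
  have hp : Function.Periodic (fun x : ℝ => f x) 1 := fun x => by
    simp [hper]
  let F : C(AddCircle (1 : ℝ), ℂ) := ⟨hp.lift, by
    refine continuous_coinduced_dom.2 ?_
    exact hf.continuous.comp Complex.continuous_ofReal⟩
  have hF : ∀ x : ℝ, F (x : AddCircle (1 : ℝ)) = f x := fun x => rfl
  have hc : fourierCoeff F = 0 := by
    funext n
    rw [fourierCoeff_eq_intervalIntegral _ _ 0]
    have := h (-n)
    simp only [hF, fourier_coe_apply, zero_add, smul_eq_mul, Complex.ofReal_one, div_one]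
    rw [this]; simp
  have hreal : ∀ x : ℝ, f x = 0 := fun x => by
    have hs := has_pointwise_sum_fourier_series_of_summable (f := F)
      (by rw [hc]; exact summable_zero) (x : AddCircle (1 : ℝ))
    rw [hc, hF] at hs
    exact hs.unique (by simp)
  have han : AnalyticOnNhd ℂ f Set.univ := fun z _ => hf.analyticAt z
  have hfreq : ∃ᶠ z in 𝓝[≠] (0 : ℂ), f z = 0 := by
    have ht : Tendsto (fun n : ℕ => (((1 : ℝ) / ((n : ℝ) + 1) : ℝ) : ℂ)) atTop (𝓝[≠] 0) := by
      refine tendsto_nhdsWithin_iff.2 ⟨?_, Eventually.of_forall fun n => ?_⟩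
      · have := (Complex.continuous_ofReal.tendsto 0).comp
          (tendsto_one_div_add_atTop_nhds_zero_nat (𝕜 := ℝ))
        simpa [Function.comp_def] using this
      · have : ((1 : ℝ) / ((n : ℝ) + 1)) ≠ 0 := by positivity
        simpa using Complex.ofReal_ne_zero.2 this
    exact ht.frequently (Eventually.frequently (Eventually.of_forall fun n => hreal _))
  intro z
  exact han.eqOn_zero_of_preconnected_of_frequently_eq_zero isPreconnected_univ (Set.mem_univ 0)
    hfreq (Set.mem_univ z)

/-- Moving the contour by `τ` brings in the factor `exp (-2 π i x)`, which lowers the frequency by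
one. So neighbouring Fourier coefficients differ by a non-zero factor, and the vanishing of one
forces that of all. -/
theorem eq_zero_of_quasiPeriodic_of_integral_eq_zero {f : ℂ → ℂ} {τ : ℂ} (hf : Differentiable ℂ f)
    (h1 : ∀ z, f (z + 1) = f z)
    (hτ : ∀ z, f (z + τ) = Complex.exp (-Real.pi * Complex.I * (τ + 2 * z)) * f z)
    (h0 : ∫ x in (0 : ℝ)..1, f x = 0) : ∀ z, f z = 0 := by
  refine eq_zero_of_fourier_eq_zero hf h1 ?_
  have hstep : ∀ n : ℤ,
      ∫ x in (0 : ℝ)..1, Complex.exp (2 * Real.pi * Complex.I * (n + 1 : ℤ) * x) * f x =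
      Complex.exp (2 * Real.pi * Complex.I * (n + 1) * τ - Real.pi * Complex.I * τ) *
      ∫ x in (0 : ℝ)..1, Complex.exp (2 * Real.pi * Complex.I * n * x) * f x := fun n => by
    have hper : ∀ z, Complex.exp (2 * Real.pi * Complex.I * (n + 1 : ℤ) * (z + 1)) * f (z + 1) =
        Complex.exp (2 * Real.pi * Complex.I * (n + 1 : ℤ) * z) * f z := fun z => by
      rw [h1, mul_add, Complex.exp_add, mul_one, mul_comm (2 * (Real.pi : ℂ) * Complex.I),
        Complex.exp_int_mul_two_pi_mul_I, mul_one]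
    have h := integral_add_of_periodic
      (g := fun z => Complex.exp (2 * Real.pi * Complex.I * (n + 1 : ℤ) * z) * f z)
      (by fun_prop) hper τ
    have h2 := intervalIntegral.integral_const_mul (a := (0 : ℝ)) (b := 1)
      (μ := MeasureTheory.volume)
      (Complex.exp (2 * Real.pi * Complex.I * (n + 1) * τ - Real.pi * Complex.I * τ))
      (fun x : ℝ => Complex.exp (2 * Real.pi * Complex.I * n * x) * f x)
    have h3 : ∫ x in (0 : ℝ)..1,
        Complex.exp (2 * Real.pi * Complex.I * (n + 1 : ℤ) * (x + τ)) * f (x + τ) =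
        Complex.exp (2 * Real.pi * Complex.I * (n + 1) * τ - Real.pi * Complex.I * τ) *
        ∫ x in (0 : ℝ)..1, Complex.exp (2 * Real.pi * Complex.I * n * x) * f x := by
      rw [← h2]
      refine intervalIntegral.integral_congr fun x _ => ?_
      simp only [hτ, ← mul_assoc, ← Complex.exp_add]
      congr 2; push_cast; ring
    rw [← h, h3]
  have hz : ∀ n : ℤ,
      ∫ x in (0 : ℝ)..1, Complex.exp (2 * Real.pi * Complex.I * n * x) * f x = 0 := by
    intro n
    induction n using Int.induction_on with
    | zero => simpa using h0
    | succ n ih => rw [hstep, ih, mul_zero]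
    | pred n ih =>
      have := hstep (-n - 1)
      rw [sub_add_cancel, ih, eq_comm, mul_eq_zero] at this
      exact this.resolve_left (Complex.exp_ne_zero _)
  exact hz

/-- Only the term `n = 0` survives termwise integration. The value `1` fixes the constant in
`eq_const_mul_jacobiTheta₂` and shows that the series is not identically zero. -/
theorem integral_jacobiTheta₂ {τ : ℂ} (hτ : 0 < τ.im) :
    ∫ x in (0 : ℝ)..1, jacobiTheta₂ x τ = 1 := by
  let F : ℤ → C(ℝ, ℂ) := fun n => ⟨fun x => jacobiTheta₂_term n x τ, by
    unfold jacobiTheta₂_term; fun_prop⟩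
  have hb : ∀ n (x : ℝ), ‖F n x‖ ≤ Real.exp (-Real.pi * (τ.im * n ^ 2 - 2 * 0 * |(n : ℝ)|)) :=
    fun n x => by
      have h := norm_jacobiTheta₂_term_le (S := 0) hτ (z := x) (by simp) le_rfl n
      rwa [Int.cast_abs] at h
  have hsum : Summable fun n : ℤ => Real.exp (-Real.pi * (τ.im * n ^ 2 - 2 * 0 * |(n : ℝ)|)) := by
    simpa using summable_pow_mul_jacobiTheta₂_term_bound 0 hτ 0
  have h := intervalIntegral.hasSum_intervalIntegral_of_summable_norm (a := 0) (b := 1) (f := F)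
    (Summable.of_nonneg_of_le (fun n => norm_nonneg _)
      (fun n => (ContinuousMap.norm_le _ (Real.exp_pos _).le).2 fun x => hb n x) hsum)
  have hval : ∀ n : ℤ, ∫ x in (0 : ℝ)..1, F n x = if n = 0 then 1 else 0 := fun n => by
    split_ifs with hn
    · subst hn; simp [F, jacobiTheta₂_term]
    · have hc : (2 * Real.pi * Complex.I * n : ℂ) ≠ 0 := by
        have : (n : ℂ) ≠ 0 := by exact_mod_cast hn
        have := Complex.two_pi_I_ne_zero
        positivity
      have h1 : ∀ x : ℝ, F n x = Complex.exp (2 * Real.pi * Complex.I * n * x) *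
          Complex.exp (Real.pi * Complex.I * n ^ 2 * τ) := fun x => by
        simp [F, jacobiTheta₂_term, Complex.exp_add]
      simp_rw [h1]
      rw [intervalIntegral.integral_mul_const, integral_exp_mul_complex hc]
      have : Complex.exp (2 * Real.pi * Complex.I * n * (1 : ℝ)) = 1 := by
        rw [Complex.ofReal_one, mul_one, mul_comm, Complex.exp_int_mul_two_pi_mul_I]
      rw [this]; simp
  simp_rw [hval] at h
  exact (h.unique (hasSum_ite_eq 0 1))

/-- The functions with the quasi-periodicity of `jacobiTheta₂` form a line. -/
theorem eq_const_mul_jacobiTheta₂ {f : ℂ → ℂ} {τ : ℂ} (hτ : 0 < τ.im) (hf : Differentiable ℂ f)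
    (h1 : ∀ z, f (z + 1) = f z)
    (hfτ : ∀ z, f (z + τ) = Complex.exp (-Real.pi * Complex.I * (τ + 2 * z)) * f z) :
    ∃ c : ℂ, ∀ z, f z = c * jacobiTheta₂ z τ := by
  -- The constant must be the zeroth Fourier coefficient of `f`, since that of the theta series is
  -- `1`.
  set c := ∫ x in (0 : ℝ)..1, f x
  have hJ : Differentiable ℂ fun z => jacobiTheta₂ z τ := fun z =>
    differentiableAt_jacobiTheta₂_fst z hτ
  refine ⟨c, fun z => sub_eq_zero.1 ?_⟩
  refine eq_zero_of_quasiPeriodic_of_integral_eq_zero (f := fun z => f z - c * jacobiTheta₂ z τ)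
    (τ := τ) (by fun_prop) (fun z => ?_) (fun z => ?_) ?_ z
  · rw [h1, jacobiTheta₂_add_left]
  · rw [hfτ, jacobiTheta₂_add_left']; ring
  · rw [intervalIntegral.integral_sub, intervalIntegral.integral_const_mul,
      integral_jacobiTheta₂ hτ, mul_one, sub_self]
    · exact (hf.continuous.comp Complex.continuous_ofReal).intervalIntegrable _ _
    · exact ((hJ.continuous.comp Complex.continuous_ofReal).const_mul c).intervalIntegrable _ _

theorem exists_jacobiTheta₂_ne_zero {τ : ℂ} (hτ : 0 < τ.im) : ∃ z, jacobiTheta₂ z τ ≠ 0 := by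
  by_contra! h
  simpa [h] using integral_jacobiTheta₂ hτ

/-! ### The Weierstrass zeta function -/

namespace PeriodPair

variable (L : PeriodPair)

/-- The summand equals `s² / (l² (s - l))`, of order `‖l‖⁻³`, which is summable over a lattice of
rank `2`. -/
theorem norm_zeta_summand_le (r : ℝ) (hr : 0 < r) (s : ℂ) (hs : ‖s‖ < r) (l : ℂ)
    (h : 2 * r ≤ ‖l‖) :
    ‖1 / (s - l) + 1 / l + s / l ^ 2‖ ≤ 2 * r ^ 2 * ‖l‖ ^ (-3 : ℝ) := by
  have hl : 0 < ‖l‖ := by linarith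
  have hl0 : l ≠ 0 := norm_pos_iff.1 hl
  have hsl : ‖l‖ / 2 ≤ ‖s - l‖ := by
    rw [norm_sub_rev]
    exact .trans (by linarith) (norm_sub_norm_le l s)
  have hsl0 : s - l ≠ 0 := norm_pos_iff.1 (by linarith)
  have h1 : 1 / (s - l) + 1 / l + s / l ^ 2 = s ^ 2 / (l ^ 2 * (s - l)) := by
    field_simp; ring
  rw [h1, norm_div, norm_mul, norm_pow, norm_pow]
  calc ‖s‖ ^ 2 / (‖l‖ ^ 2 * ‖s - l‖) ≤ r ^ 2 / (‖l‖ ^ 2 * (‖l‖ / 2)) := by gcongr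
    _ = 2 * r ^ 2 / ‖l‖ ^ 3 := by field_simp
    _ = _ := by rw [Real.rpow_neg hl.le, div_eq_mul_inv]; norm_cast

/-- The Weierstrass zeta function without the term of the lattice point `l₀`. -/
noncomputable def weierstrassZetaExcept (l₀ z : ℂ) : ℂ :=
  ∑' l : L.lattice, if (l : ℂ) = l₀ then 0 else (1 / (z - l) + 1 / (l : ℂ) + z / (l : ℂ) ^ 2)

/-- The Weierstrass zeta function of a lattice; the summand of `0` is `1 / z`. -/
noncomputable def weierstrassZeta (z : ℂ) : ℂ :=
  ∑' l : L.lattice, (1 / (z - l) + 1 / (l : ℂ) + z / (l : ℂ) ^ 2)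

theorem hasSumLocallyUniformly_weierstrassZetaExcept (l₀ : ℂ) :
    HasSumLocallyUniformly (fun (l : L.lattice) (z : ℂ) =>
      if (l : ℂ) = l₀ then 0 else (1 / (z - l) + 1 / (l : ℂ) + z / (l : ℂ) ^ 2))
      (L.weierstrassZetaExcept l₀) := by
  refine L.hasSumLocallyUniformly_aux (u := (2 * · ^ 2 * ‖·‖ ^ (-3 : ℝ))) _
    (fun _ _ ↦ (ZLattice.summable_norm_rpow _ _ (by simp; norm_num)).mul_left _) fun r hr ↦
    Filter.eventually_atTop.mpr ⟨2 * r, ?_⟩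
  rintro _ h s hs l rfl
  split_ifs
  · simpa using show 0 ≤ 2 * r ^ 2 * (‖(l : ℂ)‖ ^ 3)⁻¹ by positivity
  · exact norm_zeta_summand_le r hr s hs l h

theorem weierstrassZetaExcept_add (l₀ : L.lattice) (z : ℂ) :
    L.weierstrassZetaExcept l₀ z + (1 / (z - l₀) + 1 / (l₀ : ℂ) + z / (l₀ : ℂ) ^ 2) =
      L.weierstrassZeta z := by
  trans L.weierstrassZetaExcept l₀ z + ∑' i : L.lattice,
    if (i : ℂ) = l₀ then (1 / (z - l₀) + 1 / (l₀ : ℂ) + z / (l₀ : ℂ) ^ 2) else 0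
  · simp
  rw [weierstrassZetaExcept, ← Summable.tsum_add]
  · unfold weierstrassZeta
    congr with w; split_ifs <;> simp only [zero_add, add_zero, *]
  · exact ⟨_, (L.hasSumLocallyUniformly_weierstrassZetaExcept _).hasSum⟩
  · exact summable_of_hasFiniteSupport ((Set.finite_singleton l₀).subset (by simp))

theorem hasDerivAt_zeta_summand {l z : ℂ} (h : z - l ≠ 0) :
    HasDerivAt (fun w => 1 / (w - l) + 1 / l + w / l ^ 2) (-(1 / (z - l) ^ 2 - 1 / l ^ 2)) z := by
  have h1 : HasDerivAt (fun w => 1 / (w - l)) (-(1 / (z - l) ^ 2)) z := by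
    have := ((hasDerivAt_id' z).sub_const l).inv h
    simp only [← one_div] at this
    exact this.congr_deriv (by rw [neg_div])
  exact ((h1.add_const _).add ((hasDerivAt_id' z).div_const _)).congr_deriv (by ring)

/-- Locally uniform convergence permits termwise differentiation, and the derivatives of the
summands are minus those of `℘`. Leaving out `l₀` makes this available at the lattice point `l₀`
itself. -/
theorem hasDerivAt_weierstrassZetaExcept (l₀ : ℂ) {z : ℂ} (hz : z ∈ (L.lattice \ {l₀} : Set ℂ)ᶜ) :
    HasDerivAt (L.weierstrassZetaExcept l₀) (-L.weierstrassPExcept l₀ z) z := by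
  have hopen := L.isOpen_compl_lattice_sdiff (s := {l₀})
  have hterm : ∀ (l : L.lattice), ∀ w ∈ (L.lattice \ {l₀} : Set ℂ)ᶜ,
      HasDerivAt (fun w => if (l : ℂ) = l₀ then 0 else
          (1 / (w - l) + 1 / (l : ℂ) + w / (l : ℂ) ^ 2))
        (-(if (l : ℂ) = l₀ then 0 else (1 / (w - l) ^ 2 - 1 / (l : ℂ) ^ 2))) w := by
    intro l w hw
    split_ifs with hl
    · simpa using hasDerivAt_const w (0 : ℂ)
    · exact hasDerivAt_zeta_summand fun e => hl (by
        obtain rfl := sub_eq_zero.1 e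
        simpa using hw)
  have hdiff : ∀ s : Finset L.lattice, ∀ w ∈ (L.lattice \ {l₀} : Set ℂ)ᶜ,
      HasDerivAt (fun w => ∑ l ∈ s, if (l : ℂ) = l₀ then 0 else
        (1 / (w - l) + 1 / (l : ℂ) + w / (l : ℂ) ^ 2))
        (∑ l ∈ s, -(if (l : ℂ) = l₀ then 0 else (1 / (w - l) ^ 2 - 1 / (l : ℂ) ^ 2))) w :=
    fun s w hw => HasDerivAt.fun_sum fun l _ => hterm l w hw
  have hlu : TendstoLocallyUniformlyOn (fun (s : Finset L.lattice) w => ∑ l ∈ s,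
      if (l : ℂ) = l₀ then 0 else (1 / (w - l) + 1 / (l : ℂ) + w / (l : ℂ) ^ 2))
      (L.weierstrassZetaExcept l₀) atTop (L.lattice \ {l₀} : Set ℂ)ᶜ :=
    (L.hasSumLocallyUniformly_weierstrassZetaExcept l₀).tendstoLocallyUniformlyOn
  have hd : ∀ᶠ s : Finset L.lattice in atTop, DifferentiableOn ℂ (fun w => ∑ l ∈ s,
      if (l : ℂ) = l₀ then 0 else (1 / (w - l) + 1 / (l : ℂ) + w / (l : ℂ) ^ 2))
      (L.lattice \ {l₀} : Set ℂ)ᶜ := Eventually.of_forall fun s w hw =>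
    (hdiff s w hw).differentiableAt.differentiableWithinAt
  have h1 := (hlu.deriv hd hopen).tendsto_at hz
  have h2 : HasSum _ _ := (L.hasSum_weierstrassPExcept l₀ z).neg
  have h3 : deriv (L.weierstrassZetaExcept l₀) z = -L.weierstrassPExcept l₀ z := by
    refine tendsto_nhds_unique (h1.congr fun s => ?_) h2
    exact (hdiff s z hz).deriv
  rw [← h3]
  exact ((hlu.differentiableOn hd hopen).differentiableAt (hopen.mem_nhds hz)).hasDerivAt

theorem weierstrassZetaExcept_of_notMem {l₀ : ℂ} (hl : l₀ ∉ L.lattice) :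
    L.weierstrassZetaExcept l₀ = L.weierstrassZeta := by
  delta weierstrassZetaExcept weierstrassZeta
  congr! 3 with z l
  have : (l : ℂ) ≠ l₀ := by rintro rfl; simp at hl
  simp [this]

theorem hasDerivAt_weierstrassZeta {z : ℂ} (hz : z ∉ L.lattice) :
    HasDerivAt L.weierstrassZeta (-L.weierstrassP z) z := by
  -- As `z` is no lattice point, leaving out the term of `z` leaves out nothing.
  rw [← L.weierstrassZetaExcept_of_notMem hz, ← L.weierstrassPExcept_of_notMem z hz]
  exact L.hasDerivAt_weierstrassZetaExcept z (by simp)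

theorem analyticAt_weierstrassZeta {z : ℂ} (hz : z ∉ L.lattice) :
    AnalyticAt ℂ L.weierstrassZeta z :=
  DifferentiableOn.analyticAt (s := (L.lattice : Set ℂ)ᶜ)
    (fun _ hw => (L.hasDerivAt_weierstrassZeta hw).differentiableAt.differentiableWithinAt)
    (L.isClosed_lattice.isOpen_compl.mem_nhds hz)

theorem analyticAt_weierstrassZetaExcept (l₀ : ℂ) :
    AnalyticAt ℂ (L.weierstrassZetaExcept l₀) l₀ :=
  DifferentiableOn.analyticAt (s := (L.lattice \ {l₀} : Set ℂ)ᶜ)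
    (fun _ hw => (L.hasDerivAt_weierstrassZetaExcept l₀ hw).differentiableAt.differentiableWithinAt)
    (L.compl_lattice_sdiff_singleton_mem_nhds l₀)

/-- Near a lattice point, `ζ` is a simple pole plus an analytic function. -/
theorem exists_weierstrassZeta_eq_add {l : ℂ} (hl : l ∈ L.lattice) :
    ∃ g : ℂ → ℂ, AnalyticAt ℂ g l ∧ ∀ z, L.weierstrassZeta z = 1 / (z - l) + g z := by
  refine ⟨fun z => L.weierstrassZetaExcept l z + (1 / l + z / l ^ 2), ?_, fun z => ?_⟩
  · refine (L.analyticAt_weierstrassZetaExcept l).fun_add (analyticAt_const.fun_add ?_)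
    simp only [div_eq_mul_inv]
    exact analyticAt_id.fun_mul analyticAt_const
  · rw [← L.weierstrassZetaExcept_add ⟨l, hl⟩]; ring

theorem exists_weierstrassP_eq_add {l : ℂ} (hl : l ∈ L.lattice) :
    ∃ g : ℂ → ℂ, AnalyticAt ℂ g l ∧ ∀ z, L.weierstrassP z = 1 / (z - l) ^ 2 + g z := by
  refine ⟨fun z => L.weierstrassPExcept l z - 1 / l ^ 2, ?_, fun z => ?_⟩
  · exact (L.analyticAt_weierstrassPExcept l).fun_sub analyticAt_const
  · rw [← L.weierstrassPExcept_add ⟨l, hl⟩]; ring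

theorem meromorphicOrderAt_weierstrassZeta {l : ℂ} (hl : l ∈ L.lattice) :
    meromorphicOrderAt L.weierstrassZeta l = -1 := by
  obtain ⟨g, hg, h⟩ := L.exists_weierstrassZeta_eq_add hl
  trans ↑(-1 : ℤ)
  · rw [meromorphicOrderAt_eq_int_iff]
    · refine ⟨fun z => 1 + (z - l) * g z, by fun_prop, by simp, ?_⟩
      filter_upwards [self_mem_nhdsWithin] with z hz
      have : z - l ≠ 0 := sub_ne_zero.2 hz
      rw [h, zpow_neg_one, smul_eq_mul]
      field_simp
    · rw [funext h]
      exact (MeromorphicAt.div (by fun_prop) (by fun_prop)).fun_add hg.meromorphicAt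
  · rfl

theorem weierstrassZeta_neg (z : ℂ) : L.weierstrassZeta (-z) = -L.weierstrassZeta z := by
  simp only [weierstrassZeta]
  rw [← (Equiv.neg L.lattice).tsum_eq, ← tsum_neg]
  congr with l
  have : -z - -(l : ℂ) = -(z - l) := by ring
  simp only [Equiv.neg_apply, NegMemClass.coe_neg, this, div_neg, neg_sq]
  ring

theorem isPreconnected_compl_lattice : IsPreconnected (L.lattice : Set ℂ)ᶜ := by
  refine (Set.Countable.isConnected_compl_of_one_lt_rank ?_ ?_).isPreconnected
  · exact Complex.rank_real_complex ▸ Cardinal.one_lt_two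
  · have : Countable L.lattice := L.latticeEquivProd.toEquiv.countable_iff.2 inferInstance
    exact Set.countable_coe_iff.1 this

/-- The increment has derivative `℘(z) - ℘(z + l) = 0` on the complement of the lattice, which is
connected. -/
theorem weierstrassZeta_add_coe (l : ℂ) (hl : l ∈ L.lattice) :
    ∃ η : ℂ, ∀ z, z ∉ L.lattice → L.weierstrassZeta (z + l) = L.weierstrassZeta z + η := by
  have hmem : ∀ z, z ∉ L.lattice → z + l ∉ L.lattice := fun z hz h =>
    hz (by simpa using L.lattice.sub_mem h hl)
  have hd : ∀ z ∈ (L.lattice : Set ℂ)ᶜ,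
      HasDerivAt (fun w => L.weierstrassZeta (w + l) - L.weierstrassZeta w) 0 z := fun z hz => by
    have h1 := (L.hasDerivAt_weierstrassZeta (hmem z hz)).comp_add_const z l
    have h2 := L.weierstrassP_add_coe z ⟨l, hl⟩
    simp only at h2
    exact (h1.sub (L.hasDerivAt_weierstrassZeta hz)).congr_deriv (by rw [h2, sub_self])
  obtain ⟨η, hη⟩ := L.isClosed_lattice.isOpen_compl.exists_is_const_of_deriv_eq_zero
    L.isPreconnected_compl_lattice
    (fun z hz => (hd z hz).differentiableAt.differentiableWithinAt) (fun z hz => (hd z hz).deriv)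
  exact ⟨η, fun z hz => by rw [← hη z hz]; ring⟩

/-- The remainder after removing the term of `0` is continuous at `0` and vanishes there term by
term, as `1 / (-l) + 1 / l = 0`. -/
theorem tendsto_weierstrassZeta_sub_inv :
    Tendsto (fun z => L.weierstrassZeta z - z⁻¹) (𝓝[≠] 0) (𝓝 0) := by
  have h0 : L.weierstrassZetaExcept 0 0 = 0 := by
    unfold weierstrassZetaExcept
    rw [← tsum_zero (α := ℂ) (β := L.lattice)]
    refine tsum_congr fun l => ?_
    simp [div_eq_mul_inv, inv_neg]
  have h := (L.analyticAt_weierstrassZetaExcept 0).continuousAt.tendsto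
  rw [h0] at h
  refine (h.mono_left nhdsWithin_le_nhds).congr fun z => ?_
  rw [← L.weierstrassZetaExcept_add 0]
  simp

/-! ### Second derivative of `℘` and its values at half periods -/

theorem hasDerivAt_weierstrassP {z : ℂ} (hz : z ∉ L.lattice) :
    HasDerivAt L.weierstrassP (L.derivWeierstrassP z) z := by
  rw [← L.deriv_weierstrassP]
  exact (L.analyticOnNhd_weierstrassP z hz).differentiableAt.hasDerivAt

theorem eventually_notMem_lattice (x : ℂ) : ∀ᶠ z in 𝓝[≠] x, z ∉ L.lattice := by
  filter_upwards [mem_nhdsWithin_of_mem_nhds (L.compl_lattice_sdiff_singleton_mem_nhds x),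
    self_mem_nhdsWithin] with z hz hzx h
  exact hz ⟨h, hzx⟩

/-- The double pole at `l` excludes this; it is the contradiction at the end of each argument that
would force `℘` to be constant. -/
theorem not_eventually_weierstrassP_eq (k l : ℂ) (hl : l ∈ L.lattice) :
    ¬ ∀ᶠ z in 𝓝[≠] l, L.weierstrassP z = k := by
  intro h
  have h1 := meromorphicOrderAt_congr (f₁ := L.weierstrassP) (f₂ := fun _ => k) h
  rw [L.order_weierstrassP l hl] at h1
  have h2 := (analyticAt_const (𝕜 := ℂ) (v := k) (x := l)).meromorphicOrderAt_nonneg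
  rw [← h1] at h2
  exact absurd h2 (by decide)

/-- `℘'' = 6 ℘² - g₂ / 2`. -/
theorem hasDerivAt_derivWeierstrassP {z : ℂ} (hz : z ∉ L.lattice) :
    HasDerivAt L.derivWeierstrassP (6 * L.weierstrassP z ^ 2 - L.g₂ / 2) z := by
  have hd : ∀ w, w ∉ L.lattice → HasDerivAt L.derivWeierstrassP (deriv L.derivWeierstrassP w) w :=
    fun w hw => (L.analyticOnNhd_derivWeierstrassP w hw).differentiableAt.hasDerivAt
  -- Differentiating `℘'² = 4 ℘³ - g₂ ℘ - g₃` gives the claim multiplied by `℘'`. On a connected set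
  -- one of two analytic factors with product zero vanishes identically, and `℘'` does not, since
  -- `℘` is not constant.
  have hprod : ∀ w ∈ (L.lattice : Set ℂ)ᶜ, L.derivWeierstrassP w *
      (deriv L.derivWeierstrassP w - (6 * L.weierstrassP w ^ 2 - L.g₂ / 2)) = 0 := fun w hw => by
    have h1 := (hd w hw).fun_pow 2
    have h2 := ((((L.hasDerivAt_weierstrassP hw).fun_pow 3).const_mul 4).sub
      ((L.hasDerivAt_weierstrassP hw).const_mul L.g₂)).sub_const L.g₃
    have h3 := h2.unique (h1.congr_of_eventuallyEq (by
      filter_upwards [L.isClosed_lattice.isOpen_compl.mem_nhds hw] with u hu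
      exact (L.derivWeierstrassP_sq u hu).symm))
    norm_num at h3
    linear_combination (-1 / 2) * h3
  have han1 : AnalyticOnNhd ℂ L.derivWeierstrassP (L.lattice : Set ℂ)ᶜ :=
    L.analyticOnNhd_derivWeierstrassP
  have han2 : AnalyticOnNhd ℂ (fun w => deriv L.derivWeierstrassP w -
      (6 * L.weierstrassP w ^ 2 - L.g₂ / 2)) (L.lattice : Set ℂ)ᶜ := fun w hw =>
    (han1 w hw).deriv.fun_sub ((analyticAt_const.fun_mul
      ((L.analyticOnNhd_weierstrassP w hw).fun_pow 2)).fun_sub analyticAt_const)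
  have hz' := hd z hz
  rcases han1.eq_zero_or_eq_zero_of_smul_eq_zero han2 hprod L.isPreconnected_compl_lattice
    with h | h
  · exfalso
    obtain ⟨k, hk⟩ := L.isClosed_lattice.isOpen_compl.exists_is_const_of_deriv_eq_zero
      L.isPreconnected_compl_lattice
      (fun w hw => (L.hasDerivAt_weierstrassP hw).differentiableAt.differentiableWithinAt)
      (fun w hw => by rw [L.deriv_weierstrassP]; exact h w hw)
    exact L.not_eventually_weierstrassP_eq k 0 L.lattice.zero_mem
      ((L.eventually_notMem_lattice 0).mono fun w hw => hk w hw)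
  · rwa [sub_eq_zero.1 (h z hz)] at hz'

/-- `℘'` is odd, while `a` and `-a` are congruent modulo the lattice. -/
theorem derivWeierstrassP_half_period {a : ℂ} (h2 : 2 * a ∈ L.lattice) :
    L.derivWeierstrassP a = 0 := by
  have h := L.derivWeierstrassP_add_coe (-a) ⟨2 * a, h2⟩
  rw [L.derivWeierstrassP_neg] at h
  have h3 : -a + 2 * a = a := by ring
  simp only [h3] at h
  linear_combination h / 2

end PeriodPair

/-! ### Quasi-periodicity of the theta functions -/

/-- The sign `(-1)^n = exp (π i n)` is a translation by `1 / 2`. -/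
theorem thetaFour_eq (z τ : ℂ) : thetaFour z τ = jacobiTheta₂ (z / Real.pi + 1 / 2) τ := by
  have hpi : (Real.pi : ℂ) ≠ 0 := by exact_mod_cast Real.pi_ne_zero
  refine tsum_congr fun n => ?_
  rw [jacobiTheta₂_term, ← Complex.exp_pi_mul_I, ← Complex.exp_int_mul, ← Complex.exp_add]
  congr 1; field_simp; ring

theorem thetaOneTilde_eq (z τ : ℂ) : thetaOneTilde z τ =
    -Complex.I * Complex.exp (Real.pi * Complex.I * (z / 2 + τ / 4)) *
      jacobiTheta₂ (z / 2 + τ / 2 + 1 / 2) τ := by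
  have hpi : (Real.pi : ℂ) ≠ 0 := by exact_mod_cast Real.pi_ne_zero
  rw [thetaOneTilde, thetaOne, thetaFour_eq]
  congr 2
  · congr 2; ring
  · field_simp

theorem thetaOneTilde_neg (z τ : ℂ) : thetaOneTilde (-z) τ = -thetaOneTilde z τ := by
  rw [thetaOneTilde_eq, thetaOneTilde_eq, ← jacobiTheta₂_neg_left,
    show -(-z / 2 + τ / 2 + 1 / 2) = z / 2 - τ / 2 - 1 / 2 by ring,
    ← jacobiTheta₂_add_left, show z / 2 + τ / 2 + 1 / 2 = (z / 2 - τ / 2 - 1 / 2 + 1) + τ by ring,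
    jacobiTheta₂_add_left']
  rw [show Real.pi * Complex.I * (-z / 2 + τ / 4) = Real.pi * Complex.I * (z / 2 + τ / 4) +
    (-Real.pi * Complex.I * (τ + 2 * (z / 2 - τ / 2 - 1 / 2 + 1)) + Real.pi * Complex.I) by ring,
    Complex.exp_add, Complex.exp_add _ (Real.pi * Complex.I), Complex.exp_pi_mul_I]
  ring

theorem thetaOneTilde_add_two (z τ : ℂ) : thetaOneTilde (z + 2) τ = -thetaOneTilde z τ := by
  rw [thetaOneTilde_eq, thetaOneTilde_eq,
    show (z + 2) / 2 + τ / 2 + 1 / 2 = (z / 2 + τ / 2 + 1 / 2) + 1 by ring, jacobiTheta₂_add_left,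
    show Real.pi * Complex.I * ((z + 2) / 2 + τ / 4) = Real.pi * Complex.I * (z / 2 + τ / 4) +
      Real.pi * Complex.I by ring, Complex.exp_add, Complex.exp_pi_mul_I]
  ring

theorem thetaOneTilde_add_two_mul (z τ : ℂ) : thetaOneTilde (z + 2 * τ) τ =
    -Complex.exp (-Real.pi * Complex.I * (τ + z)) * thetaOneTilde z τ := by
  rw [thetaOneTilde_eq, thetaOneTilde_eq,
    show (z + 2 * τ) / 2 + τ / 2 + 1 / 2 = (z / 2 + τ / 2 + 1 / 2) + τ by ring,
    jacobiTheta₂_add_left',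
    show Real.pi * Complex.I * ((z + 2 * τ) / 2 + τ / 4) = Real.pi * Complex.I * (z / 2 + τ / 4) +
      Real.pi * Complex.I * τ by ring,
    show -Real.pi * Complex.I * (τ + 2 * (z / 2 + τ / 2 + 1 / 2)) =
      -Real.pi * Complex.I * (τ + z) + (-(Real.pi * Complex.I * τ) + -(Real.pi * Complex.I)) by
        ring,
    Complex.exp_add, Complex.exp_add, Complex.exp_add, Complex.exp_neg (Real.pi * Complex.I),
    Complex.exp_pi_mul_I, Complex.exp_neg (Real.pi * Complex.I * τ)]
  field_simp [Complex.exp_ne_zero]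

theorem differentiable_thetaOneTilde {τ : ℂ} (hτ : 0 < τ.im) :
    Differentiable ℂ fun z => thetaOneTilde z τ := by
  have hJ : Differentiable ℂ fun z => jacobiTheta₂ z τ := fun z =>
    differentiableAt_jacobiTheta₂_fst z hτ
  simp only [thetaOneTilde_eq]
  have h2 : Differentiable ℂ fun z => jacobiTheta₂ (z / 2 + τ / 2 + 1 / 2) τ :=
    hJ.comp (f := fun z => z / 2 + τ / 2 + 1 / 2) (by fun_prop)
  fun_prop

theorem mem_halfPeriodPair_lattice {τ : UpperHalfPlane} {z : ℂ} :
    z ∈ (halfPeriodPair τ).lattice ↔ ∃ m n : ℤ, z = 2 * (m : ℂ) + 2 * (n : ℂ) * τ := by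
  rw [PeriodPair.mem_lattice]
  refine exists_congr fun m => exists_congr fun n => ?_
  simp only [halfPeriodPair]
  constructor
  · intro h; rw [← h]; ring
  · intro h; rw [h]; ring

/-- Translation by a lattice point multiplies `ϑ₁` by the exponential of an affine function. -/
theorem exists_thetaOneTilde_add {τ : UpperHalfPlane} {l : ℂ}
    (hl : l ∈ (halfPeriodPair τ).lattice) :
    ∃ α β : ℂ, ∀ z, thetaOneTilde (z + l) τ = Complex.exp (α + β * z) * thetaOneTilde z τ := by
  rw [PeriodPair.lattice] at hl
  induction hl using Submodule.span_induction with
  | mem x hx =>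
    rcases hx with rfl | rfl
    · exact ⟨Real.pi * Complex.I, 0, fun z => by
        simp [halfPeriodPair, thetaOneTilde_add_two, Complex.exp_pi_mul_I]⟩
    · refine ⟨Real.pi * Complex.I - Real.pi * Complex.I * τ, -(Real.pi * Complex.I), fun z => ?_⟩
      simp only [halfPeriodPair, thetaOneTilde_add_two_mul]
      rw [show Real.pi * Complex.I - Real.pi * Complex.I * τ + -(Real.pi * Complex.I) * z =
        -Real.pi * Complex.I * (τ + z) + Real.pi * Complex.I by ring, Complex.exp_add,
        Complex.exp_pi_mul_I]
      ring
  | zero => exact ⟨0, 0, fun z => by simp⟩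
  | add x y _ _ hx hy =>
    obtain ⟨a, b, hx⟩ := hx
    obtain ⟨c, d, hy⟩ := hy
    -- The exponent of the second translation is taken at `z + x`, whence the constant `d * x`.
    refine ⟨a + c + d * x, b + d, fun z => ?_⟩
    rw [← add_assoc, hy, hx, ← mul_assoc, ← Complex.exp_add]
    congr 2; ring
  | smul n x _ hx =>
    obtain ⟨a, b, hx⟩ := hx
    induction n using Int.induction_on with
    | zero => exact ⟨0, 0, fun z => by simp⟩
    | succ n ih =>
      obtain ⟨c, d, ih⟩ := ih
      refine ⟨c + a + b * ((n : ℤ) • x), b + d, fun z => ?_⟩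
      rw [add_smul, one_smul, ← add_assoc, hx, ih, ← mul_assoc, ← Complex.exp_add]
      congr 2; ring
    | pred n ih =>
      obtain ⟨c, d, ih⟩ := ih
      refine ⟨c - (a + b * ((-(n : ℤ) - 1) • x)), d - b, fun z => ?_⟩
      have h := hx (z + (-(n : ℤ) - 1) • x)
      have h' : z + (-(n : ℤ) - 1) • x + x = z + (-(n : ℤ)) • x := by
        rw [sub_smul, one_smul]; ring
      rw [h', ih] at h
      have : thetaOneTilde (z + (-(n : ℤ) - 1) • x) τ =
          Complex.exp (-(a + b * (z + (-(n : ℤ) - 1) • x))) *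
          (Complex.exp (c + d * z) * thetaOneTilde z τ) := by
        rw [h, ← mul_assoc, ← Complex.exp_add]; simp
      rw [this, ← mul_assoc, ← Complex.exp_add]
      congr 2; ring

theorem thetaOneTilde_add_eq_zero_iff {τ : UpperHalfPlane} {l : ℂ}
    (hl : l ∈ (halfPeriodPair τ).lattice) (z : ℂ) :
    thetaOneTilde (z + l) τ = 0 ↔ thetaOneTilde z τ = 0 := by
  obtain ⟨α, β, h⟩ := exists_thetaOneTilde_add hl
  rw [h, mul_eq_zero, or_iff_right (Complex.exp_ne_zero _)]

/-- An odd function vanishes at `0`, and translations by the lattice preserve the zeros. -/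
theorem thetaOneTilde_eq_zero_of_mem {τ : UpperHalfPlane} {l : ℂ}
    (hl : l ∈ (halfPeriodPair τ).lattice) : thetaOneTilde l τ = 0 := by
  have h0 := thetaOneTilde_neg 0 τ
  have h := (thetaOneTilde_add_eq_zero_iff hl 0).2 (by
    rw [neg_zero] at h0
    linear_combination h0 / 2)
  rwa [zero_add] at h

theorem eventually_thetaOneTilde_ne_zero {τ : ℂ} (hτ : 0 < τ.im) (x : ℂ) :
    ∀ᶠ z in 𝓝[≠] x, thetaOneTilde z τ ≠ 0 := by
  have hd := differentiable_thetaOneTilde hτ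
  refine (hd.analyticAt x).eventually_eq_zero_or_eventually_ne_zero.resolve_left fun h => ?_
  obtain ⟨u, hu⟩ := exists_jacobiTheta₂_ne_zero hτ
  have h0 := AnalyticOnNhd.eqOn_zero_of_preconnected_of_eventuallyEq_zero
    (fun z _ => hd.analyticAt z) isPreconnected_univ (Set.mem_univ x) h
    -- The point `2 u - τ - 1` is sent to `u` by `z ↦ z / 2 + τ / 2 + 1 / 2`, the argument of the
    -- theta series in `ϑ₁`.
    (Set.mem_univ (2 * u - τ - 1))
  simp only [thetaOneTilde_eq, Pi.zero_apply] at h0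
  rw [show (2 * u - τ - 1) / 2 + τ / 2 + 1 / 2 = u by ring] at h0
  simp [hu, Complex.exp_ne_zero] at h0

/-! ### Elliptic functions whose poles are compensated by the zeros of `ϑ₁` -/

theorem eq_of_eventuallyEq_nhdsNE {f g : ℂ → ℂ} {x : ℂ} (hf : ContinuousAt f x)
    (hg : ContinuousAt g x) (h : f =ᶠ[𝓝[≠] x] g) : f x = g x :=
  ((hf.eventuallyEq_nhds_iff_eventuallyEq_nhdsNE hg).1 h).eq_of_nhds

/-- Functions which are analytic up to removable singularities extend to entire functions. -/
theorem exists_differentiable_eventuallyEq {f : ℂ → ℂ}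
    (hf : ∀ x, ∃ g : ℂ → ℂ, AnalyticAt ℂ g x ∧ f =ᶠ[𝓝[≠] x] g) :
    ∃ w : ℂ → ℂ, Differentiable ℂ w ∧ ∀ x, f =ᶠ[𝓝[≠] x] w := by
  choose g hg hfg using hf
  -- The extension takes at each point the value of the local extension there. Near `x` it agrees
  -- with `g x`, because at `z ≠ x` both `g z` and `g x` are continuous extensions of the same germ
  -- of `f`.
  have key : ∀ x, (fun z => g z z) =ᶠ[𝓝 x] g x := fun x => by
    have h1 : ∀ᶠ z in 𝓝[≠] x, g z z = g x z := by
      filter_upwards [eventually_eventually_nhdsWithin.2 (hfg x),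
        nhdsWithin_le_nhds (hg x).eventually_analyticAt, self_mem_nhdsWithin] with z hz haz hzx
      have hz' : ∀ᶠ y in 𝓝[≠] z, f y = g x y := by
        have hopen : ({x}ᶜ : Set ℂ) ∈ 𝓝 z := isOpen_compl_singleton.mem_nhds hzx
        rw [nhdsWithin_eq_nhds.2 hopen] at hz
        exact nhdsWithin_le_nhds hz
      refine eq_of_eventuallyEq_nhdsNE (hg z).continuousAt haz.continuousAt ?_
      filter_upwards [hfg z, hz'] with y h1 h2
      rw [← h1, h2]
    rw [eventually_nhdsWithin_iff] at h1
    filter_upwards [h1] with z hz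
    by_cases hzx : z = x
    · rw [hzx]
    · exact hz hzx
  refine ⟨fun z => g z z, fun x => ((hg x).congr (key x).symm).differentiableAt, fun x => ?_⟩
  filter_upwards [hfg x, nhdsWithin_le_nhds (key x)] with z h1 h2
  rw [h1, h2]

theorem tendsto_add_nhdsNE (x l : ℂ) : Tendsto (fun z => z + l) (𝓝[≠] x) (𝓝[≠] (x + l)) := by
  refine tendsto_nhdsWithin_iff.2 ⟨?_, ?_⟩
  · exact ((continuous_add_const l).tendsto x).mono_left nhdsWithin_le_nhds
  · filter_upwards [self_mem_nhdsWithin] with z hz h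
    exact hz (add_right_cancel h)

/-- The product `h ϑ₁` extends to an entire function with the same multipliers as `ϑ₁`. Such
functions form a line, so it is a constant multiple of `ϑ₁`, and `h` is that constant away from the
zeros. In every use, the poles of `h` are matched by zeros of `ϑ₁`. -/
theorem eventually_eq_const_of_elliptic (τ : UpperHalfPlane) {h : ℂ → ℂ}
    (hper : ∀ l ∈ (halfPeriodPair τ).lattice, ∀ x, ∀ᶠ z in 𝓝[≠] x, h (z + l) = h z)
    (hreg : ∀ x, ∃ g : ℂ → ℂ, AnalyticAt ℂ g x ∧
      (fun z => h z * thetaOneTilde z τ) =ᶠ[𝓝[≠] x] g) :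
    ∃ k : ℂ, ∀ x, ∀ᶠ z in 𝓝[≠] x, h z = k := by
  obtain ⟨w, hw, hwh⟩ := exists_differentiable_eventuallyEq hreg
  have h2 : ∀ z, w (z + 2) = -w z := fun x => by
    have hc : Continuous w := hw.continuous
    refine eq_of_eventuallyEq_nhdsNE (f := fun z => w (z + 2)) (g := fun z => -w z)
      (by fun_prop) (by fun_prop) ?_
    have hm : (2 : ℂ) ∈ (halfPeriodPair τ).lattice := (halfPeriodPair τ).ω₁_mem_lattice
    filter_upwards [hwh x, (tendsto_add_nhdsNE x 2).eventually (hwh _), hper 2 hm x] with z a b c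
    rw [← a, ← b, c, thetaOneTilde_add_two]; ring
  have hτ2 : ∀ z, w (z + 2 * τ) = -Complex.exp (-Real.pi * Complex.I * (τ + z)) * w z := fun x => by
    have hc : Continuous w := hw.continuous
    refine eq_of_eventuallyEq_nhdsNE (f := fun z => w (z + 2 * τ))
      (g := fun z => -Complex.exp (-Real.pi * Complex.I * (τ + z)) * w z)
      (by fun_prop) (by fun_prop) ?_
    have hm : (2 * τ : ℂ) ∈ (halfPeriodPair τ).lattice := (halfPeriodPair τ).ω₂_mem_lattice
    filter_upwards [hwh x, (tendsto_add_nhdsNE x (2 * τ)).eventually (hwh _), hper _ hm x]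
      with z a b c
    rw [← a, ← b, c, thetaOneTilde_add_two_mul]; ring
  -- The substitution `z = 2 u - τ - 1` and the factor `exp (-π i z / 2)` undo, up to a constant,
  -- the passage from the theta series to `ϑ₁`.
  obtain ⟨c, hc⟩ := eq_const_mul_jacobiTheta₂ (τ := τ)
    (f := fun u => w (2 * u - τ - 1) * Complex.exp (-(Real.pi * Complex.I * ((2 * u - τ - 1) / 2))))
    τ.im_pos (by fun_prop) (fun u => by
      rw [show 2 * (u + 1) - (τ : ℂ) - 1 = (2 * u - τ - 1) + 2 by ring, h2,
        show -(Real.pi * Complex.I * ((2 * u - τ - 1 + 2) / 2)) =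
          -(Real.pi * Complex.I * ((2 * u - τ - 1) / 2)) + -(Real.pi * Complex.I) by ring,
        Complex.exp_add, Complex.exp_neg (Real.pi * Complex.I), Complex.exp_pi_mul_I]
      ring) (fun u => by
      rw [show 2 * (u + τ) - (τ : ℂ) - 1 = (2 * u - τ - 1) + 2 * τ by ring, hτ2,
        show -(Real.pi * Complex.I * ((2 * u - τ - 1 + 2 * τ) / 2)) =
          -(Real.pi * Complex.I * ((2 * u - τ - 1) / 2)) + -(Real.pi * Complex.I * τ) by ring,
        show -Real.pi * Complex.I * (τ + 2 * u) = -Real.pi * Complex.I * (τ + (2 * u - τ - 1)) +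
          (-(Real.pi * Complex.I * τ) + -(Real.pi * Complex.I)) by
        ring,
        Complex.exp_add, Complex.exp_add, Complex.exp_add _ (-(Real.pi * Complex.I)),
        Complex.exp_neg (Real.pi * Complex.I), Complex.exp_pi_mul_I]
      ring)
  -- The divisor is the part of the prefactor of `ϑ₁` that does not depend on `z`.
  refine ⟨c / (-Complex.I * Complex.exp (Real.pi * Complex.I * (τ / 4))), fun x => ?_⟩
  filter_upwards [hwh x, eventually_thetaOneTilde_ne_zero τ.im_pos x] with z hz ht
  have h3 := hc (z / 2 + τ / 2 + 1 / 2)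
  rw [show 2 * (z / 2 + (τ : ℂ) / 2 + 1 / 2) - τ - 1 = z by ring, ← hz] at h3
  have h4 := thetaOneTilde_eq z τ
  have hI := Complex.I_ne_zero
  have he := Complex.exp_ne_zero (Real.pi * Complex.I * (τ / 4))
  refine mul_right_cancel₀ ht ?_
  rw [mul_add, Complex.exp_add] at h4
  rw [Complex.exp_neg] at h3
  have he2 := Complex.exp_ne_zero (Real.pi * Complex.I * (z / 2))
  have h5 : h z * thetaOneTilde z τ = c * jacobiTheta₂ (z / 2 + τ / 2 + 1 / 2) τ *
      Complex.exp (Real.pi * Complex.I * (z / 2)) := by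
    rw [← h3]; field_simp
  rw [h5, h4]
  field_simp

/-! ### Zeros of `ϑ₁` -/

theorem AnalyticAt.exists_eq_sub_mul {f : ℂ → ℂ} {x : ℂ} (hf : AnalyticAt ℂ f x) (h0 : f x = 0) :
    ∃ u : ℂ → ℂ, AnalyticAt ℂ u x ∧ ∀ᶠ z in 𝓝 x, f z = (z - x) * u z := by
  have h : ((1 : ℕ) : ℕ∞) ≤ analyticOrderAt f x :=
    (natCast_le_analyticOrderAt_iff_iteratedDeriv_eq_zero hf).2 fun i hi => by
      obtain rfl : i = 0 := by omega
      simpa using h0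
  obtain ⟨u, hu, hfu⟩ := (natCast_le_analyticOrderAt hf).1 h
  exact ⟨u, hu, by simpa using hfu⟩

theorem AnalyticAt.exists_eq_sub_sq_mul {f : ℂ → ℂ} {x : ℂ} (hf : AnalyticAt ℂ f x) (h0 : f x = 0)
    (h1 : deriv f x = 0) :
    ∃ u : ℂ → ℂ, AnalyticAt ℂ u x ∧ ∀ᶠ z in 𝓝 x, f z = (z - x) ^ 2 * u z := by
  have h : ((2 : ℕ) : ℕ∞) ≤ analyticOrderAt f x :=
    (natCast_le_analyticOrderAt_iff_iteratedDeriv_eq_zero hf).2 fun i hi => by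
      interval_cases i
      · simpa using h0
      · simpa using h1
  obtain ⟨u, hu, hfu⟩ := (natCast_le_analyticOrderAt hf).1 h
  exact ⟨u, hu, by simpa using hfu⟩

section ThetaOne

variable {τ : UpperHalfPlane}

theorem analyticAt_thetaOneTilde (τ : UpperHalfPlane) (z : ℂ) :
    AnalyticAt ℂ (fun z => thetaOneTilde z τ) z :=
  (differentiable_thetaOneTilde τ.im_pos).analyticAt z

/-- With a zero `a` off the lattice, `ζ(z) - ζ(z - a)` would be elliptic, since the increments of
`ζ` cancel, and its simple poles on the lattice and on the translate by `a` would be killed by zeros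
of `ϑ₁`. It would be constant, yet it has a pole at `0`. -/
theorem mem_lattice_of_thetaOneTilde_eq_zero {a : ℂ} (ha : thetaOneTilde a τ = 0) :
    a ∈ (halfPeriodPair τ).lattice := by
  by_contra hna
  set L := halfPeriodPair τ
  have htran : ∀ x, x - a ∈ L.lattice → thetaOneTilde x τ = 0 := fun x hx => by
    have := (thetaOneTilde_add_eq_zero_iff hx a).2 ha
    rwa [add_sub_cancel] at this
  have hshift : ∀ x, x - a ∉ L.lattice → AnalyticAt ℂ (fun z => L.weierstrassZeta (z - a)) x :=
    fun x hx => (L.analyticAt_weierstrassZeta hx).fun_comp (f := fun z => z - a) (by fun_prop)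
  have hnot : ∀ x, ∀ l ∈ L.lattice, x ∉ L.lattice → x + l ∉ L.lattice := fun x l hl hx h =>
    hx (by simpa using L.lattice.sub_mem h hl)
  obtain ⟨k, hk⟩ := eventually_eq_const_of_elliptic τ
    (h := fun z => L.weierstrassZeta z - L.weierstrassZeta (z - a)) (fun l hl x => by
      obtain ⟨η, hη⟩ := L.weierstrassZeta_add_coe l hl
      have hcomp : ∀ᶠ z in 𝓝[≠] x, z - a ∉ L.lattice :=
        (tendsto_add_nhdsNE x (-a)).eventually (L.eventually_notMem_lattice (x + -a))
      filter_upwards [L.eventually_notMem_lattice x, hcomp] with z h1 h2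
      rw [hη z h1, show z + l - a = z - a + l by ring, hη _ h2]
      ring) (fun x => by
      have ht := analyticAt_thetaOneTilde τ x
      by_cases hx : x ∈ L.lattice
      · have hxa : x - a ∉ L.lattice := fun h => hna (by
          simpa using L.lattice.sub_mem hx h)
        obtain ⟨g, hg, hζ⟩ := L.exists_weierstrassZeta_eq_add hx
        obtain ⟨u, hu, htu⟩ := ht.exists_eq_sub_mul (thetaOneTilde_eq_zero_of_mem hx)
        refine ⟨fun z => u z + (g z - L.weierstrassZeta (z - a)) * thetaOneTilde z τ,
          hu.fun_add ((hg.fun_sub (hshift x hxa)).fun_mul ht), ?_⟩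
        filter_upwards [nhdsWithin_le_nhds htu, self_mem_nhdsWithin] with z hz hzx
        have : z - x ≠ 0 := sub_ne_zero.2 hzx
        rw [hζ, hz]; field_simp; ring
      · by_cases hxa : x - a ∈ L.lattice
        · obtain ⟨g, hg, hζ⟩ := L.exists_weierstrassZeta_eq_add hxa
          obtain ⟨u, hu, htu⟩ := ht.exists_eq_sub_mul (htran x hxa)
          have hg' : AnalyticAt ℂ (fun z => g (z - a)) x :=
            hg.fun_comp (f := fun z => z - a) (by fun_prop)
          refine ⟨fun z => (L.weierstrassZeta z - g (z - a)) * thetaOneTilde z τ - u z,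
            (((L.analyticAt_weierstrassZeta hx).fun_sub hg').fun_mul ht).fun_sub hu, ?_⟩
          filter_upwards [nhdsWithin_le_nhds htu, self_mem_nhdsWithin] with z hz hzx
          have : z - x ≠ 0 := sub_ne_zero.2 hzx
          rw [hζ (z - a), hz, show z - a - (x - a) = z - x by ring]; field_simp; ring
        · exact ⟨_, ((L.analyticAt_weierstrassZeta hx).fun_sub (hshift x hxa)).fun_mul ht,
            EventuallyEq.rfl⟩)
  have h0a : (0 : ℂ) - a ∉ L.lattice := fun h => hna (by
    simpa using L.lattice.neg_mem h)
  have h1 : L.weierstrassZeta =ᶠ[𝓝[≠] 0] fun z => k + L.weierstrassZeta (z - a) := by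
    filter_upwards [hk 0] with z hz
    rw [← hz]; ring
  have h2 := meromorphicOrderAt_congr h1
  rw [L.meromorphicOrderAt_weierstrassZeta L.lattice.zero_mem] at h2
  have h3 := (analyticAt_const.fun_add (hshift 0 h0a) :
    AnalyticAt ℂ (fun z => k + L.weierstrassZeta (z - a)) 0).meromorphicOrderAt_nonneg
  rw [← h2] at h3
  exact absurd h3 (by decide)

theorem thetaOneTilde_eq_zero_iff {a : ℂ} :
    thetaOneTilde a τ = 0 ↔ a ∈ (halfPeriodPair τ).lattice :=
  ⟨mem_lattice_of_thetaOneTilde_eq_zero, thetaOneTilde_eq_zero_of_mem⟩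

theorem deriv_thetaOneTilde_add {l α β : ℂ}
    (h : ∀ z, thetaOneTilde (z + l) τ = Complex.exp (α + β * z) * thetaOneTilde z τ) (z : ℂ) :
    deriv (fun z => thetaOneTilde z τ) (z + l) =
      Complex.exp (α + β * z) * (β * thetaOneTilde z τ + deriv (fun z => thetaOneTilde z τ) z) := by
  have hd := differentiable_thetaOneTilde τ.im_pos
  have h1 : HasDerivAt (fun z => thetaOneTilde (z + l) τ)
      (deriv (fun z => thetaOneTilde z τ) (z + l)) z :=
    (hd (z + l)).hasDerivAt.comp_add_const z l
  have h2 : HasDerivAt (fun z => Complex.exp (α + β * z)) (Complex.exp (α + β * z) * β) z :=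
    (((hasDerivAt_id' z).const_mul β).const_add α).cexp.congr_deriv (by ring)
  have h3 := h2.mul (hd z).hasDerivAt
  rw [funext h] at h1
  rw [h1.unique h3]; ring

/-- A multiple zero at one lattice point is, by translation, a multiple zero at all of them. Then `℘
ϑ₁` has no poles and `℘` is constant. -/
theorem deriv_thetaOneTilde_ne_zero {l : ℂ} (hl : l ∈ (halfPeriodPair τ).lattice) :
    deriv (fun z => thetaOneTilde z τ) l ≠ 0 := by
  intro h0
  set L := halfPeriodPair τ
  have hall : ∀ x ∈ L.lattice, deriv (fun z => thetaOneTilde z τ) x = 0 := fun x hx => by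
    have hxl := L.lattice.sub_mem hx hl
    obtain ⟨α, β, h⟩ := exists_thetaOneTilde_add hxl
    have := deriv_thetaOneTilde_add h l
    rwa [add_sub_cancel, h0, thetaOneTilde_eq_zero_of_mem hl, mul_zero, add_zero, mul_zero] at this
  obtain ⟨k, hk⟩ := eventually_eq_const_of_elliptic τ (h := L.weierstrassP)
    (fun l hl x => Eventually.of_forall fun z => L.weierstrassP_add_coe z ⟨l, hl⟩) (fun x => by
      have ht := analyticAt_thetaOneTilde τ x
      by_cases hx : x ∈ L.lattice
      · obtain ⟨g, hg, hP⟩ := L.exists_weierstrassP_eq_add hx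
        obtain ⟨u, hu, htu⟩ := ht.exists_eq_sub_sq_mul (thetaOneTilde_eq_zero_of_mem hx) (hall x hx)
        refine ⟨fun z => u z + g z * thetaOneTilde z τ, hu.fun_add (hg.fun_mul ht), ?_⟩
        filter_upwards [nhdsWithin_le_nhds htu, self_mem_nhdsWithin] with z hz hzx
        have : z - x ≠ 0 := sub_ne_zero.2 hzx
        rw [hP, hz]; field_simp
      · exact ⟨_, (L.analyticOnNhd_weierstrassP x hx).fun_mul ht, EventuallyEq.rfl⟩)
  exact L.not_eventually_weierstrassP_eq k 0 L.lattice.zero_mem (hk 0)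

/-- Near a lattice point, `ϑ₁` is `z - l` times a non-vanishing analytic function. -/
theorem exists_thetaOneTilde_eq_sub_mul {l : ℂ} (hl : l ∈ (halfPeriodPair τ).lattice) :
    ∃ u : ℂ → ℂ, AnalyticAt ℂ u l ∧ u l ≠ 0 ∧ ∀ᶠ z in 𝓝 l, thetaOneTilde z τ = (z - l) * u z := by
  obtain ⟨u, hu, htu⟩ :=
    (analyticAt_thetaOneTilde τ l).exists_eq_sub_mul (thetaOneTilde_eq_zero_of_mem hl)
  refine ⟨u, hu, fun h0 => deriv_thetaOneTilde_ne_zero hl ?_, htu⟩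
  have h : HasDerivAt (fun z => (z - l) * u z) (1 * u l + (l - l) * deriv u l) l :=
    ((hasDerivAt_id' l).sub_const l).mul hu.differentiableAt.hasDerivAt
  rw [(show (fun z => thetaOneTilde z τ) =ᶠ[𝓝 l] fun z => (z - l) * u z from htu).deriv_eq, h.deriv,
    h0]
  ring

/-! ### The logarithmic derivative of `ϑ₁` -/

/-- The logarithmic derivative of `ϑ₁` differs from `ζ` by a linear function. -/
theorem exists_logDeriv_thetaOneTilde (τ : UpperHalfPlane) :
    ∃ c : ℂ, ∀ z, z ∉ (halfPeriodPair τ).lattice →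
      deriv (fun z => thetaOneTilde z τ) z / thetaOneTilde z τ = zetaTau z τ + c * z := by
  set L := halfPeriodPair τ
  set t : ℂ → ℂ := fun z => thetaOneTilde z τ with ht_def
  have hζ : ∀ z, zetaTau z τ = L.weierstrassZeta z := fun z => rfl
  have han : ∀ x, AnalyticAt ℂ t x := analyticAt_thetaOneTilde τ
  have hne : ∀ x, x ∉ L.lattice → t x ≠ 0 := fun x hx h => hx (thetaOneTilde_eq_zero_iff.1 h)
  have hAan : ∀ x, x ∉ L.lattice →
      AnalyticAt ℂ (fun z => deriv t z / t z - L.weierstrassZeta z) x := fun x hx =>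
    ((han x).deriv.fun_div (han x) (hne x hx)).fun_sub (L.analyticAt_weierstrassZeta hx)
  -- Both terms have simple poles with residue `1` at the lattice points, the first because the
  -- zeros of `ϑ₁` are simple. So the difference extends to an entire function `K`.
  obtain ⟨K, hK, hKA⟩ := exists_differentiable_eventuallyEq
    (f := fun z => deriv t z / t z - L.weierstrassZeta z) (fun x => by
      by_cases hx : x ∈ L.lattice
      · obtain ⟨g, hg, hζ⟩ := L.exists_weierstrassZeta_eq_add hx
        obtain ⟨u, hu, hux, htu⟩ := exists_thetaOneTilde_eq_sub_mul hx
        refine ⟨fun z => deriv u z / u z - g z, (hu.deriv.fun_div hu hux).fun_sub hg, ?_⟩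
        filter_upwards [nhdsWithin_le_nhds (eventually_eventually_nhds.2 htu), self_mem_nhdsWithin,
          nhdsWithin_le_nhds (hu.continuousAt.eventually_ne hux),
          nhdsWithin_le_nhds hu.eventually_analyticAt] with z hz hzx huz huan
        have hzx' : z - x ≠ 0 := sub_ne_zero.2 hzx
        have h1 : HasDerivAt (fun z => (z - x) * u z) (1 * u z + (z - x) * deriv u z) z :=
          ((hasDerivAt_id' z).sub_const x).mul huan.differentiableAt.hasDerivAt
        have h2 : deriv t z = 1 * u z + (z - x) * deriv u z := by
          rw [(show t =ᶠ[𝓝 z] fun z => (z - x) * u z from hz).deriv_eq, h1.deriv]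
        have h3 : t z = (z - x) * u z := hz.self_of_nhds
        rw [h2, h3, hζ]; field_simp; ring
      · exact ⟨_, hAan x hx, EventuallyEq.rfl⟩)
  have hKz : ∀ z, z ∉ L.lattice → K z = deriv t z / t z - L.weierstrassZeta z := fun z hz =>
    (eq_of_eventuallyEq_nhdsNE (hAan z hz).continuousAt (hK z).continuousAt (hKA z)).symm
  -- Translation by `l` adds the constant `β` to `ϑ₁' / ϑ₁` and `η` to `ζ`. Thus `K'` is elliptic
  -- and entire, hence constant.
  have hper : ∀ l ∈ L.lattice, ∀ z, deriv K (z + l) = deriv K z := by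
    intro l hl
    obtain ⟨α, β, h⟩ := exists_thetaOneTilde_add hl
    obtain ⟨η, hη⟩ := L.weierstrassZeta_add_coe l hl
    have hadd : ∀ z, K (z + l) = K z + (β - η) := fun x => by
      have hc := hK.continuous
      refine eq_of_eventuallyEq_nhdsNE (f := fun z => K (z + l)) (g := fun z => K z + (β - η))
        (by fun_prop) (by fun_prop) ?_
      filter_upwards [L.eventually_notMem_lattice x] with z hz
      have hzl : z + l ∉ L.lattice := fun h => hz (by simpa using L.lattice.sub_mem h hl)
      have h1 := deriv_thetaOneTilde_add h z
      have h2 := hne z hz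
      rw [hKz _ hz, hKz _ hzl, hη z hz, ht_def, h1]
      simp only [h]
      have he := Complex.exp_ne_zero (α + β * z)
      simp only [ht_def] at h2
      field_simp
      ring
    intro z
    have h1 : HasDerivAt (fun z => K (z + l)) (deriv K (z + l)) z :=
      (hK (z + l)).hasDerivAt.comp_add_const z l
    rw [funext hadd] at h1
    exact h1.unique ((hK z).hasDerivAt.add_const _)
  have hK' : Differentiable ℂ (deriv K) := fun z => (hK.analyticAt z).deriv.differentiableAt
  obtain ⟨c, hc⟩ := eventually_eq_const_of_elliptic τ (h := deriv K)
    (fun l hl x => Eventually.of_forall fun z => hper l hl z)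
    (fun x => ⟨_, (hK'.analyticAt x).fun_mul (han x), EventuallyEq.rfl⟩)
  have hderiv : ∀ z, deriv K z = c := fun z =>
    eq_of_eventuallyEq_nhdsNE (hK' z).continuousAt continuousAt_const (hc z)
  have hlin : ∀ z, K z = c * z + K 0 := fun z => by
    have hd : ∀ z, HasDerivAt (fun z => K z - c * z) 0 z := fun z =>
      ((hK z).hasDerivAt.sub ((hasDerivAt_id' z).const_mul c)).congr_deriv (by rw [hderiv]; ring)
    have := is_const_of_deriv_eq_zero (fun z => (hd z).differentiableAt) (fun z => (hd z).deriv) z 0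
    linear_combination this
  -- `K` is odd off the lattice; the points `±1` suffice, as `K 1 + K (-1) = 2 K 0` for an affine
  -- function.
  have hodd : K 0 = 0 := by
    have h1 : (1 : ℂ) ∉ L.lattice := fun h => by
      have := L.ω₁_div_two_notMem_lattice
      exact this (by simpa [L, halfPeriodPair] using h)
    have h2 : (-1 : ℂ) ∉ L.lattice := fun h => h1 (by simpa using L.lattice.neg_mem h)
    have hdt : deriv t (-1) = deriv t 1 := by
      have h3 : HasDerivAt (fun z => t (-z)) (-deriv t (-1)) 1 := by
        have := ((han (-1)).differentiableAt.hasDerivAt).scomp (1 : ℂ) (hasDerivAt_neg' 1)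
        simpa [Function.comp_def] using this
      have h4 : (fun z => t (-z)) = fun z => -t z := funext fun z => thetaOneTilde_neg z τ
      rw [h4] at h3
      have := h3.unique (han 1).differentiableAt.hasDerivAt.fun_neg
      exact neg_injective this
    have e1 := hKz _ h1
    have e2 := hKz _ h2
    have e3 : t (-1) = -t 1 := thetaOneTilde_neg 1 τ
    rw [hlin, hdt, e3, L.weierstrassZeta_neg, div_neg] at e2
    rw [hlin] at e1
    linear_combination (e1 + e2) / 2
  refine ⟨c, fun z hz => ?_⟩
  have := hKz z hz
  rw [hlin, hodd] at this
  rw [hζ]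
  linear_combination -this

end ThetaOne

/-! ### Values at the half periods -/

/-- The function `(℘(z) - ℘(a)) ϑ₁(z)² / (ϑ₁(z + a) ϑ₁(z - a))` is elliptic. At the lattice `ϑ₁²`
cancels the double pole; on the translate by `a`, both factors of the denominator vanish, and so
does `℘ - ℘(a)` to order two, because `℘'` vanishes at half periods. So the function is constant. If
`℘(b) = ℘(a)`, its value at `b` is `0`, and `℘` would be constant. -/
theorem weierstrassP_ne_of_half_period {τ : UpperHalfPlane} {a b : ℂ}
    (ha : a ∉ (halfPeriodPair τ).lattice) (h2a : 2 * a ∈ (halfPeriodPair τ).lattice)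
    (hb : b ∉ (halfPeriodPair τ).lattice) (hba : b - a ∉ (halfPeriodPair τ).lattice) :
    (halfPeriodPair τ).weierstrassP a ≠ (halfPeriodPair τ).weierstrassP b := by
  set L := halfPeriodPair τ
  intro hab
  set t : ℂ → ℂ := fun z => thetaOneTilde z τ with ht_def
  have han : ∀ x, AnalyticAt ℂ t x := analyticAt_thetaOneTilde τ
  have hanp : ∀ s x, AnalyticAt ℂ (fun z => t (z + s)) x := fun s x =>
    (han (x + s)).fun_comp (f := fun z => z + s) (by fun_prop)
  have hanm : ∀ s x, AnalyticAt ℂ (fun z => t (z - s)) x := fun s x =>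
    (han (x - s)).fun_comp (f := fun z => z - s) (by fun_prop)
  have hne : ∀ x, x ∉ L.lattice → t x ≠ 0 := fun x hx h => hx (thetaOneTilde_eq_zero_iff.1 h)
  -- For a half period, `a` and `-a` are congruent, so the two factors of the denominator have the
  -- same zeros.
  have hpm : ∀ x, x + a ∈ L.lattice ↔ x - a ∈ L.lattice := fun x =>
    ⟨fun h => by simpa [two_mul] using L.lattice.sub_mem h h2a,
      fun h => by
        have := L.lattice.add_mem h h2a
        rwa [show x - a + 2 * a = x + a by ring] at this⟩
  have hPan : ∀ x, x ∉ L.lattice → AnalyticAt ℂ L.weierstrassP x := L.analyticOnNhd_weierstrassP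
  have hreg : ∀ x, x ∉ L.lattice → x - a ∉ L.lattice → AnalyticAt ℂ
      (fun z => (L.weierstrassP z - L.weierstrassP a) * t z ^ 2 / (t (z + a) * t (z - a))) x :=
    fun x hx hxa => (((hPan x hx).fun_sub analyticAt_const).fun_mul ((han x).fun_pow 2)).fun_div
      ((hanp a x).fun_mul (hanm a x))
      (mul_ne_zero (hne _ fun h => hxa ((hpm x).1 h)) (hne _ hxa))
  obtain ⟨k, hk⟩ := eventually_eq_const_of_elliptic τ
    (h := fun z => (L.weierstrassP z - L.weierstrassP a) * t z ^ 2 / (t (z + a) * t (z - a)))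
    (fun l hl x => Eventually.of_forall fun z => by
      obtain ⟨α, β, h⟩ := exists_thetaOneTilde_add hl
      have h1 := L.weierstrassP_add_coe z ⟨l, hl⟩
      simp only at h1
      have h2 : t (z + l + a) = Complex.exp (α + β * (z + a)) * t (z + a) := by
        rw [add_right_comm]; exact h _
      have h3 : t (z + l - a) = Complex.exp (α + β * (z - a)) * t (z - a) := by
        rw [add_sub_right_comm]; exact h _
      have h4 : t (z + l) = Complex.exp (α + β * z) * t z := h z
      have h5 : Complex.exp (α + β * (z + a)) * Complex.exp (α + β * (z - a)) =
          Complex.exp (α + β * z) ^ 2 := by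
        rw [← Complex.exp_add, ← Complex.exp_nat_mul]; congr 1; push_cast; ring
      rw [h1, h2, h3, h4, mul_pow, ← h5, mul_mul_mul_comm, ← mul_left_comm]
      exact mul_div_mul_left _ _ (mul_ne_zero (Complex.exp_ne_zero _) (Complex.exp_ne_zero _)))
    (fun x => by
      by_cases hx : x ∈ L.lattice
      · have hxa : x - a ∉ L.lattice := fun h => ha (by simpa using L.lattice.sub_mem hx h)
        obtain ⟨g, hg, hP⟩ := L.exists_weierstrassP_eq_add hx
        obtain ⟨u, hu, -, htu⟩ := exists_thetaOneTilde_eq_sub_mul hx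
        refine ⟨fun z => (u z ^ 2 + (g z - L.weierstrassP a) * t z ^ 2) / (t (z + a) * t (z - a)) *
          t z, (((hu.fun_pow 2).fun_add ((hg.fun_sub analyticAt_const).fun_mul
            ((han x).fun_pow 2))).fun_div ((hanp a x).fun_mul (hanm a x))
          (mul_ne_zero (hne _ fun h => hxa ((hpm x).1 h)) (hne _ hxa))).fun_mul (han x), ?_⟩
        filter_upwards [nhdsWithin_le_nhds htu, self_mem_nhdsWithin] with z hz hzx
        have hzx' : z - x ≠ 0 := sub_ne_zero.2 hzx
        have hz' : t z = (z - x) * u z := hz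
        have h1 : (L.weierstrassP z - L.weierstrassP a) * t z ^ 2 =
            u z ^ 2 + (g z - L.weierstrassP a) * t z ^ 2 := by
          rw [hP, hz']; field_simp; ring
        change (L.weierstrassP z - L.weierstrassP a) * t z ^ 2 / _ * _ = _
        rw [h1]
      · by_cases hxa : x - a ∈ L.lattice
        · have hxa' := (hpm x).2 hxa
          have hPx : L.weierstrassP x = L.weierstrassP a := by
            have := L.weierstrassP_add_coe a ⟨x - a, hxa⟩
            simpa using this
          have h2x : 2 * x ∈ L.lattice := by
            have := L.lattice.add_mem hxa hxa'
            rwa [show x - a + (x + a) = 2 * x by ring] at this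
          have hP' : deriv (fun z => L.weierstrassP z - L.weierstrassP a) x = 0 := by
            rw [deriv_sub_const]
            change deriv L.weierstrassP x = 0
            rw [L.deriv_weierstrassP, L.derivWeierstrassP_half_period h2x]
          obtain ⟨v, hv, hPv⟩ := AnalyticAt.exists_eq_sub_sq_mul
            ((hPan x hx).fun_sub analyticAt_const) (sub_eq_zero.2 hPx) hP'
          obtain ⟨u₁, hu₁, hu₁x, htu₁⟩ := exists_thetaOneTilde_eq_sub_mul hxa'
          obtain ⟨u₂, hu₂, hu₂x, htu₂⟩ := exists_thetaOneTilde_eq_sub_mul hxa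
          have hu₁' : AnalyticAt ℂ (fun z => u₁ (z + a)) x :=
            hu₁.fun_comp (f := fun z => z + a) (by fun_prop)
          have hu₂' : AnalyticAt ℂ (fun z => u₂ (z - a)) x :=
            hu₂.fun_comp (f := fun z => z - a) (by fun_prop)
          refine ⟨fun z => v z * t z ^ 2 / (u₁ (z + a) * u₂ (z - a)) * t z,
            ((hv.fun_mul ((han x).fun_pow 2)).fun_div (hu₁'.fun_mul hu₂')
              (mul_ne_zero hu₁x hu₂x)).fun_mul (han x), ?_⟩
          have ht1 : ∀ᶠ z in 𝓝 x, thetaOneTilde (z + a) τ = (z + a - (x + a)) * u₁ (z + a) :=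
            ((continuous_add_const a).tendsto x).eventually htu₁
          have ht2 : ∀ᶠ z in 𝓝 x, thetaOneTilde (z - a) τ = (z - a - (x - a)) * u₂ (z - a) :=
            ((continuous_sub_right a).tendsto x).eventually htu₂
          filter_upwards [nhdsWithin_le_nhds ht1, nhdsWithin_le_nhds ht2, nhdsWithin_le_nhds hPv,
            self_mem_nhdsWithin] with z h1 h2 h3 hzx
          have hzx' : (z - x) ^ 2 ≠ 0 := pow_ne_zero 2 (sub_ne_zero.2 hzx)
          have h1' : t (z + a) = (z - x) * u₁ (z + a) := by rw [ht_def]; simp only; rw [h1]; ring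
          have h2' : t (z - a) = (z - x) * u₂ (z - a) := by rw [ht_def]; simp only; rw [h2]; ring
          rw [h1', h2', h3, show (z - x) * u₁ (z + a) * ((z - x) * u₂ (z - a)) =
            (z - x) ^ 2 * (u₁ (z + a) * u₂ (z - a)) by ring, mul_assoc ((z - x) ^ 2),
            mul_div_mul_left _ _ hzx']
        · exact ⟨_, (hreg x hx hxa).fun_mul (han x), EventuallyEq.rfl⟩)
  have hk0 : k = 0 := by
    have := eq_of_eventuallyEq_nhdsNE (hreg b hb hba).continuousAt
      (continuousAt_const (y := k)) (hk b)
    rw [← this, ← hab]; simp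
  have h0a : (0 : ℂ) - a ∉ L.lattice := fun h => ha (by simpa using L.lattice.neg_mem h)
  have h0a' : (0 : ℂ) + a ∉ L.lattice := by simpa using ha
  refine L.not_eventually_weierstrassP_eq (L.weierstrassP a) 0 L.lattice.zero_mem ?_
  filter_upwards [hk 0, eventually_thetaOneTilde_ne_zero τ.im_pos 0,
    nhdsWithin_le_nhds ((hanp a 0).continuousAt.eventually_ne (hne _ h0a')),
    nhdsWithin_le_nhds ((hanm a 0).continuousAt.eventually_ne (hne _ h0a))] with z h1 h2 h3 h4
  rw [hk0, div_eq_zero_iff, or_iff_left (mul_ne_zero h3 h4), mul_eq_zero,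
    or_iff_left (pow_ne_zero 2 h2), sub_eq_zero] at h1
  exact h1

/-- Three distinct roots of `4 x³ - g₂ x - g₃` have sum `0` and `g₂ = 2 (e₁² + e₂² + e₃²)`. -/
theorem sum_eq_zero_of_cubic_roots {e₁ e₂ e₃ g₂ g₃ : ℂ} (h12 : e₁ ≠ e₂) (h13 : e₁ ≠ e₃)
    (h23 : e₂ ≠ e₃) (h1 : 4 * e₁ ^ 3 - g₂ * e₁ - g₃ = 0) (h2 : 4 * e₂ ^ 3 - g₂ * e₂ - g₃ = 0)
    (h3 : 4 * e₃ ^ 3 - g₂ * e₃ - g₃ = 0) :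
    e₁ + e₂ + e₃ = 0 ∧ g₂ = 2 * (e₁ ^ 2 + e₂ ^ 2 + e₃ ^ 2) := by
  have a12 : 4 * (e₁ ^ 2 + e₁ * e₂ + e₂ ^ 2) - g₂ = 0 :=
    mul_left_cancel₀ (sub_ne_zero.2 h12) (by linear_combination h1 - h2)
  have a13 : 4 * (e₁ ^ 2 + e₁ * e₃ + e₃ ^ 2) - g₂ = 0 :=
    mul_left_cancel₀ (sub_ne_zero.2 h13) (by linear_combination h1 - h3)
  have hs : e₁ + e₂ + e₃ = 0 :=
    mul_left_cancel₀ (sub_ne_zero.2 h23) (by linear_combination (a12 - a13) / 4)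
  refine ⟨hs, ?_⟩
  obtain rfl : e₃ = -e₁ - e₂ := by linear_combination hs
  linear_combination -a12

/-- The second and fourth derivative at `0` of an even function obtained from `ϑ₁` by translation
by a half period. -/
theorem iterate_deriv_of_even_translate {τ : UpperHalfPlane} {c : ℂ}
    (hc : ∀ z, z ∉ (halfPeriodPair τ).lattice →
      deriv (fun z => thetaOneTilde z τ) z / thetaOneTilde z τ = zetaTau z τ + c * z)
    {ω : ℂ} (hω : ω ∉ (halfPeriodPair τ).lattice) (h2ω : 2 * ω ∈ (halfPeriodPair τ).lattice)
    {f : ℂ → ℂ} {α β : ℂ} (hf : ∀ z, f z = Complex.exp (α + β * z) * thetaOneTilde (z + ω) τ)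
    (heven : ∀ z, f (-z) = f z) :
    f 0 ≠ 0 ∧ deriv^[2] f 0 = (c - wpTau ω τ) * f 0 ∧
      deriv^[4] f 0 = (3 * (c - wpTau ω τ) ^ 2 - 6 * wpTau ω τ ^ 2 + (halfPeriodPair τ).g₂ / 2) *
        f 0 := by
  set L := halfPeriodPair τ
  have hf0 : f 0 ≠ 0 := by
    rw [hf, zero_add]
    exact mul_ne_zero (Complex.exp_ne_zero _) fun h => hω (thetaOneTilde_eq_zero_iff.1 h)
  set V : Set ℂ := {z | z + ω ∉ L.lattice}
  have hV : IsOpen V := L.isClosed_lattice.isOpen_compl.preimage (continuous_add_const ω)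
  have h0V : (0 : ℂ) ∈ V := by simpa [V] using hω
  -- `B` is the logarithmic derivative of `f`. All derivatives of `f` follow from `f' = f B`, `B' =
  -- c - P` and `P'' = 6 P² - g₂ / 2`.
  set B : ℂ → ℂ := fun z => β + L.weierstrassZeta (z + ω) + c * (z + ω)
  set P : ℂ → ℂ := fun z => L.weierstrassP (z + ω)
  set P' : ℂ → ℂ := fun z => L.derivWeierstrassP (z + ω)
  have hB : ∀ z ∈ V, HasDerivAt B (c - P z) z := fun z hz => by
    have h1 := ((L.hasDerivAt_weierstrassZeta hz).comp_add_const z ω).const_add β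
    have h2 := ((hasDerivAt_id' z).add_const ω).const_mul c
    exact (h1.add h2).congr_deriv (by ring)
  have hP : ∀ z ∈ V, HasDerivAt P (P' z) z := fun z hz =>
    (L.hasDerivAt_weierstrassP hz).comp_add_const z ω
  have hP' : ∀ z ∈ V, HasDerivAt P' (6 * P z ^ 2 - L.g₂ / 2) z := fun z hz =>
    (L.hasDerivAt_derivWeierstrassP hz).comp_add_const z ω
  have hd := differentiable_thetaOneTilde τ.im_pos
  have hF : ∀ z ∈ V, HasDerivAt f (f z * B z) z := fun z hz => by
    have h1 : HasDerivAt (fun z => thetaOneTilde (z + ω) τ)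
      (deriv (fun z => thetaOneTilde z τ) (z + ω)) z :=
      (hd (z + ω)).hasDerivAt.comp_add_const z ω
    have h2 : HasDerivAt (fun z => Complex.exp (α + β * z)) (Complex.exp (α + β * z) * β) z :=
      (((hasDerivAt_id' z).const_mul β).const_add α).cexp.congr_deriv (by ring)
    rw [funext hf]
    refine (h2.mul h1).congr_deriv ?_
    have hne : thetaOneTilde (z + ω) τ ≠ 0 := fun h => hz (thetaOneTilde_eq_zero_iff.1 h)
    have h3 := hc _ hz
    rw [div_eq_iff hne] at h3
    rw [h3]
    simp only [B, show zetaTau (z + ω) τ = L.weierstrassZeta (z + ω) from rfl]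
    ring
  have hstep : ∀ {g G : ℂ → ℂ} {g' : ℂ → ℂ}, (∀ z ∈ V, g z = G z) →
      (∀ z ∈ V, HasDerivAt G (g' z) z) → ∀ z ∈ V, deriv g z = g' z := fun hg hG z hz =>
    ((hG z hz).congr_of_eventuallyEq
      (Filter.mem_of_superset (hV.mem_nhds hz) fun w hw => hg w hw)).deriv
  have d1 : ∀ z ∈ V, deriv f z = f z * B z := fun z hz => (hF z hz).deriv
  have d2 : ∀ z ∈ V, deriv (deriv f) z = f z * (B z ^ 2 + (c - P z)) :=
    hstep d1 fun z hz => ((hF z hz).mul (hB z hz)).congr_deriv (by ring)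
  have d3 : ∀ z ∈ V, deriv (deriv (deriv f)) z = f z * (B z ^ 3 + 3 * B z * (c - P z) - P' z) :=
    hstep d2 fun z hz => ((hF z hz).mul (((hB z hz).fun_pow 2).add ((hP z hz).const_sub
      c))).congr_deriv
      (by simp only [Pi.add_apply]; push_cast; ring)
  have d4 : ∀ z ∈ V, deriv (deriv (deriv (deriv f))) z = f z * (B z *
      (B z ^ 3 + 3 * B z * (c - P z) - P' z) + 3 * B z ^ 2 * (c - P z) + 3 * (c - P z) ^ 2 -
      3 * B z * P' z - (6 * P z ^ 2 - L.g₂ / 2)) :=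
    hstep d3 fun z hz => ((hF z hz).mul ((((hB z hz).fun_pow 3).add
      (((hB z hz).const_mul 3).mul ((hP z hz).const_sub c))).sub (hP' z hz))).congr_deriv
      (by simp only [Pi.add_apply, Pi.mul_apply, Pi.sub_apply]; push_cast; ring)
  -- Evenness gives `f' 0 = 0`. Together with `P' 0 = 0` at a half period this leaves only `c - P`
  -- and `P''` in the derivatives at `0`.
  have hB0 : B 0 = 0 := by
    have h1 := hF 0 h0V
    have h2 : HasDerivAt (fun z => f (-z)) (-(f 0 * B 0)) 0 := by
      have h3 : HasDerivAt f (f 0 * B 0) (-0) := by rw [neg_zero]; exact h1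
      simpa [Function.comp_def] using h3.scomp (0 : ℂ) (hasDerivAt_neg' 0)
    rw [funext heven] at h2
    have h4 := h1.unique h2
    have h5 : f 0 * B 0 = 0 := by linear_combination h4 / 2
    exact (mul_eq_zero.1 h5).resolve_left hf0
  have hP'0 : P' 0 = 0 := by
    simp only [P', zero_add]
    exact L.derivWeierstrassP_half_period h2ω
  have hP0 : P 0 = wpTau ω τ := by simp only [P, zero_add]; rfl
  refine ⟨hf0, ?_, ?_⟩
  · change deriv (deriv f) 0 = _
    rw [d2 0 h0V, hB0, hP0]; ring
  · change deriv (deriv (deriv (deriv f))) 0 = _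
    rw [d4 0 h0V, hB0, hP0, hP'0]; ring

/-! ### The three even theta functions -/

/-- `ϑ₂, ϑ₃, ϑ₄` at `(π z / 2; τ)`. -/
noncomputable def thetaEven (j : Fin 3) (z τ : ℂ) : ℂ :=
  ![thetaTwo (Real.pi * z / 2) τ, thetaThree (Real.pi * z / 2) τ, thetaFour (Real.pi * z / 2) τ] j

theorem thetaEven_at_zero (j : Fin 3) (τ : ℂ) : thetaEven j 0 τ = thetaNull j τ := by
  fin_cases j <;> simp [thetaEven, thetaNull]

theorem thetaEven_zero_eq (z τ : ℂ) : thetaEven 0 z τ = thetaOneTilde (z + 1) τ := by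
  simp only [thetaEven, thetaTwo, thetaOneTilde, Matrix.cons_val_zero]
  congr 1; ring

theorem thetaEven_one_eq (z τ : ℂ) : thetaEven 1 z τ = jacobiTheta₂ (z / 2) τ := by
  have hpi : (Real.pi : ℂ) ≠ 0 := by exact_mod_cast Real.pi_ne_zero
  change thetaFour (Real.pi * z / 2 + Real.pi / 2) τ = _
  rw [thetaFour_eq, ← jacobiTheta₂_add_left (z / 2)]
  congr 1; field_simp; ring

theorem thetaEven_two_eq (z τ : ℂ) : thetaEven 2 z τ = jacobiTheta₂ (z / 2 + 1 / 2) τ := by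
  have hpi : (Real.pi : ℂ) ≠ 0 := by exact_mod_cast Real.pi_ne_zero
  simp only [thetaEven, Matrix.cons_val, thetaFour_eq]
  congr 1; field_simp

theorem thetaEven_neg (j : Fin 3) (z τ : ℂ) : thetaEven j (-z) τ = thetaEven j z τ := by
  fin_cases j
  · change thetaEven 0 _ _ = thetaEven 0 _ _
    rw [thetaEven_zero_eq, thetaEven_zero_eq, show -z + 1 = -(z - 1) by ring, thetaOneTilde_neg,
      ← thetaOneTilde_add_two]
    congr 1; ring
  · change thetaEven 1 _ _ = thetaEven 1 _ _
    rw [thetaEven_one_eq, thetaEven_one_eq, neg_div, jacobiTheta₂_neg_left]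
  · change thetaEven 2 _ _ = thetaEven 2 _ _
    rw [thetaEven_two_eq, thetaEven_two_eq, ← jacobiTheta₂_neg_left, ← jacobiTheta₂_add_left]
    congr 1; ring

/-- The half period by which `thetaEven j` is a translate of `ϑ₁`. -/
noncomputable def thetaShift (τ : ℂ) (j : Fin 3) : ℂ := ![1, 1 - τ, -τ] j

/-- This brings the three even functions into the form required by
`iterate_deriv_of_even_translate`. -/
theorem exists_thetaEven_eq (j : Fin 3) (τ : ℂ) : ∃ α β : ℂ, ∀ z,
    thetaEven j z τ = Complex.exp (α + β * z) * thetaOneTilde (z + thetaShift τ j) τ := by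
  have hI : Complex.exp (Real.pi / 2 * Complex.I) = Complex.I := Complex.exp_pi_div_two_mul_I
  have hI2 : Complex.I * -Complex.I = 1 := by simp
  fin_cases j
  · exact ⟨0, 0, fun z => by simpa [thetaShift] using thetaEven_zero_eq z τ⟩
  · refine ⟨Real.pi / 2 * Complex.I - Real.pi * Complex.I * (1 / 2 - τ / 4),
      -(Real.pi * Complex.I / 2), fun z => ?_⟩
    change thetaEven 1 z τ = _ * thetaOneTilde (z + (1 - τ)) τ
    rw [thetaEven_one_eq, thetaOneTilde_eq, show (z + (1 - τ)) / 2 + τ / 2 + 1 / 2 = z / 2 + 1 by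
      ring, jacobiTheta₂_add_left, ← mul_assoc, mul_left_comm, ← Complex.exp_add,
      show Real.pi / 2 * Complex.I - Real.pi * Complex.I * (1 / 2 - τ / 4) +
        -(Real.pi * Complex.I / 2) * z + Real.pi * Complex.I * ((z + (1 - τ)) / 2 + τ / 4) =
        Real.pi / 2 * Complex.I by ring, hI, mul_comm (-Complex.I), hI2, one_mul]
  · refine ⟨Real.pi / 2 * Complex.I + Real.pi * Complex.I * τ / 4,
      -(Real.pi * Complex.I / 2), fun z => ?_⟩
    change thetaEven 2 z τ = _ * thetaOneTilde (z + -τ) τ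
    rw [thetaEven_two_eq, thetaOneTilde_eq, show (z + -τ) / 2 + τ / 2 + 1 / 2 = z / 2 + 1 / 2 by
      ring, ← mul_assoc, mul_left_comm, ← Complex.exp_add,
      show Real.pi / 2 * Complex.I + Real.pi * Complex.I * τ / 4 +
        -(Real.pi * Complex.I / 2) * z + Real.pi * Complex.I * ((z + -τ) / 2 + τ / 4) =
        Real.pi / 2 * Complex.I by ring, hI, mul_comm (-Complex.I), hI2, one_mul]

/-- `m + n τ` is a lattice point only if `m` and `n` are even. -/
theorem even_of_mem_halfPeriodPair_lattice {τ : UpperHalfPlane} {m n : ℤ}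
    (h : (m : ℂ) + n * τ ∈ (halfPeriodPair τ).lattice) : Even m ∧ Even n := by
  obtain ⟨p, q, h⟩ := mem_halfPeriodPair_lattice.1 h
  have him := congrArg Complex.im h
  have hre := congrArg Complex.re h
  simp at him hre
  have hn : (n : ℝ) = 2 * q := him.resolve_right τ.im_ne_zero
  have hn' : n = 2 * q := by exact_mod_cast hn
  have hm : (m : ℝ) = 2 * p := by
    rw [hn] at hre; linarith
  have hm' : m = 2 * p := by exact_mod_cast hm
  exact ⟨⟨p, by omega⟩, ⟨q, by omega⟩⟩

theorem two_mul_add_mem_lattice (τ : UpperHalfPlane) (m n : ℤ) :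
    2 * ((m : ℂ) + n * τ) ∈ (halfPeriodPair τ).lattice :=
  mem_halfPeriodPair_lattice.2 ⟨m, n, by ring⟩

/-- The logarithmic derivative of `ϑ₁` and the Taylor coefficients at `0` of the even theta
functions, in terms of a constant `c` and the values `e j` of `℘` at the half periods. -/
theorem exists_thetaEven_taylor (τ : UpperHalfPlane) : ∃ (c : ℂ) (e : Fin 3 → ℂ),
    (∀ z, z ∉ (halfPeriodPair τ).lattice →
      deriv (fun z => thetaOneTilde z τ) z / thetaOneTilde z τ = zetaTau z τ + c * z) ∧
    e 0 + e 1 + e 2 = 0 ∧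
    ∀ j, thetaNull j τ ≠ 0 ∧
      deriv^[2] (fun z => thetaEven j z τ) 0 = (c - e j) * thetaNull j τ ∧
      deriv^[4] (fun z => thetaEven j z τ) 0 =
        (3 * (c - e j) ^ 2 - 6 * e j ^ 2 + (e 0 ^ 2 + e 1 ^ 2 + e 2 ^ 2)) * thetaNull j τ := by
  obtain ⟨c, hc⟩ := exists_logDeriv_thetaOneTilde τ
  set L := halfPeriodPair τ
  have hs : ∀ j, ∃ m n : ℤ, thetaShift τ j = m + n * τ := fun j => by
    fin_cases j
    · exact ⟨1, 0, by simp [thetaShift]⟩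
    · exact ⟨1, -1, by simp [thetaShift]; ring⟩
    · exact ⟨0, -1, by simp [thetaShift]⟩
  have h2 : ∀ j, 2 * thetaShift τ j ∈ L.lattice := fun j => by
    obtain ⟨m, n, h⟩ := hs j
    rw [h]; exact two_mul_add_mem_lattice τ m n
  have hnot : ∀ m n : ℤ, ¬ (Even m ∧ Even n) → ∀ z : ℂ, z = m + n * τ → z ∉ L.lattice :=
    fun m n hmn z hz h => hmn (even_of_mem_halfPeriodPair_lattice (τ := τ) (hz ▸ h))
  have h0 : thetaShift τ 0 ∉ L.lattice := hnot 1 0 (by decide) _ (by simp [thetaShift])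
  have h1 : thetaShift τ 1 ∉ L.lattice := hnot 1 (-1) (by decide) _ (by simp [thetaShift]; ring)
  have h2' : thetaShift τ 2 ∉ L.lattice := hnot 0 (-1) (by decide) _ (by simp [thetaShift])
  have hω : ∀ j, thetaShift τ j ∉ L.lattice := fun j => by
    fin_cases j
    · exact h0
    · exact h1
    · exact h2'
  -- The differences of the shifts are `-τ`, `-1 - τ` and `-1`, none of them in the lattice.
  have n01 := weierstrassP_ne_of_half_period h0 (h2 0) h1
    (hnot 0 (-1) (by decide) _ (by simp [thetaShift]))
  have n02 := weierstrassP_ne_of_half_period h0 (h2 0) h2'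
    (hnot (-1) (-1) (by decide) _ (by simp [thetaShift]; ring))
  have n12 := weierstrassP_ne_of_half_period h1 (h2 1) h2'
    (hnot (-1) 0 (by decide) _ (by simp [thetaShift]; ring))
  -- At half periods `℘' = 0`, so the differential equation of `℘` becomes the cubic equation.
  have hcubic : ∀ j, 4 * L.weierstrassP (thetaShift τ j) ^ 3 -
      L.g₂ * L.weierstrassP (thetaShift τ j) - L.g₃ = 0 := fun j => by
    rw [← L.derivWeierstrassP_sq _ (hω j), L.derivWeierstrassP_half_period (h2 j)]; simp
  obtain ⟨hsum, hg⟩ := sum_eq_zero_of_cubic_roots n01 n02 n12 (hcubic 0) (hcubic 1) (hcubic 2)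
  refine ⟨c, fun j => wpTau (thetaShift τ j) τ, hc, hsum, fun j => ?_⟩
  obtain ⟨α, β, h⟩ := exists_thetaEven_eq j τ
  have := iterate_deriv_of_even_translate hc (hω j) (h2 j) h (fun z => thetaEven_neg j z τ)
  rw [thetaEven_at_zero] at this
  refine ⟨this.1, this.2.1, ?_⟩
  rw [this.2.2, hg]
  change _ = (3 * (c - wpTau (thetaShift τ j) τ) ^ 2 - 6 * wpTau (thetaShift τ j) τ ^ 2 +
    (L.weierstrassP (thetaShift τ 0) ^ 2 + L.weierstrassP (thetaShift τ 1) ^ 2 +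
      L.weierstrassP (thetaShift τ 2) ^ 2)) * _
  ring

/-! ### Partial derivatives -/

/-- `f` is differentiable at `x` and its `j`-th partial derivative there is `d`. -/
def HasPartialAt {n : ℕ} (f : (Fin n → ℂ) → ℂ) (j : Fin n) (d : ℂ) (x : Fin n → ℂ) : Prop :=
  DifferentiableAt ℂ f x ∧ partialAt f j x = d

section Partial

variable {n : ℕ} {f g : (Fin n → ℂ) → ℂ} {i j : Fin n} {d e : ℂ} {x : Fin n → ℂ}

theorem AnalyticAt.hasPartialAt (hf : AnalyticAt ℂ f x) (j : Fin n) :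
    HasPartialAt f j (partialAt f j x) x := ⟨hf.differentiableAt, rfl⟩

theorem HasPartialAt.congr_value (hf : HasPartialAt f j d x) (h : d = e) : HasPartialAt f j e x :=
  h ▸ hf

theorem HasPartialAt.congr (hf : HasPartialAt f j d x) (h : g =ᶠ[𝓝 x] f) :
    HasPartialAt g j d x :=
  ⟨hf.1.congr_of_eventuallyEq h, by rw [partialAt, h.fderiv_eq]; exact hf.2⟩

theorem HasPartialAt.congr_on {U : Set (Fin n → ℂ)} (hU : IsOpen U) (hx : x ∈ U)
    (hf : HasPartialAt f j d x) (h : ∀ y ∈ U, g y = f y) : HasPartialAt g j d x :=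
  hf.congr (Filter.mem_of_superset (hU.mem_nhds hx) h)

theorem hasPartialAt_const (c : ℂ) (j : Fin n) (x : Fin n → ℂ) :
    HasPartialAt (fun _ => c) j 0 x :=
  ⟨differentiableAt_const c, by simp [partialAt]⟩

theorem HasPartialAt.add (hf : HasPartialAt f j d x) (hg : HasPartialAt g j e x) :
    HasPartialAt (fun y => f y + g y) j (d + e) x :=
  ⟨hf.1.fun_add hg.1, by rw [partialAt, fderiv_fun_add hf.1 hg.1, ← hf.2, ← hg.2]; rfl⟩

theorem HasPartialAt.mul (hf : HasPartialAt f j d x) (hg : HasPartialAt g j e x) :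
    HasPartialAt (fun y => f y * g y) j (d * g x + f x * e) x :=
  ⟨hf.1.fun_mul hg.1, by
    rw [partialAt, fderiv_fun_mul hf.1 hg.1, ← hf.2, ← hg.2]
    simp [partialAt]; ring⟩

theorem HasPartialAt.const_mul (hf : HasPartialAt f j d x) (c : ℂ) :
    HasPartialAt (fun y => c * f y) j (c * d) x :=
  ((hasPartialAt_const c j x).mul hf).congr_value (by ring)

theorem HasPartialAt.sq (hf : HasPartialAt f j d x) :
    HasPartialAt (fun y => f y ^ 2) j (2 * f x * d) x := by
  simp only [pow_two]
  exact (hf.mul hf).congr_value (by ring)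

theorem HasPartialAt.inv (hf : HasPartialAt f j d x) (h0 : f x ≠ 0) :
    HasPartialAt (fun y => (f y)⁻¹) j (-d / f x ^ 2) x :=
  ⟨hf.1.fun_inv h0, by
    have := (hasDerivAt_inv h0).comp_hasFDerivAt x hf.1.hasFDerivAt
    rw [partialAt, show (fun y => (f y)⁻¹) = Inv.inv ∘ f from rfl, this.fderiv, ← hf.2]
    simp [partialAt]; ring⟩

theorem HasPartialAt.comp_coord {h : ℂ → ℂ} {d : ℂ} (i : Fin n) (hh : HasDerivAt h d (x i))
    (j : Fin n) : HasPartialAt (fun y => h (y i)) j (if j = i then d else 0) x := by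
  have h1 : HasFDerivAt (fun y : Fin n → ℂ => y i) (ContinuousLinearMap.proj i) x :=
    (ContinuousLinearMap.proj (R := ℂ) (φ := fun _ : Fin n => ℂ) i).hasFDerivAt
  have h2 := hh.comp_hasFDerivAt x h1
  refine ⟨h2.differentiableAt, ?_⟩
  rw [partialAt, show (fun y : Fin n → ℂ => h (y i)) = h ∘ fun y => y i from rfl, h2.fderiv]
  by_cases hij : j = i
  · subst hij; simp
  · have : i ≠ j := fun h => hij h.symm
    simp [hij, this]

theorem hasPartialAt_coord (i j : Fin n) (x : Fin n → ℂ) :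
    HasPartialAt (fun y => y i) j (if j = i then 1 else 0) x :=
  HasPartialAt.comp_coord i (hasDerivAt_id' _) j

theorem AnalyticAt.partialAt (hf : AnalyticAt ℂ f x) (j : Fin n) :
    AnalyticAt ℂ (partialAt f j) x :=
  ((ContinuousLinearMap.apply ℂ ℂ (Pi.single j 1 : Fin n → ℂ)).analyticAt _).comp hf.fderiv

theorem partialAt_comm (hf : AnalyticAt ℂ f x) (i j : Fin n) :
    partialAt (partialAt f i) j x = partialAt (partialAt f j) i x := by
  have h : ∀ k l : Fin n, _root_.partialAt (_root_.partialAt f k) l x =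
      fderiv ℂ (fderiv ℂ f) x (Pi.single l 1) (Pi.single k 1) := fun k l => by
    have h1 := (ContinuousLinearMap.apply ℂ ℂ (Pi.single k 1 : Fin n → ℂ)).hasFDerivAt.comp x
      hf.fderiv.differentiableAt.hasFDerivAt
    rw [_root_.partialAt, show _root_.partialAt f k =
      ContinuousLinearMap.apply ℂ ℂ (Pi.single k 1 : Fin n → ℂ) ∘ fderiv ℂ f from rfl, h1.fderiv]
    rfl
  rw [h, h]
  exact (hf.contDiffAt (n := 2)).isSymmSndFDerivAt (by simp) _ _

theorem HasPartialAt.hasDerivAt_update {s : ℂ} (hf : HasPartialAt f j d (Function.update x j s)) :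
    HasDerivAt (fun s => f (Function.update x j s)) d s := by
  have := hf.1.hasFDerivAt.comp_hasDerivAt s (_root_.hasDerivAt_update x j s)
  rwa [show fderiv ℂ f (Function.update x j s) (Pi.single j 1) = d from hf.2] at this

theorem hasPartialAt_of_hasDerivAt_update (hf : DifferentiableAt ℂ f x)
    (h : HasDerivAt (fun s => f (Function.update x j s)) d (x j)) : HasPartialAt f j d x := by
  refine ⟨hf, ?_⟩
  have h2 : HasPartialAt f j (partialAt f j x) (Function.update x j (x j)) := by
    rw [Function.update_eq_self]; exact ⟨hf, rfl⟩
  exact h2.hasDerivAt_update.unique h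

end Partial

theorem isOpen_planeTimesUpper : IsOpen planeTimesUpper :=
  isOpen_lt continuous_const (Complex.continuous_im.comp (continuous_apply 1))

theorem update_zero_mem_planeTimesUpper {x : Fin 2 → ℂ} (hx : x ∈ planeTimesUpper) (s : ℂ) :
    Function.update x 0 s ∈ planeTimesUpper := by
  simpa [planeTimesUpper] using hx

/-- Iterated partial derivatives in the first variable as iterated one-variable derivatives. -/
theorem iterate_partialAt_zero {F : (Fin 2 → ℂ) → ℂ} (hF : AnalyticOnNhd ℂ F planeTimesUpper)
    (k : ℕ) : AnalyticOnNhd ℂ ((fun G => partialAt G 0)^[k] F) planeTimesUpper ∧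
    ∀ x ∈ planeTimesUpper, (fun G => partialAt G 0)^[k] F x =
      deriv^[k] (fun z => F (Function.update x 0 z)) (x 0) := by
  induction k with
  | zero => exact ⟨hF, fun x _ => by simp⟩
  | succ k ih =>
    simp only [Function.iterate_succ_apply']
    refine ⟨fun x hx => (ih.1 x hx).partialAt 0, fun x hx => ?_⟩
    have h1 : HasPartialAt ((fun G => partialAt G 0)^[k] F) 0
        (partialAt ((fun G => partialAt G 0)^[k] F) 0 x) (Function.update x 0 (x 0)) := by
      rw [Function.update_eq_self]; exact (ih.1 x hx).hasPartialAt 0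
    rw [← h1.hasDerivAt_update.deriv]
    congr 1
    funext s
    rw [ih.2 _ (update_zero_mem_planeTimesUpper hx s)]
    simp

/-! ### The heat equation for the theta functions -/

/-- `exp(π i (ε z / 2 + ε² τ / 4))` times a translate of the theta series by `ε τ / 2 + b`. -/
noncomputable def thetaTranslate (C ε b : ℂ) (x : Fin 2 → ℂ) : ℂ :=
  C * Complex.exp (Real.pi * Complex.I * (ε * x 0 / 2 + ε ^ 2 * x 1 / 4)) *
    jacobiTheta₂ (x 0 / 2 + ε * x 1 / 2 + b) (x 1)

theorem analyticOnNhd_thetaTranslate (C ε b : ℂ) :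
    AnalyticOnNhd ℂ (thetaTranslate C ε b) planeTimesUpper := fun x hx => by
  have hc : ∀ i : Fin 2, AnalyticAt ℂ (fun y : Fin 2 → ℂ => y i) x := fun i =>
    (ContinuousLinearMap.proj (R := ℂ) (φ := fun _ : Fin 2 => ℂ) i).analyticAt x
  have h0 := hc 0
  have h1 := hc 1
  have hJ : AnalyticAt ℂ (fun y : Fin 2 → ℂ =>
      jacobiTheta₂ (y 0 / 2 + ε * y 1 / 2 + b) (y 1)) x :=
    AnalyticAt.fun_comp (g := fun p : ℂ × ℂ => jacobiTheta₂ p.1 p.2)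
      (f := fun y : Fin 2 → ℂ => (y 0 / 2 + ε * y 1 / 2 + b, y 1))
      (analyticAt_jacobiTheta₂ _ hx) (AnalyticAt.prod
        (((h0.fun_div analyticAt_const two_ne_zero).fun_add
          ((analyticAt_const.fun_mul h1).fun_div analyticAt_const two_ne_zero)).fun_add
            analyticAt_const) h1)
  exact (analyticAt_const.fun_mul (analyticAt_const.fun_mul
    (((analyticAt_const.fun_mul h0).fun_div analyticAt_const two_ne_zero).fun_add
      ((analyticAt_const.fun_mul h1).fun_div analyticAt_const
        (by norm_num : (4 : ℂ) ≠ 0)))).cexp').fun_mul hJ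

/-- The prefactor completes the square: up to constants the terms are `exp (π i (ν z + ν² τ))` with
`ν = n + ε / 2`, and each satisfies the equation. The computation deduces it from the heat equation
of the theta series by the product and chain rules. -/
theorem heat_thetaTranslate (C ε b : ℂ) {x : Fin 2 → ℂ} (hx : x ∈ planeTimesUpper) :
    partialAt (thetaTranslate C ε b) 1 x = -Complex.I / Real.pi *
      partialAt (partialAt (thetaTranslate C ε b) 0) 0 x := by
  have hpi : (Real.pi : ℂ) ≠ 0 := by exact_mod_cast Real.pi_ne_zero
  set F := thetaTranslate C ε b with hF
  have han := analyticOnNhd_thetaTranslate C ε b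
  set E : (Fin 2 → ℂ) → ℂ := fun x =>
    C * Complex.exp (Real.pi * Complex.I * (ε * x 0 / 2 + ε ^ 2 * x 1 / 4))
  set w : (Fin 2 → ℂ) → ℂ := fun x => x 0 / 2 + ε * x 1 / 2 + b
  have hE0 : ∀ (y : Fin 2 → ℂ), HasDerivAt (fun s => E (Function.update y 0 s))
      (E y * (Real.pi * Complex.I * ε / 2)) (y 0) := fun y => by
    have h1 : HasDerivAt (fun s : ℂ => Real.pi * Complex.I * (ε * s / 2 + ε ^ 2 * y 1 / 4))
        (Real.pi * Complex.I * (ε * 1 / 2)) (y 0) :=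
      ((((hasDerivAt_id' (y 0)).const_mul ε).div_const 2).add_const _).const_mul _
    have h2 := h1.cexp.const_mul C
    simp only [E, Function.update_self, Function.update_of_ne (show (1 : Fin 2) ≠ 0 by decide)]
    exact h2.congr_deriv (by ring)
  have hw0 : ∀ (y : Fin 2 → ℂ), HasDerivAt (fun s : ℂ => s / 2 + ε * y 1 / 2 + b) (1 / 2) (y 0) :=
    fun y => (((hasDerivAt_id' (y 0)).div_const 2).add_const _).add_const _
  have hJ0 : ∀ y ∈ planeTimesUpper, HasDerivAt
      (fun s : ℂ => jacobiTheta₂ (s / 2 + ε * y 1 / 2 + b) (y 1))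
      (jacobiTheta₂' (w y) (y 1) * (1 / 2)) (y 0) := fun y hy =>
    HasDerivAt.comp (h₂ := fun u => jacobiTheta₂ u (y 1)) (y 0)
      (hasDerivAt_jacobiTheta₂_fst (w y) hy) (hw0 y)
  have hJ1 : ∀ y ∈ planeTimesUpper, HasDerivAt
      (fun s : ℂ => jacobiTheta₂' (s / 2 + ε * y 1 / 2 + b) (y 1))
      (deriv (fun u => jacobiTheta₂' u (y 1)) (w y) * (1 / 2)) (y 0) := fun y hy => by
    have hd : (fun u => jacobiTheta₂' u (y 1)) = deriv fun u => jacobiTheta₂ u (y 1) :=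
      funext fun u => (hasDerivAt_jacobiTheta₂_fst u hy).deriv.symm
    have hent : Differentiable ℂ fun u => jacobiTheta₂ u (y 1) := fun u =>
      differentiableAt_jacobiTheta₂_fst u hy
    have hdd : DifferentiableAt ℂ (fun u => jacobiTheta₂' u (y 1)) (w y) := by
      rw [hd]; exact (hent.analyticAt _).deriv.differentiableAt
    exact HasDerivAt.comp (h₂ := fun u => jacobiTheta₂' u (y 1)) (y 0) hdd.hasDerivAt (hw0 y)
  have hF0 : ∀ y ∈ planeTimesUpper, partialAt F 0 y =
      E y * (Real.pi * Complex.I * ε / 2 * jacobiTheta₂ (w y) (y 1) +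
        jacobiTheta₂' (w y) (y 1) / 2) := fun y hy => by
    refine (hasPartialAt_of_hasDerivAt_update (han y hy).differentiableAt ?_).2
    have h := (hE0 y).mul (hJ0 y hy)
    simp only [Function.update_eq_self] at h
    simp only [thetaTranslate, Function.update_self,
      Function.update_of_ne (show (1 : Fin 2) ≠ 0 by decide)]
    simp only [E, Function.update_self,
      Function.update_of_ne (show (1 : Fin 2) ≠ 0 by decide)] at h
    exact h.congr_deriv (by simp only [E, w]; ring)
  have hF00 : partialAt (partialAt F 0) 0 x =
      E x * ((Real.pi * Complex.I * ε / 2) ^ 2 * jacobiTheta₂ (w x) (x 1) +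
        Real.pi * Complex.I * ε / 2 * jacobiTheta₂' (w x) (x 1) +
        deriv (fun u => jacobiTheta₂' u (x 1)) (w x) / 4) := by
    refine (hasPartialAt_of_hasDerivAt_update ((han x hx).partialAt 0).differentiableAt ?_).2
    have h := (hE0 x).mul (((hJ0 x hx).const_mul (Real.pi * Complex.I * ε / 2)).add
      ((hJ1 x hx).div_const 2))
    have hfun : (fun s => partialAt F 0 (Function.update x 0 s)) = fun s =>
        E (Function.update x 0 s) * (Real.pi * Complex.I * ε / 2 *
          jacobiTheta₂ (s / 2 + ε * x 1 / 2 + b) (x 1) +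
          jacobiTheta₂' (s / 2 + ε * x 1 / 2 + b) (x 1) / 2) := funext fun s => by
      rw [hF0 _ (update_zero_mem_planeTimesUpper hx s)]
      simp [w]
    rw [hfun]
    simp only [Function.update_eq_self] at h
    exact h.congr_deriv (by simp only [w, Pi.add_apply]; ring)
  have hE1 : HasDerivAt (fun s => E (Function.update x 1 s))
      (E x * (Real.pi * Complex.I * ε ^ 2 / 4)) (x 1) := by
    have h1 : HasDerivAt (fun s : ℂ => Real.pi * Complex.I * (ε * x 0 / 2 + ε ^ 2 * s / 4))
        (Real.pi * Complex.I * (ε ^ 2 * 1 / 4)) (x 1) :=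
      ((((hasDerivAt_id' (x 1)).const_mul (ε ^ 2)).div_const 4).const_add _).const_mul _
    have h2 := h1.cexp.const_mul C
    simp only [E, Function.update_self, Function.update_of_ne (show (0 : Fin 2) ≠ 1 by decide)]
    exact h2.congr_deriv (by ring)
  have hJτ : HasDerivAt (fun s : ℂ => jacobiTheta₂ (x 0 / 2 + ε * s / 2 + b) s)
      (jacobiTheta₂' (w x) (x 1) * (ε / 2) +
        -Complex.I / (4 * Real.pi) * deriv (fun u => jacobiTheta₂' u (x 1)) (w x)) (x 1) := by
    have h1 : HasDerivAt (fun s : ℂ => x 0 / 2 + ε * s / 2 + b) (ε * 1 / 2) (x 1) :=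
      ((((hasDerivAt_id' (x 1)).const_mul ε).div_const 2).const_add _).add_const _
    have h2 : HasDerivAt (fun s : ℂ => (x 0 / 2 + ε * s / 2 + b, s)) (ε * 1 / 2, 1) (x 1) :=
      h1.prodMk (hasDerivAt_id' (x 1))
    have h3 := HasFDerivAt.comp_hasDerivAt
      (f := fun s : ℂ => (x 0 / 2 + ε * s / 2 + b, s)) (x 1)
      (hasFDerivAt_jacobiTheta₂_heat (w x) hx) h2
    refine h3.congr_deriv ?_
    simp
  have hF1 : partialAt F 1 x = E x * (Real.pi * Complex.I * ε ^ 2 / 4) * jacobiTheta₂ (w x) (x 1) +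
      E x * (jacobiTheta₂' (w x) (x 1) * (ε / 2) +
        -Complex.I / (4 * Real.pi) * deriv (fun u => jacobiTheta₂' u (x 1)) (w x)) := by
    refine (hasPartialAt_of_hasDerivAt_update (han x hx).differentiableAt ?_).2
    have h := hE1.mul hJτ
    simp only [Function.update_eq_self] at h
    simp only [thetaTranslate, Function.update_self,
      Function.update_of_ne (show (0 : Fin 2) ≠ 1 by decide)]
    simp only [E, Function.update_self,
      Function.update_of_ne (show (0 : Fin 2) ≠ 1 by decide)] at h
    exact h
  rw [hF1, hF00]
  field_simp
  linear_combination 4 * (E x * (jacobiTheta₂ (w x) (x 1) * ε ^ 2 * Real.pi ^ 2 * Complex.I +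
    2 * Real.pi * ε * jacobiTheta₂' (w x) (x 1))) * Complex.I_sq

theorem thetaOneTilde_eq_thetaTranslate (x : Fin 2 → ℂ) :
    thetaOneTilde (x 0) (x 1) = thetaTranslate (-Complex.I) 1 (1 / 2) x := by
  rw [thetaOneTilde_eq, thetaTranslate]
  simp only [one_mul, one_pow]

theorem exists_thetaEven_eq_thetaTranslate (j : Fin 3) : ∃ C ε b : ℂ, ∀ x : Fin 2 → ℂ,
    thetaEven j (x 0) (x 1) = thetaTranslate C ε b x := by
  fin_cases j
  · refine ⟨-Complex.I * Complex.exp (Real.pi * Complex.I / 2), 1, 1, fun x => ?_⟩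
    change thetaEven 0 _ _ = _
    rw [thetaEven_zero_eq, thetaOneTilde_eq, thetaTranslate, mul_assoc (-Complex.I)
      (Complex.exp (Real.pi * Complex.I / 2)),
      ← Complex.exp_add]
    congr 2
    · congr 2; ring
    · ring
  · refine ⟨1, 0, 0, fun x => ?_⟩
    change thetaEven 1 _ _ = _
    simp [thetaEven_one_eq, thetaTranslate]
  · refine ⟨1, 0, 1 / 2, fun x => ?_⟩
    change thetaEven 2 _ _ = _
    simp [thetaEven_two_eq, thetaTranslate]

/-! ### Differential equations of the thetanulls -/

/-- The heat equation with the constant of the scaled theta functions. -/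
def SatisfiesHeat (F : (Fin 2 → ℂ) → ℂ) : Prop :=
  AnalyticOnNhd ℂ F planeTimesUpper ∧ ∀ x ∈ planeTimesUpper,
    partialAt F 1 x = -Complex.I / Real.pi * partialAt (partialAt F 0) 0 x

/-- `∂_z` commutes with the heat operator. Applied twice, this expresses second `τ`-derivatives by
fourth `z`-derivatives. -/
theorem SatisfiesHeat.partialAt_zero {F : (Fin 2 → ℂ) → ℂ} (hF : SatisfiesHeat F) :
    SatisfiesHeat (partialAt F 0) := by
  have h0 : AnalyticOnNhd ℂ (partialAt F 0) planeTimesUpper := fun x hx => (hF.1 x hx).partialAt 0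
  have h00 : AnalyticOnNhd ℂ (partialAt (partialAt F 0) 0) planeTimesUpper := fun x hx =>
    (h0 x hx).partialAt 0
  refine ⟨h0, fun x hx => ?_⟩
  rw [partialAt_comm (hF.1 x hx)]
  exact (((h00 x hx).hasPartialAt 0).const_mul _ |>.congr_on isOpen_planeTimesUpper hx hF.2).2

theorem satisfiesHeat_thetaOneTilde :
    SatisfiesHeat fun x : Fin 2 → ℂ => thetaOneTilde (x 0) (x 1) := by
  rw [funext thetaOneTilde_eq_thetaTranslate]
  exact ⟨analyticOnNhd_thetaTranslate _ _ _, fun x hx => heat_thetaTranslate _ _ _ hx⟩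

theorem satisfiesHeat_thetaEven (j : Fin 3) :
    SatisfiesHeat fun x : Fin 2 → ℂ => thetaEven j (x 0) (x 1) := by
  obtain ⟨C, ε, b, h⟩ := exists_thetaEven_eq_thetaTranslate j
  rw [funext h]
  exact ⟨analyticOnNhd_thetaTranslate _ _ _, fun x hx => heat_thetaTranslate _ _ _ hx⟩

theorem SatisfiesHeat.hasDerivAt {F : (Fin 2 → ℂ) → ℂ} (hF : SatisfiesHeat F) {τ : ℂ}
    (hτ : 0 < τ.im) : HasDerivAt (fun s => F ![0, s])
      (-Complex.I / Real.pi * partialAt (partialAt F 0) 0 ![0, τ]) τ := by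
  have hx : (![0, τ] : Fin 2 → ℂ) ∈ planeTimesUpper := by simpa [planeTimesUpper] using hτ
  have hup : ∀ s : ℂ, Function.update (![0, τ] : Fin 2 → ℂ) 1 s = ![0, s] := fun s => by
    ext i; fin_cases i <;> simp
  have h : HasPartialAt F 1 (partialAt F 1 ![0, τ])
      (Function.update (![0, τ] : Fin 2 → ℂ) 1 τ) := by
    rw [hup]; exact (hF.1 _ hx).hasPartialAt 1
  have h2 := h.hasDerivAt_update
  simp only [hup] at h2
  rwa [hF.2 _ hx] at h2

theorem hasDerivAt_thetaNull (j : Fin 3) {τ : ℂ} (hτ : 0 < τ.im) :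
    HasDerivAt (thetaNull j)
      (-Complex.I / Real.pi * deriv^[2] (fun z => thetaEven j z τ) 0) τ := by
  have hF := satisfiesHeat_thetaEven j
  have hx : (![0, τ] : Fin 2 → ℂ) ∈ planeTimesUpper := by simpa [planeTimesUpper] using hτ
  have h := hF.hasDerivAt hτ
  have h2 := (iterate_partialAt_zero hF.1 2).2 _ hx
  simp only [Function.update_self, Function.update_of_ne (show (1 : Fin 2) ≠ 0 by decide),
    Matrix.cons_val_zero, Matrix.cons_val_one] at h2
  rw [← h2]
  simp only [Matrix.cons_val_zero, Matrix.cons_val_one, thetaEven_at_zero] at h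
  exact h

theorem hasDerivAt_deriv_thetaNull (j : Fin 3) {τ : ℂ} (hτ : 0 < τ.im) :
    HasDerivAt (deriv (thetaNull j))
      ((-Complex.I / Real.pi) ^ 2 * deriv^[4] (fun z => thetaEven j z τ) 0) τ := by
  have hF := satisfiesHeat_thetaEven j
  have hx : ∀ s : ℂ, 0 < s.im → (![0, s] : Fin 2 → ℂ) ∈ planeTimesUpper := fun s hs => by
    simpa [planeTimesUpper] using hs
  have h := (hF.partialAt_zero.partialAt_zero.hasDerivAt hτ).const_mul (-Complex.I / Real.pi)
  have h4 := (iterate_partialAt_zero hF.1 4).2 _ (hx τ hτ)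
  simp only [Function.update_self, Function.update_of_ne (show (1 : Fin 2) ≠ 0 by decide),
    Matrix.cons_val_zero, Matrix.cons_val_one] at h4
  rw [← h4, pow_two, mul_assoc]
  refine h.congr_of_eventuallyEq ?_
  filter_upwards [(isOpen_lt continuous_const Complex.continuous_im).mem_nhds hτ] with s hs
  have h2 := (iterate_partialAt_zero hF.1 2).2 _ (hx s hs)
  simp only [Function.update_self, Function.update_of_ne (show (1 : Fin 2) ≠ 0 by decide),
    Matrix.cons_val_zero, Matrix.cons_val_one] at h2
  rw [(hasDerivAt_thetaNull j hs).deriv, ← h2]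
  rfl

/-- The logarithmic `δ`-derivative of a thetanull. -/
noncomputable def thetaLogDelta (j : Fin 3) (τ : ℂ) : ℂ :=
  deltaDeriv (thetaNull j) τ / thetaNull j τ

/-- The mean of the logarithmic `δ`-derivatives of the thetanulls. -/
noncomputable def thetaLogMean (τ : ℂ) : ℂ :=
  (thetaLogDelta 0 τ + thetaLogDelta 1 τ + thetaLogDelta 2 τ) / 3

/-- `δ² ϑⱼ / ϑⱼ` in terms of the logarithmic `δ`-derivatives. -/
noncomputable def thetaSecond (j : Fin 3) (τ : ℂ) : ℂ :=
  3 * thetaLogDelta j τ ^ 2 - 6 * (thetaLogDelta j τ - thetaLogMean τ) ^ 2 +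
    ((thetaLogDelta 0 τ - thetaLogMean τ) ^ 2 + (thetaLogDelta 1 τ - thetaLogMean τ) ^ 2 +
      (thetaLogDelta 2 τ - thetaLogMean τ) ^ 2)

/-- The heat equation reads `δ = -π⁻² ∂_z²` on the even theta functions, so their second Taylor data
give `e j = c + π² ψ_j` with `ψ_j` the logarithmic `δ`-derivative. The sum of the `e j` is `0`,
which yields `c`; inserting both into the fourth derivative eliminates all quantities other than the
`ψ_j`. -/
theorem thetaNull_main (τ : UpperHalfPlane) :
    (∀ z, z ∉ (halfPeriodPair τ).lattice →
      deriv (fun z => thetaOneTilde z τ) z / thetaOneTilde z τ =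
        zetaTau z τ + -(Real.pi ^ 2 * thetaLogMean τ) * z) ∧
    ∀ j, thetaNull j τ ≠ 0 ∧
      1 / (Real.pi * Complex.I) * (1 / (Real.pi * Complex.I) * deriv (deriv (thetaNull j)) τ) =
        thetaSecond j τ * thetaNull j τ := by
  obtain ⟨c, e, hc, he, h⟩ := exists_thetaEven_taylor τ
  have hpi : (Real.pi : ℂ) ≠ 0 := by exact_mod_cast Real.pi_ne_zero
  have hI := Complex.I_ne_zero
  have hψ : ∀ j, e j = c + Real.pi ^ 2 * thetaLogDelta j τ := fun j => by
    rw [thetaLogDelta, deltaDeriv, (hasDerivAt_thetaNull j τ.im_pos).deriv, (h j).2.1]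
    have := (h j).1
    field_simp
    ring
  have hcm : c = -(Real.pi ^ 2 * thetaLogMean τ) := by
    rw [hψ 0, hψ 1, hψ 2] at he
    rw [thetaLogMean]
    linear_combination he / 3
  refine ⟨fun z hz => by rw [hc z hz, hcm], fun j => ⟨(h j).1, ?_⟩⟩
  rw [(hasDerivAt_deriv_thetaNull j τ.im_pos).deriv, (h j).2.2, hψ j, hψ 0, hψ 1, hψ 2, hcm,
    thetaSecond]
  field_simp
  ring

theorem analyticAt_thetaNull (j : Fin 3) {τ : ℂ} (hτ : 0 < τ.im) :
    AnalyticAt ℂ (thetaNull j) τ :=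
  DifferentiableOn.analyticAt (s := {s : ℂ | 0 < s.im})
    (fun _ hs => (hasDerivAt_thetaNull j hs).differentiableAt.differentiableWithinAt)
    ((isOpen_lt continuous_const Complex.continuous_im).mem_nhds hτ)

theorem analyticAt_deltaDeriv_thetaNull (j : Fin 3) {τ : ℂ} (hτ : 0 < τ.im) :
    AnalyticAt ℂ (deltaDeriv (thetaNull j)) τ :=
  analyticAt_const.fun_mul (analyticAt_thetaNull j hτ).deriv

theorem thetaNull_ne_zero (j : Fin 3) {τ : ℂ} (hτ : 0 < τ.im) : thetaNull j τ ≠ 0 :=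
  ((thetaNull_main ⟨τ, hτ⟩).2 j).1

theorem hasDerivAt_thetaNull_delta (j : Fin 3) {τ : ℂ} (hτ : 0 < τ.im) :
    HasDerivAt (thetaNull j) (Real.pi * Complex.I * deltaDeriv (thetaNull j) τ) τ := by
  refine (analyticAt_thetaNull j hτ).differentiableAt.hasDerivAt.congr_deriv ?_
  have hpi : (Real.pi : ℂ) ≠ 0 := by exact_mod_cast Real.pi_ne_zero
  have hI := Complex.I_ne_zero
  rw [deltaDeriv]; field_simp

theorem hasDerivAt_deltaDeriv_thetaNull (j : Fin 3) {τ : ℂ} (hτ : 0 < τ.im) :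
    HasDerivAt (deltaDeriv (thetaNull j))
      (Real.pi * Complex.I * (thetaSecond j τ * thetaNull j τ)) τ := by
  have hpi : (Real.pi : ℂ) ≠ 0 := by exact_mod_cast Real.pi_ne_zero
  have hI := Complex.I_ne_zero
  have h := ((thetaNull_main ⟨τ, hτ⟩).2 j).2
  simp only at h
  rw [← h]
  refine ((hasDerivAt_deriv_thetaNull j hτ).const_mul (1 / (Real.pi * Complex.I))).congr_deriv ?_
  rw [(hasDerivAt_deriv_thetaNull j hτ).deriv]
  field_simp

theorem hasDerivAt_thetaLogDelta (j : Fin 3) {τ : ℂ} (hτ : 0 < τ.im) :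
    HasDerivAt (thetaLogDelta j)
      (Real.pi * Complex.I * (thetaSecond j τ - thetaLogDelta j τ ^ 2)) τ := by
  have h0 := thetaNull_ne_zero j hτ
  refine ((hasDerivAt_deltaDeriv_thetaNull j hτ).fun_div (hasDerivAt_thetaNull_delta j hτ)
    h0).congr_deriv ?_
  rw [thetaLogDelta]
  field_simp

/-- The `τ`-derivative of `thetaLogMean`, up to the factor `π i`. -/
noncomputable def thetaLogMeanDelta (τ : ℂ) : ℂ :=
  ((thetaSecond 0 τ - thetaLogDelta 0 τ ^ 2) + (thetaSecond 1 τ - thetaLogDelta 1 τ ^ 2) +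
    (thetaSecond 2 τ - thetaLogDelta 2 τ ^ 2)) / 3

theorem hasDerivAt_thetaLogMean {τ : ℂ} (hτ : 0 < τ.im) :
    HasDerivAt thetaLogMean (Real.pi * Complex.I * thetaLogMeanDelta τ) τ := by
  refine ((((hasDerivAt_thetaLogDelta 0 hτ).fun_add (hasDerivAt_thetaLogDelta 1 hτ)).fun_add
    (hasDerivAt_thetaLogDelta 2 hτ)).div_const 3).congr_deriv ?_
  rw [thetaLogMeanDelta]; ring

theorem analyticAt_thetaLogMean {τ : ℂ} (hτ : 0 < τ.im) : AnalyticAt ℂ thetaLogMean τ :=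
  DifferentiableOn.analyticAt (s := {s : ℂ | 0 < s.im})
    (fun _ hs => (hasDerivAt_thetaLogMean hs).differentiableAt.differentiableWithinAt)
    ((isOpen_lt continuous_const Complex.continuous_im).mem_nhds hτ)

/-! ### The two-variable system of `ϑ₁` and `ζ` -/

/-- The points of `ℂ × ℍ` where `ϑ₁(π z / 2; τ)` does not vanish. -/
def thetaRegular : Set (Fin 2 → ℂ) :=
  {x | x ∈ planeTimesUpper ∧ thetaOneTilde (x 0) (x 1) ≠ 0}

theorem isOpen_thetaRegular : IsOpen thetaRegular :=
  ContinuousOn.isOpen_inter_preimage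
    (f := fun x : Fin 2 → ℂ => thetaOneTilde (x 0) (x 1))
    (fun x hx => (satisfiesHeat_thetaOneTilde.1 x hx).continuousAt.continuousWithinAt)
    isOpen_planeTimesUpper isOpen_compl_singleton

theorem coe_ofComplex_of_mem {x : Fin 2 → ℂ} (hx : x ∈ planeTimesUpper) :
    (UpperHalfPlane.ofComplex (x 1) : ℂ) = x 1 := by
  rw [UpperHalfPlane.ofComplex_apply_of_im_pos hx]

theorem mem_thetaRegular_iff {x : Fin 2 → ℂ} : x ∈ thetaRegular ↔
    x ∈ planeTimesUpper ∧ x 0 ∉ (halfPeriodPair (UpperHalfPlane.ofComplex (x 1))).lattice := by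
  refine and_congr_right fun hx => ?_
  rw [← thetaOneTilde_eq_zero_iff, coe_ofComplex_of_mem hx]

/-- The coefficient `c` in `ϑ₁' / ϑ₁ = ζ + c z`. -/
noncomputable def zetaCorrection (τ : ℂ) : ℂ := -(Real.pi ^ 2 * thetaLogMean τ)

theorem hasPartialAt_zetaCorrection (j : Fin 2) {x : Fin 2 → ℂ} (hx : x ∈ planeTimesUpper) :
    HasPartialAt (fun x => zetaCorrection (x 1)) j
      (if j = 1 then -(Real.pi ^ 2 * (Real.pi * Complex.I * thetaLogMeanDelta (x 1))) else 0) x :=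
  HasPartialAt.comp_coord 1 ((hasDerivAt_thetaLogMean hx).const_mul _).fun_neg j

theorem analyticAt_coord {n : ℕ} (i : Fin n) (x : Fin n → ℂ) :
    AnalyticAt ℂ (fun y : Fin n → ℂ => y i) x :=
  (ContinuousLinearMap.proj (R := ℂ) (φ := fun _ : Fin n => ℂ) i).analyticAt x

theorem analyticAt_zetaCorrection {x : Fin 2 → ℂ} (hx : x ∈ planeTimesUpper) :
    AnalyticAt ℂ (fun x : Fin 2 → ℂ => zetaCorrection (x 1)) x :=
  AnalyticAt.fun_comp (f := fun x : Fin 2 → ℂ => x 1) (g := zetaCorrection)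
    (analyticAt_const.fun_mul (analyticAt_thetaLogMean hx)).neg (analyticAt_coord 1 x)

theorem partialAt_zero_thetaOneTilde {x : Fin 2 → ℂ} (hx : x ∈ thetaRegular) :
    partialAt (fun x => thetaOneTilde (x 0) (x 1)) 0 x =
      thetaOneTilde (x 0) (x 1) * (onPlane zetaTau x + zetaCorrection (x 1) * x 0) := by
  have h := (mem_thetaRegular_iff.1 hx).2
  have h1 := (thetaNull_main (UpperHalfPlane.ofComplex (x 1))).1 _ h
  rw [coe_ofComplex_of_mem hx.1] at h1
  have h2 : HasPartialAt (fun x : Fin 2 → ℂ => thetaOneTilde (x 0) (x 1)) 0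
      (partialAt (fun x => thetaOneTilde (x 0) (x 1)) 0 x) (Function.update x 0 (x 0)) := by
    rw [Function.update_eq_self]; exact (satisfiesHeat_thetaOneTilde.1 x hx.1).hasPartialAt 0
  have h3 := h2.hasDerivAt_update
  simp only [Function.update_self, Function.update_of_ne (show (1 : Fin 2) ≠ 0 by decide)] at h3
  rw [div_eq_iff hx.2, h3.deriv] at h1
  rw [h1, onPlane, zetaCorrection]; ring

/-- Joint analyticity comes from `ζ = ∂_z ϑ₁ / ϑ₁ - c z`, where `ϑ₁` and `c` are known to be
analytic, and not from the lattice sum. -/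
theorem analyticOnNhd_onPlane_zetaTau : AnalyticOnNhd ℂ (onPlane zetaTau) thetaRegular := by
  intro x hx
  have h : AnalyticAt ℂ (fun x : Fin 2 → ℂ => partialAt (fun x => thetaOneTilde (x 0) (x 1)) 0 x /
      thetaOneTilde (x 0) (x 1) - zetaCorrection (x 1) * x 0) x :=
    (((satisfiesHeat_thetaOneTilde.1 x hx.1).partialAt 0).fun_div
      (satisfiesHeat_thetaOneTilde.1 x hx.1) hx.2).fun_sub
      ((analyticAt_zetaCorrection hx.1).fun_mul (analyticAt_coord 0 x))
  refine h.congr ?_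
  filter_upwards [isOpen_thetaRegular.mem_nhds hx] with y hy
  have := hy.2
  rw [partialAt_zero_thetaOneTilde hy]
  field_simp
  ring

/-- The iterated `z`-derivatives of `ζ` as functions of two variables. -/
noncomputable def zetaIter (k : ℕ) : (Fin 2 → ℂ) → ℂ :=
  onPlane fun z τ => iteratedDeriv k (fun w => zetaTau w τ) z

theorem zetaIter_zero : zetaIter 0 = onPlane zetaTau := by
  funext x; simp [zetaIter, onPlane]

theorem zetaIter_spec (k : ℕ) : AnalyticOnNhd ℂ (zetaIter k) thetaRegular ∧
    ∀ x ∈ thetaRegular, partialAt (zetaIter k) 0 x = zetaIter (k + 1) x := by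
  have hstep : ∀ k, AnalyticOnNhd ℂ (zetaIter k) thetaRegular →
      ∀ x ∈ thetaRegular, partialAt (zetaIter k) 0 x = zetaIter (k + 1) x := fun k hk x hx => by
    have h1 : HasPartialAt (zetaIter k) 0 (partialAt (zetaIter k) 0 x)
        (Function.update x 0 (x 0)) := by
      rw [Function.update_eq_self]; exact (hk x hx).hasPartialAt 0
    rw [← h1.hasDerivAt_update.deriv]
    change _ = iteratedDeriv (k + 1) (fun w => zetaTau w (UpperHalfPlane.ofComplex (x 1))) (x 0)
    rw [iteratedDeriv_succ]
    simp only [zetaIter, onPlane, Function.update_self,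
      Function.update_of_ne (show (1 : Fin 2) ≠ 0 by decide)]
  have han : AnalyticOnNhd ℂ (zetaIter k) thetaRegular := by
    induction k with
    | zero => rw [zetaIter_zero]; exact analyticOnNhd_onPlane_zetaTau
    | succ k ih =>
      intro x hx
      refine ((ih x hx).partialAt 0).congr ?_
      filter_upwards [isOpen_thetaRegular.mem_nhds hx] with y hy using hstep k ih y hy
  exact ⟨han, hstep k han⟩

/-- Differentiating `℘'' = 6 ℘² - g₂ / 2` once more removes `g₂`. This closes the chain in the
`z`-direction. -/
theorem iteratedDeriv_zetaTau (τ : UpperHalfPlane) {z : ℂ} (hz : z ∉ (halfPeriodPair τ).lattice) :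
    iteratedDeriv 1 (fun w => zetaTau w τ) z = -wpTau z τ ∧
    iteratedDeriv 4 (fun w => zetaTau w τ) z =
      -12 * iteratedDeriv 1 (fun w => zetaTau w τ) z *
        iteratedDeriv 2 (fun w => zetaTau w τ) z := by
  set L := halfPeriodPair τ
  have hopen : IsOpen (L.lattice : Set ℂ)ᶜ := L.isClosed_lattice.isOpen_compl
  have hstep : ∀ {k : ℕ} {G g' : ℂ → ℂ},
      (∀ z ∉ L.lattice, iteratedDeriv k (fun w => zetaTau w τ) z = G z) →
      (∀ z ∉ L.lattice, HasDerivAt G (g' z) z) →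
      ∀ z ∉ L.lattice, iteratedDeriv (k + 1) (fun w => zetaTau w τ) z = g' z :=
    fun hg hG z hz => by
      rw [iteratedDeriv_succ]
      exact ((hG z hz).congr_of_eventuallyEq
        (Filter.mem_of_superset (hopen.mem_nhds hz) fun w hw => hg w hw)).deriv
  have d0 : ∀ z ∉ L.lattice, iteratedDeriv 0 (fun w => zetaTau w τ) z = L.weierstrassZeta z :=
    fun z _ => by simp [zetaTau, PeriodPair.weierstrassZeta, L]
  have d1 := hstep d0 fun z hz => L.hasDerivAt_weierstrassZeta hz
  have d2 := hstep d1 fun z hz => (L.hasDerivAt_weierstrassP hz).fun_neg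
  have d3 := hstep d2 fun z hz => (L.hasDerivAt_derivWeierstrassP hz).fun_neg
  have d4 := hstep d3 fun z hz =>
    ((((L.hasDerivAt_weierstrassP hz).fun_pow 2).const_mul 6).sub_const (L.g₂ / 2)).fun_neg
  refine ⟨d1 z hz, ?_⟩
  have e1 := d1 z hz
  have e2 := d2 z hz
  have e4 := d4 z hz
  simp only [zero_add, Nat.reduceAdd] at e1 e2 e4
  rw [e4, e1, e2]
  push_cast; ring

theorem zetaIter_one {x : Fin 2 → ℂ} (hx : x ∈ thetaRegular) :
    zetaIter 1 x = -onPlane wpTau x :=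
  (iteratedDeriv_zetaTau _ (mem_thetaRegular_iff.1 hx).2).1

theorem zetaIter_four {x : Fin 2 → ℂ} (hx : x ∈ thetaRegular) :
    zetaIter 4 x = -12 * zetaIter 1 x * zetaIter 2 x :=
  (iteratedDeriv_zetaTau _ (mem_thetaRegular_iff.1 hx).2).2

theorem hasPartialAt_zetaIter_zero (k : ℕ) {x : Fin 2 → ℂ} (hx : x ∈ thetaRegular) :
    HasPartialAt (zetaIter k) 0 (zetaIter (k + 1) x) x :=
  ⟨((zetaIter_spec k).1 x hx).differentiableAt, (zetaIter_spec k).2 x hx⟩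

/-- `ζ + c z`, the logarithmic derivative of `ϑ₁`. -/
noncomputable def thetaLogDeriv (x : Fin 2 → ℂ) : ℂ := zetaIter 0 x + zetaCorrection (x 1) * x 0

theorem hasPartialAt_thetaLogDeriv_zero {x : Fin 2 → ℂ} (hx : x ∈ thetaRegular) :
    HasPartialAt thetaLogDeriv 0 (zetaIter 1 x + zetaCorrection (x 1)) x :=
  ((hasPartialAt_zetaIter_zero 0 hx).add
    ((hasPartialAt_zetaCorrection 0 hx.1).mul (hasPartialAt_coord 0 0 x))).congr_value (by simp)

theorem hasPartialAt_thetaOneTilde_zero {x : Fin 2 → ℂ} (hx : x ∈ thetaRegular) :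
    HasPartialAt (fun x => thetaOneTilde (x 0) (x 1)) 0
      (thetaOneTilde (x 0) (x 1) * thetaLogDeriv x) x :=
  ⟨(satisfiesHeat_thetaOneTilde.1 x hx.1).differentiableAt, by
    rw [partialAt_zero_thetaOneTilde hx, thetaLogDeriv, zetaIter_zero]⟩

theorem hasPartialAt_thetaOneTilde_one {x : Fin 2 → ℂ} (hx : x ∈ thetaRegular) :
    HasPartialAt (fun x => thetaOneTilde (x 0) (x 1)) 1
      (-Complex.I / Real.pi * (thetaOneTilde (x 0) (x 1) *
        (thetaLogDeriv x ^ 2 + (zetaIter 1 x + zetaCorrection (x 1))))) x := by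
  refine ⟨(satisfiesHeat_thetaOneTilde.1 x hx.1).differentiableAt, ?_⟩
  rw [satisfiesHeat_thetaOneTilde.2 x hx.1]
  congr 1
  rw [((hasPartialAt_thetaOneTilde_zero hx).mul (hasPartialAt_thetaLogDeriv_zero hx)).congr_on
    isOpen_thetaRegular hx (fun y hy => (hasPartialAt_thetaOneTilde_zero hy).2) |>.2]
  ring

/-- The `τ`-derivative of `ζ`. -/
noncomputable def zetaTauDeriv (x : Fin 2 → ℂ) : ℂ :=
  -Complex.I / Real.pi * (2 * (thetaLogDeriv x * (zetaIter 1 x + zetaCorrection (x 1))) +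
    zetaIter 2 x) +
    Real.pi ^ 2 * (Real.pi * Complex.I * thetaLogMeanDelta (x 1)) * x 0

/-- With `L = ζ + c z`, compare `∂_τ (ϑ₁ L)` and `∂_z` of `∂_τ ϑ₁ = (-i/π) ϑ₁ (L² + ∂_z L)`.
Cancelling `ϑ₁` leaves `∂_τ L = (-i/π) (2 L ∂_z L + ∂_z² L)`, from which `c' z` is subtracted. -/
theorem hasPartialAt_zetaIter_zero_one {x : Fin 2 → ℂ} (hx : x ∈ thetaRegular) :
    HasPartialAt (zetaIter 0) 1 (zetaTauDeriv x) x := by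
  have hZ := ((zetaIter_spec 0).1 x hx).hasPartialAt 1
  have hg : HasPartialAt thetaLogDeriv 1 (partialAt (zetaIter 0) 1 x -
      Real.pi ^ 2 * (Real.pi * Complex.I * thetaLogMeanDelta (x 1)) * x 0) x :=
    (hZ.add ((hasPartialAt_zetaCorrection 1 hx.1).mul (hasPartialAt_coord 0 1 x))).congr_value
      (by simp; ring)
  have h10 := ((hasPartialAt_thetaOneTilde_one hx).mul hg).congr_on isOpen_thetaRegular hx
    (fun y hy => (hasPartialAt_thetaOneTilde_zero hy).2) |>.2
  have hc := (hasPartialAt_zetaIter_zero 1 hx).add (hasPartialAt_zetaCorrection 0 hx.1)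
  have h01 := (((hasPartialAt_thetaOneTilde_zero hx).mul
    ((hasPartialAt_thetaLogDeriv_zero hx).sq.add hc)).const_mul
      (-Complex.I / Real.pi)).congr_on isOpen_thetaRegular hx
    (fun y hy => (hasPartialAt_thetaOneTilde_one hy).2) |>.2
  rw [partialAt_comm (satisfiesHeat_thetaOneTilde.1 x hx.1), h01] at h10
  refine hZ.congr_value ?_
  rw [zetaTauDeriv]
  refine mul_left_cancel₀ hx.2 ?_
  simp only [Fin.isValue, show (0 : Fin 2) ≠ 1 by decide, if_false] at h10
  linear_combination -h10

/-- By the symmetry of mixed partials, the `τ`-derivative of the next `z`-derivative is the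
`z`-derivative of the expression already found. -/
theorem hasPartialAt_zetaIter_succ_one {k : ℕ} {E : (Fin 2 → ℂ) → ℂ} {d : ℂ}
    {x : Fin 2 → ℂ} (hx : x ∈ thetaRegular)
    (hE : ∀ y ∈ thetaRegular, HasPartialAt (zetaIter k) 1 (E y) y) (hd : HasPartialAt E 0 d x) :
    HasPartialAt (zetaIter (k + 1)) 1 d x := by
  refine ⟨((zetaIter_spec (k + 1)).1 x hx).differentiableAt, ?_⟩
  have h1 := (((zetaIter_spec k).1 x hx).partialAt 0).hasPartialAt 1 |>.congr_on
    isOpen_thetaRegular hx (fun y hy => ((zetaIter_spec k).2 y hy).symm)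
  rw [h1.2, partialAt_comm ((zetaIter_spec k).1 x hx)]
  exact (hd.congr_on isOpen_thetaRegular hx fun y hy => (hE y hy).2).2

/-- The `τ`-derivative of `∂ζ/∂z`. -/
noncomputable def zetaTauDeriv₁ (x : Fin 2 → ℂ) : ℂ :=
  -Complex.I / Real.pi * (2 * ((zetaIter 1 x + zetaCorrection (x 1)) ^ 2 +
    thetaLogDeriv x * zetaIter 2 x) + zetaIter 3 x) +
    Real.pi ^ 2 * (Real.pi * Complex.I * thetaLogMeanDelta (x 1))

theorem analyticAt_thetaLogMeanDelta {τ : ℂ} (hτ : 0 < τ.im) :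
    AnalyticAt ℂ thetaLogMeanDelta τ := by
  have h : AnalyticAt ℂ (fun s => (Real.pi * Complex.I)⁻¹ * deriv thetaLogMean s) τ :=
    analyticAt_const.fun_mul (analyticAt_thetaLogMean hτ).deriv
  refine h.congr ?_
  have hpi : (Real.pi : ℂ) ≠ 0 := by exact_mod_cast Real.pi_ne_zero
  have hI := Complex.I_ne_zero
  filter_upwards [(isOpen_lt continuous_const Complex.continuous_im).mem_nhds hτ] with s hs
  rw [(hasDerivAt_thetaLogMean hs).deriv]
  field_simp

theorem hasPartialAt_thetaLogMeanDelta_zero {x : Fin 2 → ℂ} (hx : x ∈ planeTimesUpper) :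
    HasPartialAt (fun x => thetaLogMeanDelta (x 1)) 0 0 x :=
  HasPartialAt.comp_coord 1 (analyticAt_thetaLogMeanDelta hx).differentiableAt.hasDerivAt 0

theorem hasPartialAt_zetaIter_one_one {x : Fin 2 → ℂ} (hx : x ∈ thetaRegular) :
    HasPartialAt (zetaIter 1) 1 (zetaTauDeriv₁ x) x := by
  refine hasPartialAt_zetaIter_succ_one hx (fun y hy => hasPartialAt_zetaIter_zero_one hy) ?_
  have hc := (hasPartialAt_zetaIter_zero 1 hx).add (hasPartialAt_zetaCorrection 0 hx.1)
  have h := (((((hasPartialAt_thetaLogDeriv_zero hx).mul hc).const_mul 2).add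
    (hasPartialAt_zetaIter_zero 2 hx)).const_mul (-Complex.I / Real.pi)).add
    (((hasPartialAt_thetaLogMeanDelta_zero hx.1).const_mul (Real.pi * Complex.I)
      |>.const_mul (Real.pi ^ 2)).mul (hasPartialAt_coord 0 0 x))
  refine h.congr_value ?_
  simp only [zetaTauDeriv₁, Fin.isValue, show (0 : Fin 2) ≠ 1 by decide, if_false, if_true]
  ring

/-- The `τ`-derivative of `∂²ζ/∂z²`. -/
noncomputable def zetaTauDeriv₂ (x : Fin 2 → ℂ) : ℂ :=
  -Complex.I / Real.pi * (6 * ((zetaIter 1 x + zetaCorrection (x 1)) * zetaIter 2 x) +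
    2 * (thetaLogDeriv x * zetaIter 3 x) + -12 * (zetaIter 1 x * zetaIter 2 x))

theorem hasPartialAt_zetaIter_three_zero {x : Fin 2 → ℂ} (hx : x ∈ thetaRegular) :
    HasPartialAt (zetaIter 3) 0 (-12 * (zetaIter 1 x * zetaIter 2 x)) x :=
  (hasPartialAt_zetaIter_zero 3 hx).congr_value (by rw [zetaIter_four hx]; ring)

theorem hasPartialAt_zetaIter_two_one {x : Fin 2 → ℂ} (hx : x ∈ thetaRegular) :
    HasPartialAt (zetaIter 2) 1 (zetaTauDeriv₂ x) x := by
  refine hasPartialAt_zetaIter_succ_one hx (fun y hy => hasPartialAt_zetaIter_one_one hy) ?_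
  have hc := (hasPartialAt_zetaIter_zero 1 hx).add (hasPartialAt_zetaCorrection 0 hx.1)
  have h := ((((hc.sq.add ((hasPartialAt_thetaLogDeriv_zero hx).mul
    (hasPartialAt_zetaIter_zero 2 hx))).const_mul 2).add
    (hasPartialAt_zetaIter_three_zero hx)).const_mul (-Complex.I / Real.pi)).add
    ((hasPartialAt_thetaLogMeanDelta_zero hx.1).const_mul (Real.pi * Complex.I)
      |>.const_mul (Real.pi ^ 2))
  refine h.congr_value ?_
  simp only [zetaTauDeriv₂, Fin.isValue, show (0 : Fin 2) ≠ 1 by decide, if_false]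
  ring

/-- The `τ`-derivative of `∂³ζ/∂z³`. -/
noncomputable def zetaTauDeriv₃ (x : Fin 2 → ℂ) : ℂ :=
  -Complex.I / Real.pi * (6 * zetaIter 2 x ^ 2 +
    8 * ((zetaIter 1 x + zetaCorrection (x 1)) * zetaIter 3 x) +
    -24 * (thetaLogDeriv x * (zetaIter 1 x * zetaIter 2 x)) +
    -12 * (zetaIter 2 x ^ 2 + zetaIter 1 x * zetaIter 3 x))

theorem hasPartialAt_zetaIter_three_one {x : Fin 2 → ℂ} (hx : x ∈ thetaRegular) :
    HasPartialAt (zetaIter 3) 1 (zetaTauDeriv₃ x) x := by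
  refine hasPartialAt_zetaIter_succ_one hx (fun y hy => hasPartialAt_zetaIter_two_one hy) ?_
  have h1 := hasPartialAt_zetaIter_zero 1 hx
  have h2 := hasPartialAt_zetaIter_zero 2 hx
  have hc := h1.add (hasPartialAt_zetaCorrection 0 hx.1)
  have h := ((((hc.mul h2).const_mul 6).add (((hasPartialAt_thetaLogDeriv_zero hx).mul
    (hasPartialAt_zetaIter_three_zero hx)).const_mul 2)).add ((h1.mul h2).const_mul
      (-12))).const_mul (-Complex.I / Real.pi)
  refine h.congr_value ?_
  simp only [zetaTauDeriv₃, Fin.isValue, show (0 : Fin 2) ≠ 1 by decide, if_false]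
  ring

/-! ### Polynomial and rational expressions in a chain -/

section Expressions

variable {n ℓ : ℕ} {U : Set (Fin n → ℂ)} {φ : Fin ℓ → (Fin n → ℂ) → ℂ} {f g : (Fin n → ℂ) → ℂ}

/-- `g` is a polynomial in `x, φ` on `U`. -/
def PolyExpr (U : Set (Fin n → ℂ)) (φ : Fin ℓ → (Fin n → ℂ) → ℂ) (g : (Fin n → ℂ) → ℂ) : Prop :=
  ∃ P : MvPolynomial (Fin n ⊕ Fin ℓ) ℂ, ∀ x ∈ U, g x = evalChain P φ x

theorem polyExpr_const (c : ℂ) : PolyExpr U φ fun _ => c :=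
  ⟨MvPolynomial.C c, fun x _ => by simp [evalChain]⟩

theorem polyExpr_coord (i : Fin n) : PolyExpr U φ fun x => x i :=
  ⟨MvPolynomial.X (Sum.inl i), fun x _ => by simp [evalChain]⟩

theorem polyExpr_chain (i : Fin ℓ) : PolyExpr U φ (φ i) :=
  ⟨MvPolynomial.X (Sum.inr i), fun x _ => by simp [evalChain]⟩

theorem PolyExpr.add (hf : PolyExpr U φ f) (hg : PolyExpr U φ g) :
    PolyExpr U φ fun x => f x + g x := by
  obtain ⟨P, hP⟩ := hf
  obtain ⟨Q, hQ⟩ := hg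
  exact ⟨P + Q, fun x hx => by beta_reduce; rw [hP x hx, hQ x hx]; simp [evalChain]⟩

theorem PolyExpr.mul (hf : PolyExpr U φ f) (hg : PolyExpr U φ g) :
    PolyExpr U φ fun x => f x * g x := by
  obtain ⟨P, hP⟩ := hf
  obtain ⟨Q, hQ⟩ := hg
  exact ⟨P * Q, fun x hx => by beta_reduce; rw [hP x hx, hQ x hx]; simp [evalChain]⟩

theorem PolyExpr.congr (hf : PolyExpr U φ f) (h : ∀ x ∈ U, g x = f x) : PolyExpr U φ g := by
  obtain ⟨P, hP⟩ := hf
  exact ⟨P, fun x hx => by rw [h x hx, hP x hx]⟩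

theorem PolyExpr.evalChain {m : ℕ} {χ : Fin m → (Fin n → ℂ) → ℂ}
    (P : MvPolynomial (Fin n ⊕ Fin m) ℂ) (h : ∀ i, PolyExpr U φ (χ i)) :
    PolyExpr U φ (evalChain P χ) := by
  induction P using MvPolynomial.induction_on with
  | C c => exact (polyExpr_const c).congr fun x _ => by simp [_root_.evalChain]
  | add p q hp hq => exact (hp.add hq).congr fun x _ => by simp [_root_.evalChain]
  | mul_X p i hp =>
    rcases i with i | i
    · exact (hp.mul (polyExpr_coord i)).congr fun x _ => by simp [_root_.evalChain]
    · exact (hp.mul (h i)).congr fun x _ => by simp [_root_.evalChain]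

/-- `g` is a rational function of `x, φ` on `U` whose denominator does not vanish on `U`. -/
def RatExpr (U : Set (Fin n → ℂ)) (φ : Fin ℓ → (Fin n → ℂ) → ℂ) (g : (Fin n → ℂ) → ℂ) : Prop :=
  ∃ Q R : MvPolynomial (Fin n ⊕ Fin ℓ) ℂ, ∀ x ∈ U,
    evalChain R φ x ≠ 0 ∧ g x = evalChain Q φ x / evalChain R φ x

theorem PolyExpr.ratExpr (hf : PolyExpr U φ f) : RatExpr U φ f := by
  obtain ⟨P, hP⟩ := hf
  exact ⟨P, 1, fun x hx => by simp [hP x hx, _root_.evalChain]⟩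

theorem ratExpr_const (c : ℂ) : RatExpr U φ fun _ => c := (polyExpr_const c).ratExpr

theorem ratExpr_coord (i : Fin n) : RatExpr U φ fun x => x i := (polyExpr_coord i).ratExpr

theorem ratExpr_chain (i : Fin ℓ) : RatExpr U φ (φ i) := (polyExpr_chain i).ratExpr

theorem RatExpr.congr (hf : RatExpr U φ f) (h : ∀ x ∈ U, g x = f x) : RatExpr U φ g := by
  obtain ⟨P, R, hP⟩ := hf
  exact ⟨P, R, fun x hx => by rw [h x hx]; exact hP x hx⟩

theorem RatExpr.add (hf : RatExpr U φ f) (hg : RatExpr U φ g) :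
    RatExpr U φ fun x => f x + g x := by
  obtain ⟨P, R, hP⟩ := hf
  obtain ⟨Q, S, hQ⟩ := hg
  refine ⟨P * S + R * Q, R * S, fun x hx => ?_⟩
  obtain ⟨h1, h2⟩ := hP x hx
  obtain ⟨h3, h4⟩ := hQ x hx
  beta_reduce
  rw [h2, h4, div_add_div _ _ h1 h3]
  simp only [evalChain] at h1 h3
  simp [evalChain, h1, h3]

theorem RatExpr.mul (hf : RatExpr U φ f) (hg : RatExpr U φ g) :
    RatExpr U φ fun x => f x * g x := by
  obtain ⟨P, R, hP⟩ := hf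
  obtain ⟨Q, S, hQ⟩ := hg
  refine ⟨P * Q, R * S, fun x hx => ?_⟩
  obtain ⟨h1, h2⟩ := hP x hx
  obtain ⟨h3, h4⟩ := hQ x hx
  beta_reduce
  rw [h2, h4, div_mul_div_comm]
  simp only [evalChain] at h1 h3
  simp [evalChain, h1, h3]

theorem RatExpr.const_mul (c : ℂ) (hf : RatExpr U φ f) : RatExpr U φ fun x => c * f x :=
  (ratExpr_const c).mul hf

theorem RatExpr.neg (hf : RatExpr U φ f) : RatExpr U φ fun x => -f x :=
  (hf.const_mul (-1)).congr fun _ _ => by ring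

theorem RatExpr.sub (hf : RatExpr U φ f) (hg : RatExpr U φ g) :
    RatExpr U φ fun x => f x - g x :=
  (hf.add hg.neg).congr fun _ _ => by ring

theorem RatExpr.sq (hf : RatExpr U φ f) : RatExpr U φ fun x => f x ^ 2 :=
  (hf.mul hf).congr fun _ _ => by ring

theorem RatExpr.div (hf : RatExpr U φ f) (hg : RatExpr U φ g) (h0 : ∀ x ∈ U, g x ≠ 0) :
    RatExpr U φ fun x => f x / g x := by
  obtain ⟨P, R, hP⟩ := hf
  obtain ⟨Q, S, hQ⟩ := hg
  refine ⟨P * S, R * Q, fun x hx => ?_⟩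
  obtain ⟨h1, h2⟩ := hP x hx
  obtain ⟨h3, h4⟩ := hQ x hx
  have h5 := h0 x hx
  rw [h4] at h5
  have h6 : evalChain Q φ x ≠ 0 := fun h => h5 (by rw [h, zero_div])
  beta_reduce
  rw [h2, h4, div_div_div_eq]
  simp only [evalChain] at h1 h6
  simp [evalChain, h1, h6]

theorem satisfiesRationalSystem_of_ratExpr (hU : IsOpen U) (hφ : ∀ i, AnalyticOnNhd ℂ (φ i) U)
    (h : ∀ i j, ∃ g, RatExpr U φ g ∧ ∀ x ∈ U, HasPartialAt (φ i) j (g x) x) :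
    SatisfiesRationalSystem U φ := by
  choose g hg hp using h
  choose Q R hQR using hg
  exact ⟨hU, hφ, Q, R, fun i j x hx =>
    ⟨(hQR i j x hx).1, by rw [(hp i j x hx).2, (hQR i j x hx).2]⟩⟩

/-! ### Rational systems without poles give Noetherian functions -/

theorem analyticOnNhd_evalChain (hφ : ∀ i, AnalyticOnNhd ℂ (φ i) U)
    (P : MvPolynomial (Fin n ⊕ Fin ℓ) ℂ) : AnalyticOnNhd ℂ (evalChain P φ) U := by
  intro x hx
  induction P using MvPolynomial.induction_on with
  | C c =>
    have : evalChain (MvPolynomial.C c) φ = fun _ => c := by funext; simp [evalChain]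
    rw [this]; exact analyticAt_const
  | add p q hp hq =>
    have : evalChain (p + q) φ = fun x => evalChain p φ x + evalChain q φ x := by
      funext; simp [evalChain]
    rw [this]; exact hp.fun_add hq
  | mul_X p i hp =>
    rcases i with i | i
    · have : evalChain (p * MvPolynomial.X (Sum.inl i)) φ = fun x => evalChain p φ x * x i := by
        funext; simp [evalChain]
      rw [this]; exact hp.fun_mul (analyticAt_coord i x)
    · have : evalChain (p * MvPolynomial.X (Sum.inr i)) φ = fun x => evalChain p φ x * φ i x := by
        funext; simp [evalChain]
      rw [this]; exact hp.fun_mul (hφ i x hx)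

theorem exists_hasPartialAt_evalChain {m : ℕ} {χ : Fin m → (Fin n → ℂ) → ℂ} {j : Fin n}
    (hχ : ∀ i, PolyExpr U φ (χ i)) (h : ∀ i, ∃ g, PolyExpr U φ g ∧
      ∀ x ∈ U, HasPartialAt (χ i) j (g x) x) (P : MvPolynomial (Fin n ⊕ Fin m) ℂ) :
    ∃ g, PolyExpr U φ g ∧ ∀ x ∈ U, HasPartialAt (evalChain P χ) j (g x) x := by
  induction P using MvPolynomial.induction_on with
  | C c =>
    refine ⟨fun _ => 0, polyExpr_const 0, fun x _ => ?_⟩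
    have : evalChain (MvPolynomial.C c) χ = fun _ => c := by funext; simp [evalChain]
    rw [this]; exact hasPartialAt_const c j x
  | add p q hp hq =>
    obtain ⟨g₁, h₁, k₁⟩ := hp
    obtain ⟨g₂, h₂, k₂⟩ := hq
    refine ⟨_, h₁.add h₂, fun x hx => ?_⟩
    have : evalChain (p + q) χ = fun x => evalChain p χ x + evalChain q χ x := by
      funext; simp [evalChain]
    rw [this]; exact (k₁ x hx).add (k₂ x hx)
  | mul_X p i hp =>
    obtain ⟨g₁, h₁, k₁⟩ := hp
    have hpe : PolyExpr U φ (evalChain p χ) := PolyExpr.evalChain p hχ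
    rcases i with i | i
    · refine ⟨_, (h₁.mul (polyExpr_coord i)).add (hpe.mul
        (polyExpr_const (if j = i then 1 else 0))), fun x hx => ?_⟩
      have : evalChain (p * MvPolynomial.X (Sum.inl i)) χ = fun x => evalChain p χ x * x i := by
        funext; simp [evalChain]
      rw [this]; exact (k₁ x hx).mul (hasPartialAt_coord i j x)
    · obtain ⟨g₂, h₂, k₂⟩ := h i
      refine ⟨_, (h₁.mul (hχ i)).add (hpe.mul h₂), fun x hx => ?_⟩
      have : evalChain (p * MvPolynomial.X (Sum.inr i)) χ = fun x => evalChain p χ x * χ i x := by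
        funext; simp [evalChain]
      rw [this]; exact (k₁ x hx).mul (k₂ x hx)

/-- The inverse of the product of all denominators, adjoined to `φ`, makes a rational system
polynomial. -/
theorem SatisfiesRationalSystem.isNoetherianFunction (hφ : SatisfiesRationalSystem U φ)
    {Ω : Set (Fin n → ℂ)} (hΩ : IsRelCompactDomain U Ω) (hf : PolyExpr U φ f) :
    IsNoetherianFunction Ω f := by
  obtain ⟨hU, han, Q, R, hQR⟩ := hφ
  obtain ⟨hΩo, hΩc, hΩk, hΩU⟩ := hΩ
  -- One common denominator for all equations, so that a single new function suffices.
  set D : MvPolynomial (Fin n ⊕ Fin ℓ) ℂ := ∏ p : Fin ℓ × Fin n, R p.1 p.2 with hD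
  have hDe : ∀ x, evalChain D φ x = ∏ p : Fin ℓ × Fin n, evalChain (R p.1 p.2) φ x := fun x => by
    simp [hD, evalChain]
  have hD0 : ∀ x ∈ U, evalChain D φ x ≠ 0 := fun x hx => by
    rw [hDe]; exact Finset.prod_ne_zero_iff.2 fun p _ => (hQR p.1 p.2 x hx).1
  have hDan := analyticOnNhd_evalChain han D
  set ψ : Fin (ℓ + 1) → (Fin n → ℂ) → ℂ := Fin.cons (fun x => (evalChain D φ x)⁻¹) φ with hψ
  have hψφ : ∀ i, PolyExpr U ψ (φ i) := fun i => polyExpr_chain (φ := ψ) i.succ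
  have hψD : PolyExpr U ψ fun x => (evalChain D φ x)⁻¹ := polyExpr_chain (φ := ψ) 0
  have hφp : ∀ j i, ∃ g, PolyExpr U ψ g ∧ ∀ x ∈ U, HasPartialAt (φ i) j (g x) x := fun j i => by
    -- `Q / R` is `Q` times the remaining denominators times `D⁻¹`.
    refine ⟨_, ((PolyExpr.evalChain (Q i j) hψφ).mul (PolyExpr.evalChain
      (∏ p ∈ Finset.univ.erase (i, j), R p.1 p.2) hψφ)).mul hψD, fun x hx => ?_⟩
    refine ((han i x hx).hasPartialAt j).congr_value ?_
    have h0 := hD0 x hx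
    have h1 := (hQR i j x hx).1
    have h2 : evalChain D φ x = evalChain (R i j) φ x *
        evalChain (∏ p ∈ Finset.univ.erase (i, j), R p.1 p.2) φ x := by
      rw [hD, ← Finset.mul_prod_erase Finset.univ _ (Finset.mem_univ (i, j))]
      simp [evalChain]
    rw [(hQR i j x hx).2, h2]
    rw [h2] at h0
    have h3 := right_ne_zero_of_mul h0
    field_simp
  have hψp : ∀ i j, ∃ g, PolyExpr U ψ g ∧ ∀ x ∈ U, HasPartialAt (ψ i) j (g x) x := fun i j => by
    refine Fin.cases ?_ (fun i => hφp j i) i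
    -- The new function is covered as well: the derivative of `D⁻¹` is `-D' (D⁻¹)²`, and `D'` is
    -- already polynomial in the enlarged chain.
    obtain ⟨g, hg, hgp⟩ := exists_hasPartialAt_evalChain hψφ (hφp j) D
    refine ⟨_, ((polyExpr_const (-1)).mul hg).mul (hψD.mul hψD), fun x hx => ?_⟩
    refine ((hgp x hx).inv (hD0 x hx)).congr_value ?_
    have := hD0 x hx
    field_simp
  choose g hg hgp using hψp
  choose P hP using hg
  obtain ⟨F, hF⟩ := hf
  obtain ⟨G, hG⟩ := PolyExpr.evalChain (U := U) F hψφ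
  have hsub : Ω ⊆ U := subset_closure.trans hΩU
  refine ⟨ℓ + 1, ψ, G, ⟨hΩo, hΩc, hΩk.isBounded.subset subset_closure, fun i x hx => ?_, P,
    fun i j x hx => ?_⟩, fun x hx => ?_⟩
  · refine Fin.cases ?_ (fun i => han i x (hΩU hx)) i
    exact (hDan x (hΩU hx)).fun_inv (hD0 x (hΩU hx))
  · rw [(hgp i j x (hsub hx)).2, hP i j x (hsub hx)]
  · rw [hF x (hsub hx), hG x (hsub hx)]

end Expressions

/-! ### The rational systems of the thetanulls and of `ζ` -/

theorem analyticAt_thetaNull_coord {n : ℕ} (k : Fin n) (j : Fin 3) {x : Fin n → ℂ}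
    (hx : 0 < (x k).im) : AnalyticAt ℂ (fun x : Fin n → ℂ => thetaNull j (x k)) x :=
  AnalyticAt.fun_comp (f := fun x : Fin n → ℂ => x k) (analyticAt_thetaNull j hx)
    (analyticAt_coord k x)

theorem analyticAt_deltaDeriv_thetaNull_coord {n : ℕ} (k : Fin n) (j : Fin 3) {x : Fin n → ℂ}
    (hx : 0 < (x k).im) : AnalyticAt ℂ (fun x : Fin n → ℂ => deltaDeriv (thetaNull j) (x k)) x :=
  AnalyticAt.fun_comp (f := fun x : Fin n → ℂ => x k) (analyticAt_deltaDeriv_thetaNull j hx)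
    (analyticAt_coord k x)

section ThetaExpressions

variable {n ℓ : ℕ} {U : Set (Fin n → ℂ)} {φ : Fin ℓ → (Fin n → ℂ) → ℂ} {k : Fin n}

/-- Apart from constants, these are the only denominators in both systems; they do not vanish
because the thetanulls have no zeros on `ℍ`. -/
theorem ratExpr_thetaLogDelta (hU : ∀ x ∈ U, 0 < (x k).im)
    (hθ : ∀ j, RatExpr U φ fun x => thetaNull j (x k))
    (hδ : ∀ j, RatExpr U φ fun x => deltaDeriv (thetaNull j) (x k)) (j : Fin 3) :
    RatExpr U φ fun x => thetaLogDelta j (x k) :=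
  (hδ j).div (hθ j) fun x hx => thetaNull_ne_zero j (hU x hx)

theorem ratExpr_thetaLogMean (h : ∀ j, RatExpr U φ fun x => thetaLogDelta j (x k)) :
    RatExpr U φ fun x => thetaLogMean (x k) :=
  (((h 0).add (h 1)).add (h 2)).div (ratExpr_const 3) fun _ _ => three_ne_zero

theorem ratExpr_thetaSecond (h : ∀ j, RatExpr U φ fun x => thetaLogDelta j (x k)) (j : Fin 3) :
    RatExpr U φ fun x => thetaSecond j (x k) := by
  have hm := ratExpr_thetaLogMean h
  exact (((h j).sq.const_mul 3).sub (((h j).sub hm).sq.const_mul 6)).add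
    (((((h 0).sub hm).sq).add (((h 1).sub hm).sq)).add (((h 2).sub hm).sq))

theorem ratExpr_thetaLogMeanDelta (h : ∀ j, RatExpr U φ fun x => thetaLogDelta j (x k)) :
    RatExpr U φ fun x => thetaLogMeanDelta (x k) := by
  have hs := ratExpr_thetaSecond h
  exact ((((hs 0).sub (h 0).sq).add ((hs 1).sub (h 1).sq)).add ((hs 2).sub (h 2).sq)).div
    (ratExpr_const 3) fun _ _ => three_ne_zero

theorem exists_ratExpr_partial_thetaNull (hU : ∀ x ∈ U, 0 < (x k).im)
    (hδ : ∀ j, RatExpr U φ fun x => deltaDeriv (thetaNull j) (x k)) (i : Fin 3) (j : Fin n) :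
    ∃ g, RatExpr U φ g ∧ ∀ x ∈ U, HasPartialAt (fun x => thetaNull i (x k)) j (g x) x := by
  refine ⟨_, (ratExpr_const (if j = k then 1 else 0)).mul
    ((hδ i).const_mul (Real.pi * Complex.I)), fun x hx =>
    (HasPartialAt.comp_coord k (hasDerivAt_thetaNull_delta i (hU x hx)) j).congr_value (by simp)⟩

theorem exists_ratExpr_partial_deltaDeriv (hU : ∀ x ∈ U, 0 < (x k).im)
    (hθ : ∀ j, RatExpr U φ fun x => thetaNull j (x k))
    (hδ : ∀ j, RatExpr U φ fun x => deltaDeriv (thetaNull j) (x k)) (i : Fin 3) (j : Fin n) :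
    ∃ g, RatExpr U φ g ∧
      ∀ x ∈ U, HasPartialAt (fun x => deltaDeriv (thetaNull i) (x k)) j (g x) x := by
  refine ⟨_, (ratExpr_const (if j = k then 1 else 0)).mul
    (((ratExpr_thetaSecond (ratExpr_thetaLogDelta hU hθ hδ) i).mul (hθ i)).const_mul
      (Real.pi * Complex.I)), fun x hx =>
    (HasPartialAt.comp_coord k (hasDerivAt_deltaDeriv_thetaNull i (hU x hx)) j).congr_value
      (by simp)⟩

end ThetaExpressions

/-- The thetanulls and their `δ`-derivatives form a rational system in the coordinate `x k`. -/
theorem satisfiesRationalSystem_thetaNullChain {n : ℕ} (k : Fin n) :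
    SatisfiesRationalSystem {x : Fin n → ℂ | 0 < (x k).im}
      fun i x => thetaNullChain i fun _ => x k := by
  set U := {x : Fin n → ℂ | 0 < (x k).im}
  set φ : Fin 6 → (Fin n → ℂ) → ℂ := fun i x => thetaNullChain i fun _ => x k
  have hU : ∀ x ∈ U, 0 < (x k).im := fun _ hx => hx
  have hθ : ∀ j, RatExpr U φ fun x => thetaNull j (x k) := fun j => by
    fin_cases j
    exacts [ratExpr_chain (φ := φ) 0, ratExpr_chain (φ := φ) 1, ratExpr_chain (φ := φ) 2]
  have hδ : ∀ j, RatExpr U φ fun x => deltaDeriv (thetaNull j) (x k) := fun j => by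
    fin_cases j
    exacts [ratExpr_chain (φ := φ) 3, ratExpr_chain (φ := φ) 4, ratExpr_chain (φ := φ) 5]
  have aθ : ∀ j, AnalyticOnNhd ℂ (fun x : Fin n → ℂ => thetaNull j (x k)) U := fun j x hx =>
    analyticAt_thetaNull_coord k j (hU x hx)
  have aδ : ∀ j, AnalyticOnNhd ℂ (fun x : Fin n → ℂ => deltaDeriv (thetaNull j) (x k)) U :=
    fun j x hx => analyticAt_deltaDeriv_thetaNull_coord k j (hU x hx)
  refine satisfiesRationalSystem_of_ratExpr
    (isOpen_lt continuous_const (Complex.continuous_im.comp (continuous_apply k)))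
    (fun i => ?_) (fun i j => ?_)
  · fin_cases i
    exacts [aθ 0, aθ 1, aθ 2, aδ 0, aδ 1, aδ 2]
  · have pθ := fun i => exists_ratExpr_partial_thetaNull hU hδ i j
    have pδ := fun i => exists_ratExpr_partial_deltaDeriv hU hθ hδ i j
    fin_cases i
    exacts [pθ 0, pθ 1, pθ 2, pδ 0, pδ 1, pδ 2]

/-- In the `z`-direction the derivatives of `ζ` shift along the chain up to `ζ'''' = -12 ζ' ζ''`; in
the `τ`-direction the formulas above use no further functions, since `c` and its derivative are
rational in the thetanull entries. -/
theorem satisfiesRationalSystem_thetaZetaChain :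
    SatisfiesRationalSystem thetaRegular thetaZetaChain := by
  have hU : ∀ x ∈ thetaRegular, 0 < (x 1).im := fun _ hx => hx.1
  have hθ : ∀ j, RatExpr thetaRegular thetaZetaChain fun x => thetaNull j (x 1) := fun j => by
    fin_cases j
    exacts [ratExpr_chain (φ := thetaZetaChain) 0, ratExpr_chain (φ := thetaZetaChain) 1,
      ratExpr_chain (φ := thetaZetaChain) 2]
  have hδ : ∀ j, RatExpr thetaRegular thetaZetaChain fun x => deltaDeriv (thetaNull j) (x 1) :=
    fun j => by
      fin_cases j
      exacts [ratExpr_chain (φ := thetaZetaChain) 3, ratExpr_chain (φ := thetaZetaChain) 4,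
        ratExpr_chain (φ := thetaZetaChain) 5]
  have r : RatExpr thetaRegular thetaZetaChain fun x => thetaOneTilde (x 0) (x 1) :=
    ratExpr_chain (φ := thetaZetaChain) 6
  have r0 : RatExpr thetaRegular thetaZetaChain (zetaIter 0) := by
    rw [zetaIter_zero]; exact ratExpr_chain (φ := thetaZetaChain) 7
  have r1 : RatExpr thetaRegular thetaZetaChain (zetaIter 1) :=
    ratExpr_chain (φ := thetaZetaChain) 8
  have r2 : RatExpr thetaRegular thetaZetaChain (zetaIter 2) :=
    ratExpr_chain (φ := thetaZetaChain) 9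
  have r3 : RatExpr thetaRegular thetaZetaChain (zetaIter 3) :=
    ratExpr_chain (φ := thetaZetaChain) 10
  have hl := ratExpr_thetaLogDelta hU hθ hδ
  have rx : RatExpr thetaRegular thetaZetaChain fun x => x 0 := ratExpr_coord 0
  have rc : RatExpr thetaRegular thetaZetaChain fun x => zetaCorrection (x 1) :=
    ((ratExpr_thetaLogMean hl).const_mul (Real.pi ^ 2)).neg
  have rd : RatExpr thetaRegular thetaZetaChain fun x =>
      Real.pi ^ 2 * (Real.pi * Complex.I * thetaLogMeanDelta (x 1)) :=
    ((ratExpr_thetaLogMeanDelta hl).const_mul (Real.pi * Complex.I)).const_mul (Real.pi ^ 2)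
  have rL : RatExpr thetaRegular thetaZetaChain thetaLogDeriv := r0.add (rc.mul rx)
  have r1c := r1.add rc
  have aθ : ∀ j, AnalyticOnNhd ℂ (fun x : Fin 2 → ℂ => thetaNull j (x 1)) thetaRegular :=
    fun j x hx => analyticAt_thetaNull_coord 1 j (hU x hx)
  have aδ : ∀ j, AnalyticOnNhd ℂ (fun x : Fin 2 → ℂ => deltaDeriv (thetaNull j) (x 1))
      thetaRegular := fun j x hx =>
    analyticAt_deltaDeriv_thetaNull_coord 1 j (hU x hx)
  refine satisfiesRationalSystem_of_ratExpr isOpen_thetaRegular (fun i => ?_) (fun i j => ?_)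
  · fin_cases i
    exacts [aθ 0, aθ 1, aθ 2, aδ 0, aδ 1, aδ 2, fun x hx => satisfiesHeat_thetaOneTilde.1 x hx.1,
      analyticOnNhd_onPlane_zetaTau, (zetaIter_spec 1).1, (zetaIter_spec 2).1, (zetaIter_spec 3).1]
  · have pθ := fun i => exists_ratExpr_partial_thetaNull hU hδ i j
    have pδ := fun i => exists_ratExpr_partial_deltaDeriv hU hθ hδ i j
    have split : ∀ {f d0 d1 : (Fin 2 → ℂ) → ℂ}, RatExpr thetaRegular thetaZetaChain d0 →
        RatExpr thetaRegular thetaZetaChain d1 → (∀ x ∈ thetaRegular, HasPartialAt f 0 (d0 x) x) →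
        (∀ x ∈ thetaRegular, HasPartialAt f 1 (d1 x) x) →
        ∃ g, RatExpr thetaRegular thetaZetaChain g ∧
          ∀ x ∈ thetaRegular, HasPartialAt f j (g x) x := fun h0 h1 p0 p1 => by
      fin_cases j
      exacts [⟨_, h0, p0⟩, ⟨_, h1, p1⟩]
    have q : ∃ g, RatExpr thetaRegular thetaZetaChain g ∧ ∀ x ∈ thetaRegular,
        HasPartialAt (fun x => thetaOneTilde (x 0) (x 1)) j (g x) x :=
      split (r.mul rL) ((r.mul (rL.sq.add r1c)).const_mul (-Complex.I / Real.pi))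
        (fun x hx => hasPartialAt_thetaOneTilde_zero hx)
        (fun x hx => hasPartialAt_thetaOneTilde_one hx)
    have q0 := split r1 (d1 := zetaTauDeriv)
      (((((rL.mul r1c).const_mul 2).add r2).const_mul (-Complex.I / Real.pi)).add (rd.mul rx))
      (fun x hx => hasPartialAt_zetaIter_zero 0 hx) (fun x hx => hasPartialAt_zetaIter_zero_one hx)
    have q1 := split r2 (d1 := zetaTauDeriv₁)
      ((((((r1c.sq).add (rL.mul r2)).const_mul 2).add r3).const_mul (-Complex.I / Real.pi)).add rd)
      (fun x hx => hasPartialAt_zetaIter_zero 1 hx) (fun x hx => hasPartialAt_zetaIter_one_one hx)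
    have q2 := split r3 (d1 := zetaTauDeriv₂)
      (((((r1c.mul r2).const_mul 6).add ((rL.mul r3).const_mul 2)).add
        ((r1.mul r2).const_mul (-12))).const_mul (-Complex.I / Real.pi))
      (fun x hx => hasPartialAt_zetaIter_zero 2 hx) (fun x hx => hasPartialAt_zetaIter_two_one hx)
    have q3 := split ((r1.mul r2).const_mul (-12)) (d1 := zetaTauDeriv₃)
      ((((((r2.sq).const_mul 6).add ((r1c.mul r3).const_mul 8)).add
        ((rL.mul (r1.mul r2)).const_mul (-24))).add
        ((r2.sq.add (r1.mul r3)).const_mul (-12))).const_mul (-Complex.I / Real.pi))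
      (fun x hx => hasPartialAt_zetaIter_three_zero hx)
      (fun x hx => hasPartialAt_zetaIter_three_one hx)
    rw [zetaIter_zero] at q0
    fin_cases i
    exacts [pθ 0, pθ 1, pθ 2, pδ 0, pδ 1, pδ 2, q, q0, q1, q2, q3]

/-! ### Polar loci -/

theorem mem_planeTimesUpper_and_mem_lattice_iff {x : Fin 2 → ℂ} (hx : x ∈ planeTimesUpper) :
    x 0 ∈ (halfPeriodPair (UpperHalfPlane.ofComplex (x 1))).lattice ↔
      ∃ m n : ℤ, x 0 = 2 * (m : ℂ) + 2 * (n : ℂ) * x 1 := by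
  rw [mem_halfPeriodPair_lattice, coe_ofComplex_of_mem hx]

theorem meromorphicOrderAt_zetaTau_neg_iff (z : ℂ) (τ : UpperHalfPlane) :
    meromorphicOrderAt (fun w => zetaTau w τ) z < 0 ↔ z ∈ (halfPeriodPair τ).lattice := by
  by_cases hz : z ∈ (halfPeriodPair τ).lattice
  · have h : meromorphicOrderAt (fun w => zetaTau w τ) z = -1 :=
      (halfPeriodPair τ).meromorphicOrderAt_weierstrassZeta hz
    rw [h]; exact iff_of_true (by decide) hz
  · have h : AnalyticAt ℂ (fun w => zetaTau w τ) z :=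
      (halfPeriodPair τ).analyticAt_weierstrassZeta hz
    exact iff_of_false h.meromorphicOrderAt_nonneg.not_gt hz

theorem meromorphicOrderAt_wpTau_neg_iff (z : ℂ) (τ : UpperHalfPlane) :
    meromorphicOrderAt (fun w => wpTau w τ) z < 0 ↔ z ∈ (halfPeriodPair τ).lattice := by
  by_cases hz : z ∈ (halfPeriodPair τ).lattice
  · have h : meromorphicOrderAt (fun w => wpTau w τ) z = -2 :=
      (halfPeriodPair τ).order_weierstrassP z hz
    rw [h]; exact iff_of_true (by decide) hz
  · have h : AnalyticAt ℂ (fun w => wpTau w τ) z :=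
      (halfPeriodPair τ).analyticOnNhd_weierstrassP z hz
    exact iff_of_false h.meromorphicOrderAt_nonneg.not_gt hz

theorem polarLocus_zetaTau : polarLocus zetaTau = {x | x ∈ planeTimesUpper ∧
    x 0 ∈ (halfPeriodPair (UpperHalfPlane.ofComplex (x 1))).lattice} := by
  ext x
  exact and_congr_right fun _ => meromorphicOrderAt_zetaTau_neg_iff _ _

theorem planeTimesUpper_diff_polarLocus : planeTimesUpper \ polarLocus zetaTau = thetaRegular := by
  ext x
  rw [mem_thetaRegular_iff, polarLocus_zetaTau, Set.mem_sdiff, Set.mem_ofPred_eq]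
  tauto

/-! ### Assembly of the four statements -/

theorem mainTheorem12 :
    -- `ζ` is the primitive of `-℘` normalised by `ζ(z;τ) - 1/z → 0` at `z = 0`
    (∀ τ : UpperHalfPlane,
      (∀ z : ℂ, z ∉ (halfPeriodPair τ).lattice →
        HasDerivAt (fun w => zetaTau w τ) (-wpTau z τ) z) ∧
      Filter.Tendsto (fun z => zetaTau z τ - z⁻¹) (nhdsWithin 0 {0}ᶜ) (nhds 0)) ∧
    -- the polar locus of `ζ` is the zero locus of `ϑ₁(π z / 2;τ)`, is `z ∈ 2ℤ + 2τℤ`, and is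
    -- the polar locus of `℘`
    polarLocus zetaTau = {x | x ∈ planeTimesUpper ∧ thetaOneTilde (x 0) (x 1) = 0} ∧
    polarLocus zetaTau =
      {x | x ∈ planeTimesUpper ∧ ∃ m n : ℤ, x 0 = 2 * (m : ℂ) + 2 * (n : ℂ) * x 1} ∧
    polarLocus wpTau = polarLocus zetaTau ∧
    -- the rational Noetherian systems, without poles outside the polar locus of `ζ`
    SatisfiesRationalSystem {x : Fin 1 → ℂ | 0 < (x 0).im} thetaNullChain ∧
    SatisfiesRationalSystem (planeTimesUpper \ polarLocus zetaTau) thetaZetaChain ∧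
    -- the thetanulls are Noetherian on relatively compact subdomains of `ℍ` and of `ℂ × ℍ`
    (∀ Ω : Set (Fin 1 → ℂ), IsRelCompactDomain {x | 0 < (x 0).im} Ω →
      ∀ j, IsNoetherianFunction Ω fun x => thetaNull j (x 0)) ∧
    (∀ Ω : Set (Fin 2 → ℂ), IsRelCompactDomain planeTimesUpper Ω →
      ∀ j, IsNoetherianFunction Ω fun x => thetaNull j (x 1)) ∧
    -- the remaining functions are Noetherian on relatively compact domains off the polar locus
    (∀ Ω : Set (Fin 2 → ℂ), IsRelCompactDomain (planeTimesUpper \ polarLocus zetaTau) Ω →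
      IsNoetherianFunction Ω (fun x => thetaOneTilde (x 0) (x 1)) ∧
      IsNoetherianFunction Ω (onPlane zetaTau) ∧
      IsNoetherianFunction Ω (onPlane wpTau)) := by
  have hσ := satisfiesRationalSystem_thetaZetaChain
  have hν : thetaNullChain = fun i (x : Fin 1 → ℂ) => thetaNullChain i fun _ => x 0 := by
    funext i x
    congr 1
    funext a
    rw [Subsingleton.elim a 0]
  refine ⟨fun τ => ⟨fun z hz => (halfPeriodPair τ).hasDerivAt_weierstrassZeta hz,
    (halfPeriodPair τ).tendsto_weierstrassZeta_sub_inv⟩, ?_, ?_, ?_,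
    hν ▸ satisfiesRationalSystem_thetaNullChain 0, ?_, fun Ω hΩ j => ?_, fun Ω hΩ j => ?_,
    fun Ω hΩ => ?_⟩
  · rw [polarLocus_zetaTau]
    ext x
    refine and_congr_right fun hx => ?_
    rw [← thetaOneTilde_eq_zero_iff, coe_ofComplex_of_mem hx]
  · rw [polarLocus_zetaTau]
    ext x
    exact and_congr_right fun hx => mem_planeTimesUpper_and_mem_lattice_iff hx
  · rw [polarLocus_zetaTau]
    ext x
    exact and_congr_right fun _ => meromorphicOrderAt_wpTau_neg_iff _ _
  · rw [planeTimesUpper_diff_polarLocus]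
    exact hσ
  · refine (satisfiesRationalSystem_thetaNullChain 0).isNoetherianFunction hΩ ?_
    fin_cases j
    exacts [polyExpr_chain 0, polyExpr_chain 1, polyExpr_chain 2]
  -- The system of the thetanulls alone, read in the coordinate `x 1`, is free of poles on all of `ℂ
  -- × ℍ`, so the polar locus need not be removed.
  · refine (satisfiesRationalSystem_thetaNullChain 1).isNoetherianFunction hΩ ?_
    fin_cases j
    exacts [polyExpr_chain 0, polyExpr_chain 1, polyExpr_chain 2]
  · rw [planeTimesUpper_diff_polarLocus] at hΩ
    refine ⟨hσ.isNoetherianFunction hΩ (polyExpr_chain 6),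
      hσ.isNoetherianFunction hΩ (polyExpr_chain 7), hσ.isNoetherianFunction hΩ ?_⟩
    -- Entry `8` of the chain is `∂_z ζ = -℘`.
    exact ((polyExpr_const (-1)).mul (polyExpr_chain (φ := thetaZetaChain) 8)).congr
      fun x hx => by
        change _ = -1 * zetaIter 1 x
        rw [zetaIter_one hx]; ring
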